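/- Let $G$ be a directed acyclic graph on $n \ge 8$ vertices. Write $u\rightsquigarrow v$ if $v$ is reachable from $u$ in $G$ (with $u\rightsquigarrow u$), and let $\mathrm{TC}(G)=\{(u,v): u\rightsquigarrow v\}$ be the transitive closure. A *chain* is a path in $\mathrm{TC}(G)$. For $\ell>0$, an *$\ell$-chain cover* is a set of at most $\ell$ pairwise vertex-disjoint chains such that every path of $G$ contains at most $2n/\ell$ vertices lying on no chain. A set $H_0$ *super-shortcuts* a set $\mathcal C$ of vertex-disjoint chains if every edge of $H_0$ joins a vertex of some chain of $\mathcal C$ to a later vertex of the same chain, $H_0$ contains all edges between consecutive vertices of each chain, and on each chain every vertex reaches every later vertex by a path of at most $4$ edges of $H_0$. A set $H\subseteq \mathrm{TC}(G)$ is a *shortcut set of hopbound $\beta$* if for all $s\rightsquigarrow t$ there is an $s$–$t$ path with at most $\beta$ edges in $G\cup H$. For a vertex $v$ and a chain $C\in\mathcal C$ that $v$ can reach, let $e(v,C)=(v,w)$, where $w$ is the first vertex of $C$ with $v\rightsquigarrow w$ in $G$, and let $S$ be the set of all such pairs. A path $P$ from $u$ in $G\cup H$ is *valid* if for every $C\in\mathcal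 C$ that it meets, $P\cap C$ is a contiguous segment of $P$ which starts at the second vertex of $e(u,C)$. Let $d'_H(a,b)$ be the minimum number of chains met by a valid path from $a$ to $b$ in $G\cup H$, and let $\phi'(H)=\sum_{(a,b)\in S} d'_H(a,b)$. Consider the following algorithm. 1. Compute a $2n^{2/3}$-chain cover $\mathcal C$ of $G$. 2. Compute a set $H_0$ of $O(n\log^* n)$ edges that super-shortcuts $\mathcal C$, and put $H:=H_0$. 3. As long as some $(a,b)\in S$ has $d'_H(a,b)>n^{1/3}$, add to $H$ an edge of $\mathrm{TC}(G)$ that maximizes the decrease of $\phi'$. Return $H$. **Theorem.** Such $\mathcal C$ and $H_0$ always exist, and for all admissible choices of $\mathcal C$ and $H_0$ and all ways of breaking ties in step 3, the algorithm terminates and its output is a shortcut set of $G$ of hopbound $O(n^{1/3})$ and size $O(n\log^* n)$. Precisely: there is a constant $c_0$ such that for every $c\ge c_0$ there is a constant $K$ such that for every such $G$: a $2n^{2/3}$-chain cover exists; every $2n^{2/3}$-chain cover $\mathcal C$ is super-shortcut by some $H_0$ with $|H_0|\le c\,n\log^* n$; and for every such $\mathcal C$ and $H_0$, step 3 cannot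 run forever, it has an output, and every possible output $H$ is a shortcut set of hopbound $K n^{1/3}$ with $|H|\le K\,n\log^* n$. Here $\log^* n$ is the least $k$ such that the $k$-fold iterated base-2 logarithm of $n$ is at most $1$. -/

import Mathlib

namespace ChainGreedy

variable {V : Type}

/-- Reachability in a directed graph; the trivial path is allowed. -/
def Reaches (G : Digraph V) (u v : V) : Prop := Relation.ReflTransGen G.Adj u v

/-- The transitive closure: an edge `(u, v)` for every pair with a path from `u` to `v`. -/
def tc (G : Digraph V) : Digraph V := ⟨Reaches G⟩

/-- A directed graph without directed cycles (in particular without loops). -/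
def IsDAG (G : Digraph V) : Prop := ∀ v, ¬ Relation.TransGen G.Adj v v

/-- A (simple, directed, nonempty) path, given as the list of its vertices. -/
def IsPath (G : Digraph V) (p : List V) : Prop := p ≠ [] ∧ p.Nodup ∧ p.IsChain G.Adj

/-- `p` is a path of `G` with first vertex `s` and last vertex `t`. -/
def IsPathFromTo (G : Digraph V) (s t : V) (p : List V) : Prop :=
  IsPath G p ∧ p.head? = some s ∧ p.getLast? = some t

/-- The distance from `s` to `t` is at most `β`: some path from `s` to `t` has at most `β` edges. -/
def DistLE (G : Digraph V) (s t : V) (β : ℝ) : Prop :=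
  ∃ p, IsPathFromTo G s t p ∧ (p.length : ℝ) - 1 ≤ β

/-- The graph whose edges are the pairs in `H`. -/
def edgeGraph (H : Set (V × V)) : Digraph V := ⟨fun u v => (u, v) ∈ H⟩

/-- The graph `G ∪ H`. -/
def addEdges (G : Digraph V) (H : Set (V × V)) : Digraph V :=
  ⟨fun u v => G.Adj u v ∨ (u, v) ∈ H⟩

/-- `H` is a shortcut set of `G` with hopbound `β`. -/
def IsShortcutSet (G : Digraph V) (H : Set (V × V)) (β : ℝ) : Prop :=
  (∀ e ∈ H, (tc G).Adj e.1 e.2) ∧ ∀ s t, (tc G).Adj s t → DistLE (addEdges G H) s t β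

/-- The iterated logarithm (base 2): the number of times the logarithm has to be applied to `n`
until the result is at most `1`. -/
noncomputable def logStar (n : ℕ) : ℕ := sInf {k : ℕ | (Real.logb 2)^[k] (n : ℝ) ≤ 1}

/-- A vertex is covered if it lies on one of the chains. -/
def Covered (𝒞 : Finset (List V)) (v : V) : Prop := ∃ C ∈ 𝒞, v ∈ C

/-- `𝒞` is an `ℓ`-chain cover of `G`: at most `ℓ` vertex-disjoint chains (paths in the transitive
closure) such that every path of `G` has at most `2 n / ℓ` vertices that lie on no chain. -/
structure IsChainCover [Fintype V] (G : Digraph V) (ℓ : ℝ) (𝒞 : Finset (List V)) : Prop where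
  isChain : ∀ C ∈ 𝒞, IsPath (tc G) C
  disjoint : (𝒞 : Set (List V)).Pairwise List.Disjoint
  card_le : (𝒞.card : ℝ) ≤ ℓ
  uncovered_le : ∀ p, IsPath G p →
    ({v | v ∈ p ∧ ¬ Covered 𝒞 v}.ncard : ℝ) ≤ 2 * (Fintype.card V : ℝ) / ℓ

/-- `H` super-shortcuts the chains in `𝒞`: it contains the edges between consecutive vertices of
every chain, together with forward edges along the chains, so that on each chain every vertex
reaches every later one by at most `4` edges of `H`. (All edges of `H` run along a chain and the
chains are disjoint, so these edges stay on the chain.) -/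
structure IsSuperShortcut (𝒞 : Finset (List V)) (H : Set (V × V)) : Prop where
  along : ∀ e ∈ H, ∃ C ∈ 𝒞, [e.1, e.2].Sublist C
  consecutive : ∀ C ∈ 𝒞, ∀ u v, [u, v] <:+: C → (u, v) ∈ H
  four_hops : ∀ C ∈ 𝒞, ∀ u v, [u, v].Sublist C → DistLE (edgeGraph H) u v 4

/-- `w` is the earliest node on the chain `C` that `u` can reach in `G`, so `e(u, C) = (u, w)`. -/
def IsEntry (G : Digraph V) (u : V) (C : List V) (w : V) : Prop :=
  ∃ pre post, C = pre ++ w :: post ∧ Reaches G u w ∧ ∀ x ∈ pre, ¬ Reaches G u x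

/-- The set `S` of important pairs `e(v, C)`, for all nodes `v` and all chains `C` that `v` can
reach. -/
def importantPairs (G : Digraph V) (𝒞 : Finset (List V)) : Set (V × V) :=
  {e | ∃ C ∈ 𝒞, IsEntry G e.1 C e.2}

/-- A path `p` starting at `u` is valid if, for every chain `C` that it meets, the nodes of `C`
form a contiguous segment of `p`, and this segment starts at the earliest node on `C` that `u`
can reach in `G`. -/
def IsValid (G : Digraph V) (𝒞 : Finset (List V)) (u : V) (p : List V) : Prop :=
  ∀ C ∈ 𝒞, (∃ x ∈ p, x ∈ C) →
    ∃ pre seg post, p = pre ++ seg ++ post ∧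
      (∀ x ∈ pre, x ∉ C) ∧ (∀ x ∈ seg, x ∈ C) ∧ (∀ x ∈ post, x ∉ C) ∧
      ∃ w, IsEntry G u C w ∧ seg.head? = some w

/-- The number of chains that a path passes through. -/
noncomputable def chainsOn (𝒞 : Finset (List V)) (p : List V) : ℕ :=
  {C | C ∈ 𝒞 ∧ ∃ x ∈ p, x ∈ C}.ncard

/-- The normalized distance `d'(a, b)` in the current graph `G ∪ H`: the minimum number of chains
on a valid path from `a` to `b` (and `⊤` if there is no valid path). -/
noncomputable def normDist (G : Digraph V) (𝒞 : Finset (List V)) (H : Set (V × V)) (a b : V) :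
    ℕ∞ :=
  ⨅ p ∈ {p | IsPathFromTo (addEdges G H) a b p ∧ IsValid G 𝒞 a p}, (chainsOn 𝒞 p : ℕ∞)

/-- The potential `φ'`, the sum of the normalized distances of all important pairs. -/
noncomputable def potential (G : Digraph V) (𝒞 : Finset (List V)) (H : Set (V × V)) : ℕ∞ :=
  ∑ᶠ e ∈ importantPairs G 𝒞, normDist G 𝒞 H e.1 e.2

/-- The amount by which adding the edge `e` decreases the potential. -/
noncomputable def reduction (G : Digraph V) (𝒞 : Finset (List V)) (H : Set (V × V)) (e : V × V) :
    ℕ∞ :=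
  potential G 𝒞 H - potential G 𝒞 (insert e H)

/-- The stopping condition of the greedy loop: all important pairs have normalized distance at
most `n ^ (1/3)` (equivalently, at most its integer part). -/
def Done [Fintype V] (G : Digraph V) (𝒞 : Finset (List V)) (H : Set (V × V)) : Prop :=
  ∀ e ∈ importantPairs G 𝒞,
    normDist G 𝒞 H e.1 e.2 ≤ (⌊(Fintype.card V : ℝ) ^ (1 / 3 : ℝ)⌋₊ : ℕ∞)

/-- One iteration of the greedy loop: the stopping condition fails, and an edge of the transitive
closure that maximizes the reduction of the potential is added (ties are broken arbitrarily). -/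
def GreedyStep [Fintype V] (G : Digraph V) (𝒞 : Finset (List V)) (H H' : Set (V × V)) : Prop :=
  ¬ Done G 𝒞 H ∧ ∃ e : V × V, (tc G).Adj e.1 e.2 ∧
    (∀ e' : V × V, (tc G).Adj e'.1 e'.2 → reduction G 𝒞 H e' ≤ reduction G 𝒞 H e) ∧
    H' = insert e H

/-- The greedy loop, started with the edge set `H₀`, can stop with the edge set `H`. -/
def IsGreedyOutput [Fintype V] (G : Digraph V) (𝒞 : Finset (List V)) (H₀ H : Set (V × V)) :
    Prop :=
  Relation.ReflTransGen (GreedyStep G 𝒞) H₀ H ∧ Done G 𝒞 H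

end ChainGreedy

/-!
Normalized distances are governed by the entry points of the chains. Fix a source `a` and the
current edge set `H`. In a directed acyclic graph, a path from `x` is valid exactly if it enters
each chain at the entry point of `x` (`exists_vWalk_of_isValid`, `VWalk.exists_isValidList`), and an
entry point of `a` is also the entry point of every vertex between `a` and it. So the entry points
of `a`, ordered by reachability, carry heights (distances from `a`), costs (distances between them)
and steps (one chain can be left for another directly); `StepSystem` records what is needed of
them. An optimal path from `x` to `v` can be cut at its last chain unless the entry points of `x`
and `a` on that chain differ, and then some entry point directly before `v` is not reached from `x`.

The core is `StepSystem.exists_lt_gain`: if some height `T` is large and there are at most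
`2 * T ^ 2` entry points, then a single new edge decreases the sum of all costs by the order of
`T ^ 3`.
Suppose that all gains are at most `R`. Give each `x` the weight `exp (-cost x y / B)` as seen from
`y`, with `B` about `T / 4`. Weights can hardly rise when going back from `y` (`sum_wt_le`), since
otherwise some edge would have a large gain. By extremal choices there is an element `v` before
which the total weight drops slowly (`exists_stable`), and near it an element `y` such that moreover
half of the weight reaches everything shortly before `y` (`Stable.exists_center`). From this part of
the weight, optimal paths to the neighbourhood of `y` can be cut backwards step by step, so that
edges between elements near `y` have large gains, and summing these gains shows that the number of
close pairs near `y` grows by the factor `q ^ 99` whenever the radius grows by the factor `q ^ 8`.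
Ten such enlargements contradict the trivial bound (`IsCenter.false_of_stable`).

For the number of greedy steps, let `d` be the largest normalized distance of an important pair. The
potential `φ` is at most `2 * n ^ (5 / 3) * d`, and a step decreases it by the order of `d ^ 3`,
hence by the order of `φ ^ 3 / n ^ 5`. So `1 / φ ^ 2` grows by the order of `1 / n ^ 5` in each
step, and `φ` is `O(n ^ 2)` after `n` steps; from then on each step decreases `φ` by the order of
`n`, because `d ^ 3 > n`. This gives `O(n)` steps (`greedy_facts`). Small `d` need no core argument,
as every decrease is at least `1` (`exists_vPotential_lt`).

When the loop stops, a valid path meets at most `n ^ (1 / 3)` chains, and uses at most five hops for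
each of them and one for each uncovered vertex (`VWalk.exists_hops`); by the definition of a chain
cover there are at most `n ^ (1 / 3)` of the latter. A maximal family of disjoint long chains is a
chain cover (`exists_chainCover`), and a chain is super-shortcut by recursion on blocks of
logarithmic length (`exists_four_hops`).
-/

namespace ChainGreedy

/-! ### Step systems -/

/-- An abstraction of the important vertices seen from a fixed source `a`, ordered by
reachability. `height y` stands for the normalized distance from `a` to `y`, `cost x y` for the
normalized distance from `x` to `y`, and `step u v` says that `v` can be entered directly from the
chain of `u`, for every source that lies before `u`. In the field `back`, the first alternative
says that an optimal path from `x` to `v` can be cut one chain before its end; the second one is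
the obstacle that the entry points of `x` and of `a` on the previous chain differ, in which case
the latter is not reachable from `x`. -/
structure StepSystem (α : Type*) [PartialOrder α] where
  height : α → ℕ
  cost : α → α → ℕ
  step : α → α → Prop
  step_lt : ∀ {u v}, step u v → u < v
  height_le : ∀ {u v}, step u v → height v ≤ height u + 1
  cost_le : ∀ {x u v}, step u v → x ≤ u → cost x v ≤ cost x u + 1
  cost_self : ∀ x, cost x x ≤ 1
  exists_step : ∀ {v}, 2 ≤ height v → ∃ u, step u v ∧ height v = height u + 1
  back : ∀ {x v}, x < v →
    (∃ u, step u v ∧ x ≤ u ∧ cost x u + 1 ≤ cost x v) ∨ ∃ p, step p v ∧ ¬ x ≤ p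

namespace StepSystem

variable {α : Type*} [PartialOrder α] (S : StepSystem α)

/-- `v` is reached from `u` by exactly `k` steps. -/
def reach : ℕ → α → α → Prop
  | 0, u, v => u = v
  | k + 1, u, v => ∃ w, S.step u w ∧ reach k w v

/-- `v` is reached from `u` by at most `k` steps. -/
def within (k : ℕ) (u v : α) : Prop := ∃ j ≤ k, S.reach j u v

variable {S}

theorem reach_add {a b : ℕ} {u v : α} :
    S.reach (a + b) u v ↔ ∃ w, S.reach a u w ∧ S.reach b w v := by
  induction a generalizing u with
  | zero => simp [reach]
  | succ a ih =>
    rw [Nat.add_right_comm]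
    simp only [reach, ih]
    constructor
    · rintro ⟨w, h, z, h1, h2⟩
      exact ⟨z, ⟨w, h, h1⟩, h2⟩
    · rintro ⟨z, ⟨w, h, h1⟩, h2⟩
      exact ⟨w, h, z, h1, h2⟩

theorem reach_one {u v : α} : S.reach 1 u v ↔ S.step u v := by
  simp [reach]

theorem within_refl (k : ℕ) (u : α) : S.within k u u := ⟨0, Nat.zero_le _, rfl⟩

theorem within.mono {k l : ℕ} {u v : α} (h : S.within k u v) (hkl : k ≤ l) : S.within l u v := by
  obtain ⟨j, hj, h⟩ := h
  exact ⟨j, hj.trans hkl, h⟩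

theorem within.trans {k l : ℕ} {u v w : α} (h : S.within k u v) (h' : S.within l v w) :
    S.within (k + l) u w := by
  obtain ⟨j, hj, h⟩ := h
  obtain ⟨i, hi, h'⟩ := h'
  exact ⟨j + i, by lia, reach_add.2 ⟨v, h, h'⟩⟩

theorem within_of_step {u v : α} (h : S.step u v) : S.within 1 u v :=
  ⟨1, le_rfl, reach_one.2 h⟩

theorem le_of_reach {k : ℕ} {u v : α} (h : S.reach k u v) : u ≤ v := by
  induction k generalizing u with
  | zero => exact h.le
  | succ k ih =>
    obtain ⟨w, h, h'⟩ := h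
    exact (S.step_lt h).le.trans (ih h')

theorem within.le {k : ℕ} {u v : α} (h : S.within k u v) : u ≤ v := by
  obtain ⟨j, -, h⟩ := h
  exact le_of_reach h

theorem height_le_of_reach {k : ℕ} {u v : α} (h : S.reach k u v) :
    S.height v ≤ S.height u + k := by
  induction k generalizing u with
  | zero => cases h; simp
  | succ k ih =>
    obtain ⟨w, h, h'⟩ := h
    have := ih h'
    have := S.height_le h
    lia

theorem cost_le_of_reach {k : ℕ} {x u v : α} (h : S.reach k u v) (hx : x ≤ u) :
    S.cost x v ≤ S.cost x u + k := by
  induction k generalizing u with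
  | zero => cases h; simp
  | succ k ih =>
    obtain ⟨w, h, h'⟩ := h
    have := ih h' (hx.trans (S.step_lt h).le)
    have := S.cost_le h hx
    lia

theorem within.height_le {k : ℕ} {u v : α} (h : S.within k u v) :
    S.height v ≤ S.height u + k := by
  obtain ⟨j, hj, h⟩ := h
  have := height_le_of_reach h
  lia

theorem within.cost_le {k : ℕ} {x u v : α} (h : S.within k u v) (hx : x ≤ u) :
    S.cost x v ≤ S.cost x u + k := by
  obtain ⟨j, hj, h⟩ := h
  have := cost_le_of_reach h hx
  lia

theorem within.cost_le_succ {k : ℕ} {u v : α} (h : S.within k u v) : S.cost u v ≤ k + 1 := by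
  have := h.cost_le le_rfl
  have := S.cost_self u
  lia

theorem exists_within_height {k : ℕ} {v : α} (h : k < S.height v) :
    ∃ u, S.within k u v ∧ S.height v = S.height u + k := by
  induction k with
  | zero => exact ⟨v, within_refl _ _, rfl⟩
  | succ k ih =>
    obtain ⟨u, hu, hk⟩ := ih (by lia)
    obtain ⟨w, hw, hw'⟩ := S.exists_step (v := u) (by lia)
    exact ⟨w, by simpa [add_comm] using (within_of_step hw).trans hu, by lia⟩

theorem exists_finset_of_reach {t : ℕ} {w v : α} (h : S.reach t w v) :
    ∃ Z : Finset α, Z.card = t + 1 ∧ ∀ z ∈ Z, S.within t w z ∧ S.within t z v := by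
  classical
  induction t generalizing w with
  | zero =>
    refine ⟨{w}, by simp, ?_⟩
    cases h
    simp [within_refl]
  | succ t ih =>
    obtain ⟨w', h1, h2⟩ := id h
    obtain ⟨Z, hZ, hZ'⟩ := ih h2
    have hw : w ∉ Z := fun hw => absurd (hZ' w hw).1.le (S.step_lt h1).not_ge
    refine ⟨insert w Z, by rw [Finset.card_insert_of_notMem hw, hZ], ?_⟩
    intro z hz
    rcases Finset.mem_insert.1 hz with rfl | hz
    · exact ⟨within_refl _ _, _, le_rfl, h⟩
    · exact ⟨by simpa [add_comm] using (within_of_step h1).trans (hZ' z hz).1,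
        (hZ' z hz).2.mono (Nat.le_succ t)⟩

/-! ### Weights and gains -/

variable (S)

open Classical in
/-- The weight of `x` as seen from `y`, which decays exponentially on the scale `B`. -/
noncomputable def wt (B : ℝ) (x y : α) : ℝ :=
  if x ≤ y then Real.exp (-(S.cost x y : ℝ) / B) else 0

variable {S}

theorem wt_nonneg (B : ℝ) (x y : α) : 0 ≤ S.wt B x y := by
  unfold wt
  split_ifs <;> positivity

theorem wt_of_not_le {B : ℝ} {x y : α} (h : ¬ x ≤ y) : S.wt B x y = 0 := if_neg h

theorem wt_of_le {B : ℝ} {x y : α} (h : x ≤ y) :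
    S.wt B x y = Real.exp (-(S.cost x y : ℝ) / B) := if_pos h

theorem wt_le_one {B : ℝ} (hB : 0 ≤ B) (x y : α) : S.wt B x y ≤ 1 := by
  unfold wt
  split_ifs
  · rw [Real.exp_le_one_iff]
    exact div_nonpos_of_nonpos_of_nonneg (by simp) hB
  · simp

variable [Fintype α] (S)

open Classical in
/-- The elements from which `v` is reached by at most `k` steps. -/
noncomputable def ball (k : ℕ) (v : α) : Finset α := {u | S.within k u v}

open Classical in
/-- A lower bound for the total decrease of the costs when the pair `(u, v)` becomes an edge:
`x` then reaches every `z` within `j` steps of `v` at cost at most `cost x u + 1 + j`. -/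
noncomputable def gain (u v : α) (j : ℕ) : ℕ :=
  ∑ x with x ≤ u, ∑ z with S.within j v z, (S.cost x z - (S.cost x u + 1 + j))

/-- The total weight seen from `y`. -/
noncomputable def mass (B : ℝ) (y : α) : ℝ := ∑ x, S.wt B x y

variable {S}

@[simp] theorem mem_ball {k : ℕ} {u v : α} : u ∈ S.ball k v ↔ S.within k u v := by
  simp [ball]

theorem sum_wt_le_mass (B : ℝ) (y : α) (Z : Finset α) : ∑ x ∈ Z, S.wt B x y ≤ S.mass B y :=
  Finset.sum_le_sum_of_subset_of_nonneg (Finset.subset_univ Z) fun _ _ _ => wt_nonneg ..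

theorem mass_nonneg (B : ℝ) (y : α) : 0 ≤ S.mass B y := Finset.sum_nonneg fun _ _ => wt_nonneg ..

theorem mass_le_card {B : ℝ} (hB : 0 ≤ B) (y : α) : S.mass B y ≤ Fintype.card α := by
  refine (Finset.sum_le_sum fun x _ => wt_le_one hB x y).trans ?_
  simp

theorem card_le_mass_of_within {B k : ℕ} (hk : k + 1 ≤ B) {y : α} {Z : Finset α}
    (hZ : ∀ u ∈ Z, S.within k u y) : (Z.card : ℝ) ≤ 3 * S.mass B y := by
  have hB : (0 : ℝ) < B := by exact_mod_cast (by lia : 0 < B)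
  have h : ∀ u ∈ Z, (1 : ℝ) / 3 ≤ S.wt B u y := by
    intro u hu
    rw [wt_of_le (hZ u hu).le]
    have h1 : (S.cost u y : ℝ) ≤ B := by exact_mod_cast (hZ u hu).cost_le_succ.trans hk
    have h2 : -(1 : ℝ) ≤ -(S.cost u y : ℝ) / B := by
      rw [le_div_iff₀ hB]
      linarith
    refine le_trans ?_ (Real.exp_le_exp.2 h2)
    rw [Real.exp_neg, one_div]
    exact inv_anti₀ (Real.exp_pos 1) (Real.exp_one_lt_three.le)
  have h' := Finset.card_nsmul_le_sum Z _ _ h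
  have := sum_wt_le_mass (S := S) B y Z
  rw [nsmul_eq_mul] at h'
  linarith

theorem card_ball_le {B k : ℕ} (hk : k + 1 ≤ B) (y : α) :
    ((S.ball k y).card : ℝ) ≤ 3 * S.mass B y :=
  card_le_mass_of_within hk fun _ hu => mem_ball.1 hu

theorem lt_card_ball {k : ℕ} {y : α} (h : k < S.height y) : k < (S.ball k y).card := by
  classical
  have h' : ∀ i : ℕ, ∃ u, i ≤ k → S.within i u y ∧ S.height y = S.height u + i := by
    intro i
    by_cases hi : i ≤ k
    · obtain ⟨u, hu⟩ := exists_within_height (hi.trans_lt h)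
      exact ⟨u, fun _ => hu⟩
    · exact ⟨y, fun hi' => absurd hi' hi⟩
  choose g hg using h'
  have hcard : ((Finset.range (k + 1)).image g).card = k + 1 := by
    rw [Finset.card_image_of_injOn, Finset.card_range]
    intro i hi j hj hij
    simp only [Finset.coe_range, Set.mem_Iio] at hi hj
    have h1 := (hg i (by lia)).2
    have h2 := (hg j (by lia)).2
    rw [hij] at h1
    lia
  have hsub : (Finset.range (k + 1)).image g ⊆ S.ball k y := by
    intro u hu
    obtain ⟨i, hi, rfl⟩ := Finset.mem_image.1 hu
    rw [Finset.mem_range] at hi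
    exact mem_ball.2 ((hg i (by lia)).1.mono (by lia))
  have := Finset.card_le_card hsub
  lia

theorem le_mass {B : ℕ} (hB : 1 ≤ B) {y : α} (h : B ≤ S.height y) :
    (B : ℝ) ≤ 3 * S.mass B y := by
  refine le_trans ?_ (card_ball_le (k := B - 1) (by lia) y)
  have := lt_card_ball (S := S) (k := B - 1) (y := y) (by lia)
  exact_mod_cast (by lia : B ≤ (S.ball (B - 1) y).card)

open Classical in
/-- Only few `x` gain a lot on the way from `u` to `v`: otherwise an edge from `u` to an element
shortly before `v` would have a large gain. -/
theorem sq_mul_card_le {R : ℝ} (hR : ∀ u v j, u ≤ v → (S.gain u v j : ℝ) ≤ R) {u v : α} {k t : ℕ}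
    (ht : 1 ≤ t) (huv : S.within k u v) :
    (t : ℝ) ^ 2 * ((Finset.univ.filter fun x => x ≤ u ∧ S.cost x u + 4 * t ≤ S.cost x v).card : ℝ)
      ≤ R := by
  set Z := Finset.univ.filter fun x => x ≤ u ∧ S.cost x u + 4 * t ≤ S.cost x v with hZ
  rcases Z.eq_empty_or_nonempty with h0 | ⟨x₀, hx₀⟩
  · rw [h0]
    simpa using (Nat.cast_nonneg _).trans (hR u u 0 le_rfl)
  obtain ⟨j, -, hj⟩ := huv
  have hx₀' := (Finset.mem_filter.1 hx₀).2
  have hjt : 4 * t ≤ j := by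
    have := cost_le_of_reach hj hx₀'.1
    lia
  obtain ⟨w, hw, hw'⟩ := reach_add.1 (show S.reach (j - t + t) u v by
    rwa [Nat.sub_add_cancel (by lia)])
  obtain ⟨Y, hY, hY'⟩ := exists_finset_of_reach hw'
  have huw := le_of_reach hw
  refine le_trans ?_ (hR u w t huw)
  have key : Z.card * ((t + 1) * t) ≤ S.gain u w t := by
    unfold gain
    have h1 : ∀ x ∈ Z, (t + 1) * t ≤
        ∑ z with S.within t w z, (S.cost x z - (S.cost x u + 1 + t)) := by
      intro x hx
      have hx' := (Finset.mem_filter.1 hx).2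
      have hsub : Y ⊆ Finset.univ.filter fun z => S.within t w z := fun z hz => by
        simpa using (hY' z hz).1
      refine le_trans ?_ (Finset.sum_le_sum_of_subset hsub)
      rw [← hY, ← smul_eq_mul]
      refine Finset.card_nsmul_le_sum _ _ _ fun z hz => ?_
      have := (hY' z hz).2.cost_le (x := x) (hx'.1.trans (huw.trans (hY' z hz).1.le))
      lia
    have hsub : Z ⊆ Finset.univ.filter fun x => x ≤ u := fun x hx => by
      simpa using (Finset.mem_filter.1 hx).2.1
    refine le_trans ?_ (Finset.sum_le_sum_of_subset hsub)
    rw [← smul_eq_mul]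
    exact Finset.card_nsmul_le_sum _ _ _ h1
  have key' : t ^ 2 * Z.card ≤ S.gain u w t := le_trans (by nlinarith) key
  exact_mod_cast key'

/-- If the mass hardly drops from `y` to `u`, then only a small part of the weight can drop by
a factor `θ`, because by `sq_mul_card_le` hardly any weight can increase. -/
theorem sum_wt_le {R : ℝ} (hR : ∀ u v j, u ≤ v → (S.gain u v j : ℝ) ≤ R) {B : ℝ} (hB : 0 < B)
    {u y : α} {k t : ℕ} (ht : 1 ≤ t) (huy : S.within k u y) {θ : ℝ} {Z : Finset α}
    (hZ : ∀ x ∈ Z, S.wt B x u ≤ θ * S.wt B x y) :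
    (1 - θ) * ∑ x ∈ Z, S.wt B x y ≤
      R / (t : ℝ) ^ 2 + (Real.exp (4 * t / B) - 1) * S.mass B y + S.mass B y - S.mass B u := by
  classical
  set J := Finset.univ.filter fun x => x ≤ u ∧ S.cost x u + 4 * t ≤ S.cost x y with hJ
  set E := Real.exp (4 * t / B) with hE
  have hE1 : 1 ≤ E := Real.one_le_exp (by positivity)
  have hcard : (J.card : ℝ) ≤ R / (t : ℝ) ^ 2 := by
    rw [le_div_iff₀ (by positivity), mul_comm]
    exact sq_mul_card_le hR ht huy
  have hpt : ∀ x, S.wt B x u + (if x ∈ Z then (1 - θ) * S.wt B x y else 0) ≤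
      E * S.wt B x y + (if x ∈ J then 1 else 0) := by
    intro x
    have h0 := wt_nonneg (S := S) B x y
    have h0' := wt_le_one (S := S) hB.le x u
    split_ifs with h1 h2 h2
    · have := hZ x h1
      nlinarith
    · have := hZ x h1
      nlinarith
    · nlinarith
    · by_cases hxu : x ≤ u
      · have hc : S.cost x y ≤ S.cost x u + 4 * t := by
          by_contra hc
          refine h2 ?_
          simp only [hJ, Finset.mem_filter, Finset.mem_univ, true_and]
          exact ⟨hxu, by lia⟩
        rw [wt_of_le hxu, wt_of_le (hxu.trans huy.le), hE, ← Real.exp_add, add_zero, add_zero]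
        refine Real.exp_le_exp.2 ?_
        rw [← add_div]
        gcongr
        have : (S.cost x y : ℝ) ≤ S.cost x u + 4 * t := by exact_mod_cast hc
        linarith
      · rw [wt_of_not_le hxu]
        linarith [mul_nonneg (zero_le_one.trans hE1) h0]
  have hsum := Finset.sum_le_sum fun x (_ : x ∈ Finset.univ) => hpt x
  simp only [Finset.sum_add_distrib, Finset.sum_ite_mem, Finset.univ_inter, ← Finset.mul_sum,
    Finset.sum_const, nsmul_eq_mul, mul_one] at hsum
  simp only [mass] at hsum ⊢
  linarith

end StepSystem

namespace StepSystem

variable {α : Type*} [PartialOrder α] [Fintype α]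

/-! ### Stable elements -/

/-- An element `v` whose mass drops only slowly when going back from `v`, together with the
scales of the argument: `B` is the scale of the weights, `r` is the smallest radius, and `q` is the
number with `mass B v * B ^ 2 / R ≈ q ^ 252` that relates them; all radii in use are
`q ^ (4 * i) * r` for some `i ≤ 20`. -/
structure Stable (S : StepSystem α) (R : ℝ) (B q r : ℕ) (v : α) : Prop where
  gain_le : ∀ u w j, u ≤ w → (S.gain u w j : ℝ) ≤ R
  le_q : 10 ^ 6 ≤ q
  one_le_r : 1 ≤ r
  mul_le : r * q ^ 84 ≤ B
  le_mul : B ≤ 2 * (r * q ^ 84)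
  pow_mul_le : (q : ℝ) ^ 252 * R ≤ S.mass B v * (B : ℝ) ^ 2
  mass_le : S.mass B v ≤ (q : ℝ) ^ 336 * r
  le_height : 3 * B ≤ S.height v
  le_mass : ∀ W ≤ B, ∀ u, S.within W u v →
    (1 - 2 * q * W / B) * S.mass B v ≤ S.mass B u

/-- A bound on the drop of `n * B / g` between two elements becomes a bound on the drop of `g ^ n`;
in `exists_stable`, `g ^ n` is the mass up to a constant factor. -/
theorem one_sub_mul_pow_le {n : ℕ} (hn : 0 < n) {B W g g' q : ℝ} (hB : 0 < B) (hW : 0 ≤ W)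
    (hg : 0 < g) (hg' : 0 < g') (hq : g ≤ 2 * q) (h : n * B / g' ≤ W + n * B / g) :
    (1 - 2 * q * W / B) * g ^ n ≤ g' ^ n := by
  have hn' : (0 : ℝ) < n := by exact_mod_cast hn
  set x := W * g / (n * B) with hx
  have hx0 : 0 ≤ x := by positivity
  have hcoef : n * x ≤ 2 * q * W / B := by
    rw [hx, mul_div_assoc', mul_div_mul_left _ _ hn'.ne', mul_comm W]
    gcongr
  have hp : 0 < g ^ n := by positivity
  by_cases hx1 : x ≤ 1
  · have hgx : g * (1 - x) ≤ g' := by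
      have h4 : n * B / g * (1 + x) = W + n * B / g := by
        rw [hx]
        field_simp
        ring
      rw [← h4, div_le_iff₀ hg'] at h
      have h5 : g ≤ (1 + x) * g' := by
        refine le_of_mul_le_mul_left (a := n * B / g) ?_ (by positivity)
        calc n * B / g * g = n * B := by field_simp
          _ ≤ _ := h
          _ = _ := by ring
      calc g * (1 - x) ≤ ((1 + x) * g') * (1 - x) := by
            have := sub_nonneg.2 hx1
            gcongr
        _ = (1 - x ^ 2) * g' := by ring
        _ ≤ 1 * g' := by
            gcongr
            linarith [sq_nonneg x]
        _ = g' := one_mul _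
    have h6 : 1 - n * x ≤ (1 - x) ^ n := by
      have := one_add_mul_le_pow (a := -x) (by linarith) n
      calc 1 - (n : ℝ) * x = 1 + n * -x := by ring
        _ ≤ _ := this
        _ = _ := by rw [← sub_eq_add_neg]
    calc (1 - 2 * q * W / B) * g ^ n ≤ (1 - x) ^ n * g ^ n := by
          gcongr
          linarith
      _ = (g * (1 - x)) ^ n := by rw [mul_pow, mul_comm]
      _ ≤ g' ^ n := by
          have := mul_nonneg hg.le (sub_nonneg.2 hx1)
          gcongr
  · have hn1 : (1 : ℝ) ≤ n := by exact_mod_cast hn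
    have h1 : 1 - 2 * q * W / B ≤ 0 := by nlinarith
    exact (mul_nonpos_of_nonpos_of_nonneg h1 hp.le).trans (by positivity)

/-- The element `v` maximizes `height + 252 * B / (mass * B ^ 2 / R) ^ (1 / 252)` among the elements
of large height. Going back by `W` steps costs at most `W` in height, which bounds the rise of the
second summand, and hence the drop of the mass. -/
theorem exists_stable (S : StepSystem α) {p : ℝ} (hp : 10 ^ 6 + 1 ≤ p) {T : ℕ} {b : α}
    (hT : 4000 * p ^ 252 ≤ T) (hb : S.height b = T) (hcard : Fintype.card α ≤ 2 * T ^ 2)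
    (hR : ∀ u v j, u ≤ v → (S.gain u v j : ℝ) ≤ (T : ℝ) ^ 3 / (375 * p ^ 252)) :
    ∃ B q r v, S.Stable ((T : ℝ) ^ 3 / (375 * p ^ 252)) B q r v := by
  classical
  have hp0 : (0 : ℝ) < p := by linarith
  have hp1 : (1 : ℝ) ≤ p ^ 252 := one_le_pow₀ (by linarith)
  have hT' : 4000 ≤ T := by
    have : (4000 : ℝ) ≤ T := by linarith
    exact_mod_cast this
  set R := (T : ℝ) ^ 3 / (375 * p ^ 252) with hRdef
  have hTpos : (0 : ℝ) < T := by positivity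
  have hRpos : 0 < R := by positivity
  set B := T / 4 with hB
  have hB4 : 4 * B ≤ T := by lia
  have hB5 : T ≤ 5 * B := by lia
  have hB0 : 1 ≤ B := by lia
  have hB4' : 4 * (B : ℝ) ≤ T := by exact_mod_cast hB4
  have hB5' : (T : ℝ) ≤ 5 * B := by exact_mod_cast hB5
  have hBpos : (0 : ℝ) < B := by exact_mod_cast hB0
  set Q : α → ℝ := fun u => S.mass B u * (B : ℝ) ^ 2 / R with hQ
  set g : α → ℝ := fun u => Q u ^ (1 / 252 : ℝ) with hg
  have hQ0 : ∀ u, 0 ≤ Q u := fun u => by have := mass_nonneg (S := S) B u; positivity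
  have hg252 : ∀ u, g u ^ 252 = Q u := fun u => by
    simp only [hg]
    rw [← Real.rpow_natCast, ← Real.rpow_mul (hQ0 u)]
    norm_num
  have hgp : ∀ u, B ≤ S.height u → p ≤ g u := by
    intro u hu
    have h1 := StepSystem.le_mass hB0 hu
    have h0 : 0 ≤ g u := Real.rpow_nonneg (hQ0 u) _
    refine (pow_le_pow_iff_left₀ hp0.le h0 (n := 252) (by norm_num)).1 ?_
    rw [hg252]
    simp only [hQ]
    rw [hRdef, le_div_iff₀ (by positivity), mul_div_assoc', div_le_iff₀ (by positivity)]
    have h2 : (T : ℝ) ^ 3 ≤ (5 * B) ^ 3 := by gcongr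
    have h3 : (T : ℝ) ^ 3 ≤ 375 * (S.mass B u * (B : ℝ) ^ 2) := by nlinarith [sq_nonneg (B : ℝ)]
    calc p ^ 252 * (T : ℝ) ^ 3 ≤ p ^ 252 * (375 * (S.mass B u * (B : ℝ) ^ 2)) := by gcongr
      _ = _ := by ring
  -- among the elements of height at least `T / 2`
  obtain ⟨v, hv, hmax⟩ := Finset.exists_max_image
    (Finset.univ.filter fun u => T ≤ 2 * S.height u)
    (fun u => (S.height u : ℝ) + 252 * B / g u) ⟨b, by simp; lia⟩
  simp only [Finset.mem_filter, Finset.mem_univ, true_and] at hv hmax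
  have hgv : p ≤ g v := hgp v (by lia)
  have hgv0 : 0 < g v := by linarith
  -- `252 * B / g v` is at most `T / 8`, so that it cannot make up for a larger loss of height
  have hheight : 7 * T ≤ 8 * S.height v := by
    have h1 := hmax b (by lia)
    have h2 : 0 < g b := by linarith [hgp b (by lia)]
    have h3 : 0 ≤ 252 * B / g b := by positivity
    have h4 : 252 * B / g v ≤ T / 8 := by
      rw [div_le_iff₀ hgv0]
      nlinarith
    rw [hb] at h1
    have : (7 * T : ℝ) ≤ 8 * S.height v := by linarith
    exact_mod_cast this
  set q := ⌊g v⌋₊ with hq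
  have hqle : (q : ℝ) ≤ g v := Nat.floor_le hgv0.le
  have hltq : g v < q + 1 := Nat.lt_floor_add_one _
  have hq6 : 10 ^ 6 ≤ q := Nat.le_floor (by push_cast; linarith)
  have hq0 : (0 : ℝ) < q := by exact_mod_cast (by lia : 0 < q)
  have hq6' : (10 : ℝ) ^ 6 ≤ q := by exact_mod_cast hq6
  have hg2q : g v ≤ 2 * q := by linarith
  have hqQ : (q : ℝ) ^ 252 ≤ Q v := by
    rw [← hg252]
    gcongr
  have hQq : Q v ≤ (2 * q : ℝ) ^ 252 := by
    rw [← hg252]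
    gcongr
  have hQle : Q v ≤ (B : ℝ) ^ 3 := by
    have h1 := mass_le_card (S := S) hBpos.le v
    have h2 : (Fintype.card α : ℝ) ≤ 2 * (T : ℝ) ^ 2 := by exact_mod_cast hcard
    simp only [hQ]
    rw [div_le_iff₀ hRpos, hRdef, mul_div_assoc', le_div_iff₀ (by positivity)]
    have h3 : 375 * p ^ 252 ≤ (T : ℝ) / 10 := by linarith
    calc S.mass B v * (B : ℝ) ^ 2 * (375 * p ^ 252)
        ≤ (2 * (T : ℝ) ^ 2) * (B : ℝ) ^ 2 * (T / 10) := by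
          gcongr
          exact h1.trans h2
      _ = (B : ℝ) ^ 2 * (T : ℝ) ^ 3 * (1 / 5) := by ring
      _ ≤ (B : ℝ) ^ 2 * (T : ℝ) ^ 3 * B := by
          gcongr
          linarith
      _ = _ := by ring
  have hqB : q ^ 84 ≤ B := by
    have : ((q : ℝ) ^ 84) ^ 3 ≤ (B : ℝ) ^ 3 := by
      rw [← pow_mul]
      exact hqQ.trans hQle
    have := (pow_le_pow_iff_left₀ (by positivity) (by positivity) (by norm_num)).1 this
    exact_mod_cast this
  have hq84 : 0 < q ^ 84 := by positivity
  set r := B / q ^ 84 with hr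
  have hr1 : 1 ≤ r := Nat.div_pos hqB hq84
  have hrB : r * q ^ 84 ≤ B := Nat.div_mul_le_self _ _
  have hBr : B ≤ 2 * (r * q ^ 84) := by
    have h1 : B < q ^ 84 * (r + 1) := Nat.lt_mul_div_succ _ hq84
    nlinarith
  have hBr' : (B : ℝ) ≤ 2 * (r * (q : ℝ) ^ 84) := by exact_mod_cast hBr
  refine ⟨B, q, r, v, hR, hq6, hr1, hrB, hBr, ?_, ?_, by lia, ?_⟩
  · exact (le_div_iff₀ hRpos).1 hqQ
  · have h1 : S.mass B v * (B : ℝ) ^ 2 ≤ (2 * q : ℝ) ^ 252 * R := (div_le_iff₀ hRpos).1 hQq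
    have h2 : R * p ^ 252 ≤ (B : ℝ) ^ 3 / 3 := by
      rw [hRdef, div_mul_eq_mul_div, div_le_iff₀ (by positivity)]
      have h2 : (T : ℝ) ^ 3 ≤ (5 * B) ^ 3 := by gcongr
      calc (T : ℝ) ^ 3 * p ^ 252 ≤ (5 * B) ^ 3 * p ^ 252 := by gcongr
        _ = _ := by ring
    have h3 : (2 : ℝ) ^ 252 ≤ p ^ 252 := by
      gcongr
      linarith
    have h4 : S.mass B v * (B : ℝ) ^ 2 ≤ (q : ℝ) ^ 252 * ((B : ℝ) ^ 3 / 3) := by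
      rw [mul_pow] at h1
      calc _ ≤ _ := h1
        _ = (q : ℝ) ^ 252 * (R * 2 ^ 252) := by ring
        _ ≤ (q : ℝ) ^ 252 * (R * p ^ 252) := by gcongr
        _ ≤ _ := by gcongr
    have h5 : S.mass B v ≤ (q : ℝ) ^ 252 * (B / 3) := by
      refine le_of_mul_le_mul_right (a := (B : ℝ) ^ 2) ?_ (by positivity)
      calc _ ≤ _ := h4
        _ = _ := by ring
    calc S.mass B v ≤ (q : ℝ) ^ 252 * (B / 3) := h5
      _ ≤ (q : ℝ) ^ 252 * (r * (q : ℝ) ^ 84) := by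
        gcongr
        have : 0 ≤ r * (q : ℝ) ^ 84 := by positivity
        linarith
      _ = _ := by rw [mul_comm (r : ℝ), ← mul_assoc, ← pow_add]
  · intro W hW u hu
    have hhu := hu.height_le
    have h1 := hmax u (by lia)
    have hgu : 0 < g u := by linarith [hgp u (by lia)]
    have h2 : (S.height v : ℝ) ≤ S.height u + W := by exact_mod_cast hhu
    have h3 := one_sub_mul_pow_le (n := 252) (by norm_num) hBpos (Nat.cast_nonneg W) hgv0
      hgu hg2q (by push_cast; linarith)
    rw [hg252, hg252] at h3
    refine le_of_mul_le_mul_right (a := (B : ℝ) ^ 2 / R) ?_ (by positivity)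
    simp only [hQ] at h3
    calc _ = (1 - 2 * q * W / B) * (S.mass B v * (B : ℝ) ^ 2 / R) := by ring
      _ ≤ _ := h3
      _ = _ := by ring

/-! ### Masses near a stable element -/

namespace Stable

variable {S : StepSystem α} {R : ℝ} {B q r : ℕ} {v : α}

theorem q_ge (h : S.Stable R B q r v) : (10 : ℝ) ^ 6 ≤ q := by exact_mod_cast h.le_q

theorem q_pos (h : S.Stable R B q r v) : (0 : ℝ) < q := by linarith [h.q_ge]

theorem r_pos (h : S.Stable R B q r v) : (0 : ℝ) < r := by exact_mod_cast h.one_le_r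

theorem rad_pos (h : S.Stable R B q r v) : 0 < q ^ 80 * r := by
  have := h.le_q
  have := h.one_le_r
  positivity

theorem rad_le (h : S.Stable R B q r v) : q ^ 4 * (q ^ 80 * r) ≤ B := by
  calc q ^ 4 * (q ^ 80 * r) = r * q ^ 84 := by ring
    _ ≤ B := h.mul_le

theorem le_rad (h : S.Stable R B q r v) : B ≤ 2 * (q ^ 4 * (q ^ 80 * r)) := by
  calc B ≤ _ := h.le_mul
    _ = _ := by ring

theorem mul_rad_le (h : S.Stable R B q r v) : 2000 * (q ^ 80 * r) ≤ B := by
  refine le_trans (Nat.mul_le_mul_right _ ?_) h.rad_le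
  calc 2000 ≤ q := by linarith [h.le_q]
    _ ≤ q ^ 4 := Nat.le_self_pow (by norm_num) q

theorem one_le_B (h : S.Stable R B q r v) : 1 ≤ B := by
  have := h.mul_rad_le
  have := h.rad_pos
  lia

theorem B_pos (h : S.Stable R B q r v) : (0 : ℝ) < B := by exact_mod_cast h.one_le_B

theorem mass_pos (h : S.Stable R B q r v) : 0 < S.mass B v := by
  have h1 := StepSystem.le_mass h.one_le_B (y := v) (by linarith [h.le_height])
  linarith [h.B_pos]

theorem sub_mul_mass_le (h : S.Stable R B q r v) {u : α}
    (hu : S.within (1000 * (q ^ 80 * r)) u v) :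
    (1 - 2000 / (q : ℝ) ^ 3) * S.mass B v ≤ S.mass B u := by
  refine le_trans ?_ (h.le_mass _ (by linarith [h.mul_rad_le]) u hu)
  have hq := h.q_pos
  refine mul_le_mul_of_nonneg_right (sub_le_sub_left ?_ 1) h.mass_pos.le
  rw [div_le_div_iff₀ h.B_pos (by positivity)]
  have : (q : ℝ) ^ 4 * (q ^ 80 * r) ≤ B := by exact_mod_cast h.rad_le
  push_cast
  calc 2 * q * (1000 * ((q : ℝ) ^ 80 * r)) * (q : ℝ) ^ 3
      = 2000 * ((q : ℝ) ^ 4 * (q ^ 80 * r)) := by ring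
    _ ≤ 2000 * (B : ℝ) := by gcongr

theorem div_q_cube_le (h : S.Stable R B q r v) : 10000 / (q : ℝ) ^ 3 ≤ 1 / (2 * (q : ℝ) ^ 2) := by
  have hq := h.q_pos
  rw [div_le_div_iff₀ (by positivity) (by positivity)]
  have : (q : ℝ) ^ 3 = q * (q : ℝ) ^ 2 := by ring
  rw [this]
  have := h.q_ge
  have : 0 < (q : ℝ) ^ 2 := by positivity
  nlinarith

theorem mass_le_two_mul (h : S.Stable R B q r v) {u : α}
    (hu : S.within (1000 * (q ^ 80 * r)) u v) : S.mass B v ≤ 2 * S.mass B u := by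
  have h1 := h.sub_mul_mass_le hu
  have h2 := h.div_q_cube_le
  have h3 : 1 / (2 * (q : ℝ) ^ 2) ≤ 1 / 2 := by
    have : 1 ≤ (q : ℝ) ^ 2 := one_le_pow₀ (by linarith [h.q_ge])
    gcongr
    linarith
  have h4 : 10000 / (q : ℝ) ^ 3 = 5 * (2000 / (q : ℝ) ^ 3) := by ring
  have h5 : 2000 / (q : ℝ) ^ 3 ≤ 1 / 2 := by
    have : 0 ≤ 2000 / (q : ℝ) ^ 3 := by have := h.q_pos; positivity
    linarith
  have := h.mass_pos
  nlinarith

/-- The number of targets gained at the smallest radius is negligible compared to the mass. -/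
theorem div_sq_le (h : S.Stable R B q r v) :
    R / (r : ℝ) ^ 2 ≤ 4 / (q : ℝ) ^ 84 * S.mass B v := by
  have hq := h.q_pos
  have hr := h.r_pos
  have h1 := h.pow_mul_le
  have h2 : (B : ℝ) ≤ 2 * (r * (q : ℝ) ^ 84) := by exact_mod_cast h.le_mul
  have hm := h.mass_pos
  rw [div_le_iff₀ (by positivity)]
  refine le_of_mul_le_mul_left (a := (q : ℝ) ^ 252) ?_ (by positivity)
  calc (q : ℝ) ^ 252 * R ≤ S.mass B v * (B : ℝ) ^ 2 := h1
    _ ≤ S.mass B v * (2 * (r * (q : ℝ) ^ 84)) ^ 2 := by gcongr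
    _ = 4 * S.mass B v * (r : ℝ) ^ 2 * (q : ℝ) ^ 168 := by
      rw [mul_pow, mul_pow, ← pow_mul]; ring
    _ = 4 * S.mass B v * (r : ℝ) ^ 2 * ((q : ℝ) ^ 252 / (q : ℝ) ^ 84) := by
      have : (q : ℝ) ^ 252 = (q : ℝ) ^ 84 * (q : ℝ) ^ 168 := by rw [← pow_add]
      rw [this, mul_div_cancel_left₀ _ (by positivity)]
    _ = _ := by ring

theorem exp_sub_one_le (h : S.Stable R B q r v) :
    Real.exp (4 * r / B) - 1 ≤ 8 / (q : ℝ) ^ 84 := by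
  have hq := h.q_pos
  have hr := h.r_pos
  have hx : 4 * (r : ℝ) / B ≤ 4 / (q : ℝ) ^ 84 := by
    rw [div_le_div_iff₀ h.B_pos (by positivity)]
    have : (r : ℝ) * (q : ℝ) ^ 84 ≤ B := by exact_mod_cast h.mul_le
    linarith
  have hx1 : 4 / (q : ℝ) ^ 84 ≤ 1 := by
    rw [div_le_one (by positivity)]
    calc (4 : ℝ) ≤ q := by linarith [h.q_ge]
      _ ≤ (q : ℝ) ^ 84 := le_self_pow₀ (by linarith [h.q_ge]) (by norm_num)
  have hx0 : 0 ≤ 4 * (r : ℝ) / B := by have := h.B_pos; positivity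
  have := Real.abs_exp_sub_one_le (x := 4 * (r : ℝ) / B) (by rw [abs_of_nonneg hx0]; linarith)
  rw [abs_of_nonneg hx0] at this
  have h8 : 8 / (q : ℝ) ^ 84 = 2 * (4 / (q : ℝ) ^ 84) := by ring
  linarith [le_abs_self (Real.exp (4 * r / B) - 1)]

/-- `StepSystem.sum_wt_le` with the smallest radius as `t`. -/
theorem sum_wt_le (h : S.Stable R B q r v) {u y : α} {k : ℕ}
    (hy : S.within (1000 * (q ^ 80 * r)) y v) (huy : S.within k u y) {θ : ℝ} {Z : Finset α}
    (hZ : ∀ x ∈ Z, S.wt B x u ≤ θ * S.wt B x y) :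
    (1 - θ) * ∑ x ∈ Z, S.wt B x y ≤
      16 / (q : ℝ) ^ 84 * S.mass B y + S.mass B y - S.mass B u := by
  have h1 := StepSystem.sum_wt_le h.gain_le h.B_pos h.one_le_r huy hZ
  have h2 := h.div_sq_le
  have h3 := h.exp_sub_one_le
  have h4 := h.mass_le_two_mul hy
  have h5 := mass_nonneg (S := S) B y
  have hq := h.q_pos
  have h6 : (Real.exp (4 * r / B) - 1) * S.mass B y ≤ 8 / (q : ℝ) ^ 84 * S.mass B y := by
    gcongr
  have h7 : 4 / (q : ℝ) ^ 84 * S.mass B v ≤ 4 / (q : ℝ) ^ 84 * (2 * S.mass B y) := by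
    gcongr
  have h8 : 16 / (q : ℝ) ^ 84 * S.mass B y =
      4 / (q : ℝ) ^ 84 * (2 * S.mass B y) + 8 / (q : ℝ) ^ 84 * S.mass B y := by ring
  linarith

theorem mass_le_mul (h : S.Stable R B q r v) {u y : α} {k : ℕ}
    (hy : S.within (1000 * (q ^ 80 * r)) y v) (huy : S.within k u y) :
    S.mass B u ≤ (1 + 16 / (q : ℝ) ^ 84) * S.mass B y := by
  have := h.sum_wt_le hy huy (θ := 0) (Z := ∅) (by simp)
  simp only [Finset.sum_empty, mul_zero] at this
  linarith

theorem div_pow_le (h : S.Stable R B q r v) : 16 / (q : ℝ) ^ 84 ≤ 1 / (q : ℝ) ^ 80 := by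
  have hq := h.q_pos
  have hq1 : (1 : ℝ) ≤ q := by linarith [h.q_ge]
  rw [div_le_div_iff₀ (by positivity) (by positivity)]
  have h1 : (q : ℝ) ^ 84 = (q : ℝ) ^ 4 * (q : ℝ) ^ 80 := by rw [← pow_add]
  have h2 : (q : ℝ) ≤ (q : ℝ) ^ 4 := le_self_pow₀ hq1 (by norm_num)
  rw [h1, one_mul]
  gcongr
  linarith [h.q_ge]

theorem one_div_pow_le (h : S.Stable R B q r v) {k l : ℕ} (hkl : k ≤ l) :
    1 / (q : ℝ) ^ l ≤ 1 / (q : ℝ) ^ k := by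
  have hq := h.q_pos
  have hq1 : (1 : ℝ) ≤ q := by linarith [h.q_ge]
  exact one_div_le_one_div_of_le (by positivity) (pow_le_pow_right₀ hq1 hkl)

/-- The `x` that do not reach an element `u` near `v` have little weight. -/
theorem sum_wt_not_le (h : S.Stable R B q r v) {u : α}
    (hu : S.within (1000 * (q ^ 80 * r)) u v) {Z : Finset α} (hZ : ∀ x ∈ Z, ¬ x ≤ u) :
    ∑ x ∈ Z, S.wt B x v ≤ 1 / (2 * (q : ℝ) ^ 2) * S.mass B v := by
  have h1 := h.sum_wt_le (within_refl _ v) hu (θ := 0) (Z := Z) fun x hx => by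
    rw [wt_of_not_le (hZ x hx), zero_mul]
  have h2 := h.sub_mul_mass_le hu
  have h3 := h.div_pow_le.trans (h.one_div_pow_le (k := 3) (by norm_num))
  have h4 := h.div_q_cube_le
  have h5 := h.mass_pos
  have h6 : 10000 / (q : ℝ) ^ 3 = 10000 * (1 / (q : ℝ) ^ 3) := by ring
  have h7 : 2000 / (q : ℝ) ^ 3 = 2000 * (1 / (q : ℝ) ^ 3) := by ring
  have h8 : 0 < 1 / (q : ℝ) ^ 3 := by have := h.q_pos; positivity
  have h9 : ∑ x ∈ Z, S.wt B x v ≤ (10000 / (q : ℝ) ^ 3) * S.mass B v := by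
    rw [h6]
    rw [h7] at h2
    nlinarith
  refine h9.trans ?_
  gcongr

theorem rad_lt_height (h : S.Stable R B q r v) {u : α} {k : ℕ} (hk : k ≤ B)
    (hu : S.within k u v) : q ^ 80 * r < S.height u := by
  have := hu.height_le
  have := h.le_height
  have := h.mul_rad_le
  have := h.rad_pos
  lia

/-- By averaging, some residue class of heights modulo the largest radius contains only few
elements, and going back from any element it is soon hit. -/
theorem exists_sparse (h : S.Stable R B q r v) :
    ∃ P : Finset α, (∀ p ∈ P, S.within (1000 * (q ^ 80 * r)) p v) ∧
      (P.card : ℝ) ≤ (q : ℝ) ^ 257 ∧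
      ∀ k ≤ 999 * (q ^ 80 * r), ∀ y, S.within k y v → ∃ p ∈ P, p ≤ y := by
  classical
  set ρ := q ^ 80 * r with hρ
  have hρ0 : 0 < ρ := h.rad_pos
  have hρ0' : (0 : ℝ) < ρ := by exact_mod_cast hρ0
  have hρB : 2000 * ρ ≤ B := h.mul_rad_le
  obtain ⟨a, ha, hcard⟩ := Finset.exists_card_fiber_le_of_card_le_nsmul
    (s := S.ball (1000 * ρ) v) (t := Finset.range ρ) (f := fun p => S.height p % ρ)
    (b := (S.ball (1000 * ρ) v).card / (ρ : ℝ)) ⟨0, by simpa using hρ0⟩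
    (by rw [Finset.card_range, nsmul_eq_mul, mul_div_cancel₀ _ hρ0'.ne'])
  rw [Finset.mem_range] at ha
  refine ⟨_, fun p hp => mem_ball.1 (Finset.mem_filter.1 hp).1, hcard.trans ?_, ?_⟩
  · have h1 := card_ball_le (S := S) (B := B) (k := 1000 * ρ) (by lia) v
    have h2 := h.mass_le
    have hq := h.q_pos
    rw [div_le_iff₀ hρ0']
    have h3 : (ρ : ℝ) = (q : ℝ) ^ 80 * r := by rw [hρ]; push_cast; rfl
    have h4 : (q : ℝ) * (q : ℝ) ^ 336 = (q : ℝ) ^ 257 * (q : ℝ) ^ 80 := by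
      rw [← pow_add, ← pow_succ']
    have h5 := h.q_ge
    have h6 := h.r_pos
    have h8 : (q : ℝ) ^ 257 * (ρ : ℝ) = q * (q : ℝ) ^ 336 * r := by rw [h3, h4, mul_assoc]
    rw [h8]
    generalize (q : ℝ) ^ 336 = X at h2 ⊢
    have h7 := h.mass_pos
    refine h1.trans ?_
    rw [mul_assoc]
    nlinarith
  · intro k hk y hy
    have hlt := h.rad_lt_height (by lia) hy
    -- going back by `j` steps brings the height into the residue class of `a`
    obtain ⟨j, hj, hja⟩ : ∃ j < ρ, (S.height y - j) % ρ = a := by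
      refine ⟨(S.height y + (ρ - a)) % ρ, Nat.mod_lt _ hρ0, ?_⟩
      have h1 := Nat.div_add_mod (S.height y + (ρ - a)) ρ
      have h2 := Nat.mod_lt (S.height y + (ρ - a)) hρ0
      set j := (S.height y + (ρ - a)) % ρ
      set d := (S.height y + (ρ - a)) / ρ
      have h3 : S.height y - j = a + ρ * (d - 1) := by
        have hd : 1 ≤ d := by
          by_contra hd
          have : d = 0 := by lia
          rw [this] at h1
          lia
        obtain ⟨d', hd'⟩ := Nat.exists_eq_add_of_le hd
        rw [hd'] at h1 ⊢
        rw [Nat.mul_add, mul_one] at h1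
        rw [Nat.add_sub_cancel_left]
        lia
      rw [h3, Nat.add_mul_mod_self_left, Nat.mod_eq_of_lt ha]
    obtain ⟨p, hp, hpj⟩ := exists_within_height (S := S) (k := j) (v := y) (by lia)
    refine ⟨p, ?_, hp.le⟩
    simp only [Finset.mem_filter, mem_ball]
    exact ⟨(hp.trans hy).mono (by lia), by rw [← hja, hpj, Nat.add_sub_cancel]⟩

end Stable

/-! ### Existence of a center -/

theorem log_sub_log_le {a b e : ℝ} (ha : 0 < a) (hb : 0 < b) (h : a ≤ (1 + e) * b) :
    Real.log a - Real.log b ≤ e := by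
  rw [← Real.log_div ha.ne' hb.ne']
  have h1 := Real.log_le_sub_one_of_pos (div_pos ha hb)
  have h2 : a / b ≤ 1 + e := (div_le_iff₀ hb).2 h
  linarith

namespace Stable

variable {S : StepSystem α} {R : ℝ} {B q r : ℕ} {v : α}

open Classical in
/-- If more than half of the weight fails to reach the points `p x`, then some `p x` has much fewer
elements of `P` before it than `y`: each element of `P` is reached by almost all of the weight. -/
theorem exists_mul_card_le (h : S.Stable R B q r v) {P Z : Finset α} {p : α → α} {y : α}
    (hP : ∀ p ∈ P, S.within (1000 * (q ^ 80 * r)) p v) (hp : ∀ x ∈ Z, p x ≤ y)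
    (hpx : ∀ x ∈ Z, ¬ x ≤ p x) (hy : (0 : ℝ) < (P.filter fun p' => p' ≤ y).card)
    (hlt : S.mass B v / 2 < ∑ x ∈ Z, S.wt B x v) :
    ∃ x ∈ Z, (q : ℝ) ^ 2 * (P.filter fun p' => p' ≤ p x).card ≤
      (P.filter fun p' => p' ≤ y).card := by
  by_contra! hall
  have hq := h.q_pos
  set c : α → ℕ := fun z => (P.filter fun p => p ≤ z).card with hc
  have h1 : ∑ x ∈ Z, S.wt B x v * c y ≤ ∑ x ∈ Z, S.wt B x v * ((q : ℝ) ^ 2 * c (p x)) :=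
    Finset.sum_le_sum fun x hx => mul_le_mul_of_nonneg_left (hall x hx).le (wt_nonneg ..)
  -- counting the pairs of an `x` and an element of `P` before `p x` in the other order
  have h2 : ∑ x ∈ Z, S.wt B x v * ((q : ℝ) ^ 2 * c (p x)) =
      (q : ℝ) ^ 2 * ∑ p' ∈ P.filter (fun p' => p' ≤ y),
        ∑ x ∈ Z.filter (fun x => p' ≤ p x), S.wt B x v := by
    have h3 : ∀ x ∈ Z, S.wt B x v * ((q : ℝ) ^ 2 * c (p x)) =
        (q : ℝ) ^ 2 * ∑ p' ∈ P.filter (fun p' => p' ≤ y),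
          if p' ≤ p x then S.wt B x v else 0 := by
      intro x hx
      rw [← Finset.sum_filter, Finset.filter_filter, Finset.sum_const, nsmul_eq_mul]
      have : (P.filter fun p' => p' ≤ y ∧ p' ≤ p x) = P.filter fun p' => p' ≤ p x :=
        Finset.filter_congr fun p' _ => ⟨fun h => h.2, fun h => ⟨h.trans (hp x hx), h⟩⟩
      rw [this]
      ring
    rw [Finset.sum_congr rfl h3, ← Finset.mul_sum, Finset.sum_comm]
    congr 1
    refine Finset.sum_congr rfl fun p' _ => ?_
    rw [Finset.sum_filter]
  have h4 : ∑ p' ∈ P.filter (fun p' => p' ≤ y),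
        ∑ x ∈ Z.filter (fun x => p' ≤ p x), S.wt B x v ≤
      c y * (1 / (2 * (q : ℝ) ^ 2) * S.mass B v) := by
    rw [hc, ← nsmul_eq_mul]
    refine Finset.sum_le_card_nsmul _ _ _ fun p' hp' => ?_
    refine h.sum_wt_not_le (hP p' (Finset.mem_filter.1 hp').1) fun x hx hxp => ?_
    rw [Finset.mem_filter] at hx
    exact hpx x hx.1 (hxp.trans hx.2)
  rw [← Finset.sum_mul, h2] at h1
  have h5 := h1.trans (mul_le_mul_of_nonneg_left h4 (by positivity))
  have h6 : (q : ℝ) ^ 2 * (c y * (1 / (2 * (q : ℝ) ^ 2) * S.mass B v)) =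
      S.mass B v / 2 * c y := by field_simp
  rw [h6] at h5
  exact absurd (le_of_mul_le_mul_right h5 hy) hlt.not_ge

set_option maxHeartbeats 800000 in
/-- An element `y` near `v` behind which the mass drops slowly at all scales up to the largest
radius, and such that at least half of the weight reaches all elements shortly before `y`. It is
found by walking back from `v` as long as this decreases the mass or the number of elements of a
sparse set that lie before the current element. -/
theorem exists_center (h : S.Stable R B q r v) :
    ∃ y, S.within (400 * (q ^ 80 * r)) y v ∧
      (∀ d ≤ 2 * (q ^ 80 * r), ∀ u, S.within d u y →
        (1 - (q : ℝ) ^ 2 * d / B) * S.mass B y ≤ S.mass B u) ∧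
      ∀ Z : Finset α, (∀ x ∈ Z, ∃ p, S.within (2 * (q ^ 80 * r)) p y ∧ ¬ x ≤ p) →
        ∑ x ∈ Z, S.wt B x v ≤ S.mass B v / 2 := by
  classical
  obtain ⟨P, hP, hPcard, hPex⟩ := h.exists_sparse
  have hρB := h.le_rad
  set ρ := q ^ 80 * r with hρ
  have hρ0 : 0 < ρ := h.rad_pos
  have hρ0' : (0 : ℝ) < ρ := by exact_mod_cast hρ0
  have hq := h.q_pos
  have hq6 := h.q_ge
  have hB := h.B_pos
  have hBρ : (B : ℝ) ≤ 2 * ((q : ℝ) ^ 4 * ρ) := by exact_mod_cast hρB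
  have hlogq : 0 < Real.log q := Real.log_pos (by linarith)
  set c : α → ℕ := fun z => (P.filter fun p => p ≤ z).card with hc
  -- a step may be paid for by a drop of the mass by the factor `1 - q ^ 2 / B`, and `3 * ρ` steps
  -- by a drop of `c` by the factor `q ^ 2`
  set A : ℝ := B / (q : ℝ) ^ 2 with hA
  have hA0 : 0 < A := by positivity
  have hAρ : A ≤ 2 * ((q : ℝ) ^ 2 * ρ) := by
    rw [hA, div_le_iff₀ (by positivity)]
    calc (B : ℝ) ≤ _ := hBρ
      _ = _ := by ring
  set D : ℝ := 3 * ρ / (2 * Real.log q) with hD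
  have hD0 : 0 < D := by positivity
  have hDq : D * Real.log q = 3 / 2 * ρ := by
    rw [hD]
    field_simp
  set Φ : α × ℕ → ℝ := fun z => A * Real.log (S.mass B z.1) + D * Real.log (c z.1) + z.2 with hΦ
  have hnear : ∀ {k z}, k ≤ 999 * ρ → S.within k z v → S.within (1000 * ρ) z v := fun hk hz =>
    hz.mono (by lia)
  have hmass : ∀ {k z}, k ≤ 999 * ρ → S.within k z v → 0 < S.mass B z := fun hk hz => by
    have := h.mass_le_two_mul (hnear hk hz)
    linarith [h.mass_pos]
  have hc1 : ∀ {k z}, k ≤ 999 * ρ → S.within k z v → (1 : ℝ) ≤ c z := fun {k z} hk hz => by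
    obtain ⟨p, hp, hpz⟩ := hPex k hk z hz
    have : 0 < c z := Finset.card_pos.2 ⟨p, Finset.mem_filter.2 ⟨hp, hpz⟩⟩
    exact_mod_cast this
  obtain ⟨⟨y, k⟩, hyk, hmin⟩ := Finset.exists_min_image
    ((Finset.univ ×ˢ Finset.range (999 * ρ + 1)).filter fun z : α × ℕ => S.within z.2 z.1 v) Φ
    ⟨(v, 0), by simp [within_refl]⟩
  simp only [Finset.mem_filter, Finset.mem_product, Finset.mem_univ, true_and, Finset.mem_range,
    Nat.lt_succ_iff, Prod.forall] at hyk hmin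
  obtain ⟨hk, hy⟩ := hyk
  have hNy := hmass hk hy
  have hcy := hc1 hk hy
  -- `k` is at most the total drop of the first two summands of `Φ`, where `c` ranges from `1` to
  -- `q ^ 257`, and the mass hardly changes
  have hk400 : k ≤ 400 * ρ := by
    have h1 := hmin v 0 ⟨by lia, within_refl _ _⟩
    simp only [hΦ] at h1
    have h2 : 0 ≤ D * Real.log (c y) := mul_nonneg hD0.le (Real.log_nonneg hcy)
    have h3 : D * Real.log (c v) ≤ 771 / 2 * ρ := by
      have hcv := hc1 (Nat.zero_le _) (within_refl 0 v)
      have h4 : (c v : ℝ) ≤ (q : ℝ) ^ 257 :=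
        le_trans (by exact_mod_cast Finset.card_filter_le _ _) hPcard
      have h5 : Real.log (c v) ≤ 257 * Real.log q := by
        have := Real.log_le_log (by linarith) h4
        rw [Real.log_pow] at this
        exact_mod_cast this
      calc D * Real.log (c v) ≤ D * (257 * Real.log q) := by gcongr
        _ = 257 * (D * Real.log q) := by ring
        _ = _ := by rw [hDq]; ring
    have h6 : A * (Real.log (S.mass B v) - Real.log (S.mass B y)) ≤ ρ := by
      have h7 := h.sub_mul_mass_le (hnear hk hy)
      have h8 := h.div_q_cube_le
      have h9 : (2 : ℝ) ≤ 2 * (q : ℝ) ^ 2 := by nlinarith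
      have h10 : 1 / (2 * (q : ℝ) ^ 2) ≤ 1 / 2 := one_div_le_one_div_of_le (by norm_num) h9
      set ε := 2000 / (q : ℝ) ^ 3 with hε
      have hε0 : 0 < ε := by positivity
      have h11 : 10000 / (q : ℝ) ^ 3 = 5 * ε := by rw [hε]; ring
      have h12 : S.mass B v ≤ (1 + 2 * ε) * S.mass B y := by
        have h13 := mul_le_mul_of_nonneg_left h7 (show 0 ≤ 1 + 2 * ε by linarith)
        have h14 : 0 ≤ ε - 2 * ε ^ 2 := by nlinarith
        have := h.mass_pos
        nlinarith
      have h15 := log_sub_log_le h.mass_pos hNy h12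
      calc A * (Real.log (S.mass B v) - Real.log (S.mass B y))
          ≤ (2 * ((q : ℝ) ^ 2 * ρ)) * (2 * ε) := by
            calc _ ≤ A * (2 * ε) := mul_le_mul_of_nonneg_left h15 hA0.le
              _ ≤ _ := mul_le_mul_of_nonneg_right hAρ (by positivity)
        _ = 8000 / q * ρ := by rw [hε]; field_simp; norm_num
        _ ≤ 1 * ρ := by
          gcongr
          rw [div_le_one hq]
          linarith
        _ = ρ := one_mul _
    have : (k : ℝ) ≤ 400 * ρ := by
      push_cast at h1
      linarith
    exact_mod_cast this
  have hymove : ∀ {d u}, d ≤ 2 * ρ → S.within d u y →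
      k + d ≤ 999 * ρ ∧ S.within (k + d) u v := fun {d u} hd hu =>
    ⟨by lia, (hu.trans hy).mono (by lia)⟩
  refine ⟨y, hy.mono hk400, ?_, ?_⟩
  · intro d hd u hu
    obtain ⟨hkd, huv⟩ := hymove hd hu
    have h1 := hmin u (k + d) ⟨hkd, huv⟩
    have hcu := hc1 hkd huv
    have hNu := hmass hkd huv
    simp only [hΦ] at h1
    have h2 : Real.log (c u) ≤ Real.log (c y) := by
      refine Real.log_le_log (by linarith) ?_
      have : c u ≤ c y := Finset.card_le_card fun p hp => by
        rw [Finset.mem_filter] at hp ⊢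
        exact ⟨hp.1, hp.2.trans hu.le⟩
      exact_mod_cast this
    have h3 : D * Real.log (c u) ≤ D * Real.log (c y) := by gcongr
    push_cast at h1
    have h4 : Real.log (S.mass B y) - d / A ≤ Real.log (S.mass B u) := by
      rw [sub_le_iff_le_add, ← sub_le_iff_le_add', le_div_iff₀ hA0]
      linarith
    have h5 : (q : ℝ) ^ 2 * d / B = d / A := by
      rw [hA]
      field_simp
    rw [h5]
    have h6 := Real.exp_le_exp.2 h4
    rw [Real.exp_log hNu, sub_eq_add_neg, Real.exp_add, Real.exp_log hNy] at h6
    refine le_trans ?_ h6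
    rw [mul_comm]
    gcongr
    linarith [Real.add_one_le_exp (-(d / A))]
  · intro Z hZ
    by_contra! hlt
    choose! p hp hpx using hZ
    obtain ⟨x, hx, hcx⟩ := h.exists_mul_card_le hP (fun x hx => (hp x hx).le) hpx
      (by linarith) hlt
    -- moving on to `p x` takes `2 * ρ` steps, but `D * log c` drops by `3 * ρ`
    obtain ⟨hkd, huv⟩ := hymove le_rfl (hp x hx)
    have h1 := hmin (p x) (k + 2 * ρ) ⟨hkd, huv⟩
    have hcu := hc1 hkd huv
    have hNu := hmass hkd huv
    simp only [hΦ] at h1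
    have h2 : 2 * Real.log q + Real.log (c (p x)) ≤ Real.log (c y) := by
      have := Real.log_le_log (by positivity) hcx
      rwa [Real.log_mul (by positivity) (by positivity), Real.log_pow] at this
    have h3 : 3 * ρ + D * Real.log (c (p x)) ≤ D * Real.log (c y) := by
      have := mul_le_mul_of_nonneg_left h2 hD0.le
      linarith
    have h4 : S.mass B (p x) ≤ (1 + 1 / (q : ℝ) ^ 80) * S.mass B y := by
      refine (h.mass_le_mul (hnear hk hy) (hp x hx)).trans ?_
      have := h.div_pow_le
      gcongr ?_ * _
      linarith
    have h5 := log_sub_log_le hNu hNy h4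
    have h6 := mul_le_mul_of_nonneg_left h5 hA0.le
    have h7 := h.one_div_pow_le (k := 3) (l := 80) (by norm_num)
    have h8 : A * (1 / (q : ℝ) ^ 80) ≤ 2 * ((q : ℝ) ^ 2 * ρ) * (1 / (q : ℝ) ^ 3) :=
      mul_le_mul hAρ h7 (by positivity) (by positivity)
    have h9 : 2 * ((q : ℝ) ^ 2 * ρ) * (1 / (q : ℝ) ^ 3) = 2 / q * ρ := by
      have : (q : ℝ) ^ 3 = (q : ℝ) ^ 2 * q := by ring
      rw [this]
      field_simp
    have h10 : 2 / (q : ℝ) < 1 := by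
      rw [div_lt_one hq]
      linarith
    have h11 : 2 / (q : ℝ) * ρ < ρ := mul_lt_of_lt_one_left hρ0' h10
    push_cast at h1
    linarith

end Stable

/-! ### Weights seen from a center -/

open Classical in
/-- The elements that lie before everything within `d` steps of `y`, without being within `d`
steps themselves. -/
noncomputable def far (S : StepSystem α) (d : ℕ) (y : α) : Finset α :=
  {x | (∀ p, S.within d p y → x ≤ p) ∧ ¬ S.within d x y}

/-- The number of pairs `(u, z)` such that `z` is within `k` steps of `y`, and `u` of `z`. -/
noncomputable def pairCount (S : StepSystem α) (k : ℕ) (y : α) : ℕ :=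
  ∑ z ∈ S.ball k y, (S.ball k z).card

section

variable {S : StepSystem α}

/-- Near `y`, optimal paths from a far element can be cut: the obstacle in the field `back` is an
element near `y` that `x` does not reach. -/
theorem exists_step_of_mem_far {d k : ℕ} {x y u : α} (hx : x ∈ S.far d y) (hu : S.within k u y)
    (hk : k + 1 ≤ d) : ∃ w, S.step w u ∧ x ≤ w ∧ S.cost x w + 1 ≤ S.cost x u := by
  simp only [far, Finset.mem_filter, Finset.mem_univ, true_and] at hx
  have hu' : S.within d u y := hu.mono (by lia)
  have hlt : x < u := lt_of_le_of_ne (hx.1 u hu') fun h => hx.2 (h ▸ hu')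
  rcases S.back hlt with h | ⟨p, hp, hxp⟩
  · exact h
  · exact absurd (hx.1 p (((within_of_step hp).trans hu).mono (by lia))) hxp

theorem exists_within_of_mem_far {d k j : ℕ} {x y u : α} (hx : x ∈ S.far d y)
    (hu : S.within k u y) (hk : k + j ≤ d) :
    ∃ w, S.within j w u ∧ x ≤ w ∧ S.cost x w + j ≤ S.cost x u := by
  induction j generalizing u k with
  | zero =>
    refine ⟨u, within_refl _ _, ?_, le_rfl⟩
    simp only [far, Finset.mem_filter, Finset.mem_univ, true_and] at hx
    exact hx.1 u (hu.mono (by lia))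
  | succ j ih =>
    obtain ⟨w, hw, hxw, hc⟩ := exists_step_of_mem_far hx hu (by lia)
    obtain ⟨z, hz, hxz, hcz⟩ := ih ((within_of_step hw).trans hu) (by lia)
    exact ⟨z, hz.trans (within_of_step hw), hxz, by lia⟩

theorem exists_finset_of_mem_far {d k j : ℕ} {x y u : α} (hx : x ∈ S.far d y)
    (hu : S.within k u y) (hk : k + j ≤ d) :
    ∃ U : Finset α, U.card = j + 1 ∧
      ∀ w ∈ U, S.within j w u ∧ x ≤ w ∧ S.cost x w ≤ S.cost x u := by
  classical
  induction j generalizing u k with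
  | zero =>
    refine ⟨{u}, by simp, ?_⟩
    simp only [far, Finset.mem_filter, Finset.mem_univ, true_and] at hx
    simpa [within_refl] using hx.1 u (hu.mono (by lia))
  | succ j ih =>
    obtain ⟨w, hw, hxw, hc⟩ := exists_step_of_mem_far hx hu (by lia)
    obtain ⟨U, hU, hU'⟩ := ih ((within_of_step hw).trans hu) (by lia)
    have huU : u ∉ U := fun h => absurd (hU' u h).1.le (S.step_lt hw).not_ge
    refine ⟨insert u U, by rw [Finset.card_insert_of_notMem huU, hU], fun z hz => ?_⟩
    rcases Finset.mem_insert.1 hz with rfl | hz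
    · exact ⟨within_refl _ _, hxw.trans (S.step_lt hw).le, le_rfl⟩
    · obtain ⟨h1, h2, h3⟩ := hU' z hz
      exact ⟨h1.trans (within_of_step hw), h2, by lia⟩

end

/-- An element `y` near `v` as provided by `Stable.exists_center`: the mass drops slowly when going
back from `y`, and the elements that fail to reach everything shortly before `y` have at most half
of the weight. -/
structure IsCenter (S : StepSystem α) (B q r : ℕ) (v y : α) : Prop where
  near : S.within (400 * (q ^ 80 * r)) y v
  le_mass : ∀ d ≤ 2 * (q ^ 80 * r), ∀ u, S.within d u y →
    (1 - (q : ℝ) ^ 2 * d / B) * S.mass B y ≤ S.mass B u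
  sum_wt_le : ∀ Z : Finset α, (∀ x ∈ Z, ∃ p, S.within (2 * (q ^ 80 * r)) p y ∧ ¬ x ≤ p) →
    ∑ x ∈ Z, S.wt B x v ≤ S.mass B v / 2

namespace IsCenter

variable {S : StepSystem α} {R : ℝ} {B q r : ℕ} {v y : α}

theorem within_of_within (hy : S.IsCenter B q r v y) {u : α} {k : ℕ} (hu : S.within k u y)
    (hk : k ≤ 2 * (q ^ 80 * r)) : S.within (1000 * (q ^ 80 * r)) u v :=
  (hu.trans hy.near).mono (by lia)

theorem within_self (hy : S.IsCenter B q r v y) : S.within (1000 * (q ^ 80 * r)) y v :=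
  hy.within_of_within (within_refl 0 y) (Nat.zero_le _)

theorem le_height (h : S.Stable R B q r v) (hy : S.IsCenter B q r v y) : 2 * B ≤ S.height y := by
  have h1 := hy.near.height_le
  have h2 := h.le_height
  have h3 := h.mul_rad_le
  lia

theorem mass_le (h : S.Stable R B q r v) (hy : S.IsCenter B q r v y) {u : α} {k : ℕ}
    (hu : S.within k u y) : S.mass B u ≤ 2 * S.mass B v := by
  have h1 := h.mass_le_mul (within_refl _ v) (hu.trans hy.near)
  have h2 := h.div_pow_le.trans (h.one_div_pow_le (Nat.zero_le 80))
  have h3 := h.mass_pos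
  rw [pow_zero, div_one] at h2
  nlinarith

theorem mass_pos (h : S.Stable R B q r v) (hy : S.IsCenter B q r v y) : 0 < S.mass B y := by
  have := h.mass_le_two_mul hy.within_self
  linarith [h.mass_pos]

/-- The elements near `y` carry little weight: apart from a minimal one among them, they do not
reach that minimal one. -/
theorem sum_wt_ball_le (h : S.Stable R B q r v) (hy : S.IsCenter B q r v y) :
    ∑ x ∈ S.ball (2 * (q ^ 80 * r)) y, S.wt B x y ≤ 4 / (q : ℝ) ^ 2 * S.mass B y := by
  classical
  have hq := h.q_pos
  have hB := h.B_pos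
  obtain ⟨p, hp⟩ := (S.ball (2 * (q ^ 80 * r)) y).exists_minimal
    ⟨y, mem_ball.2 (within_refl _ _)⟩
  have hpy := mem_ball.1 hp.prop
  have h1 := h.sum_wt_le hy.within_self hpy (θ := 0)
    (Z := (S.ball (2 * (q ^ 80 * r)) y).erase p) fun x hx => by
      rw [Finset.mem_erase] at hx
      rw [wt_of_not_le fun hxp => hx.1 (hp.eq_of_le hx.2 hxp), zero_mul]
  rw [← Finset.add_sum_erase _ _ hp.prop]
  have h2 := hy.le_mass _ le_rfl p hpy
  have h3 := wt_le_one (S := S) hB.le p y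
  have h4 := StepSystem.le_mass h.one_le_B (y := y) (by linarith [hy.le_height h])
  have h5 : (q : ℝ) ^ 2 * (2 * (q ^ 80 * r) : ℕ) / B ≤ 2 / (q : ℝ) ^ 2 := by
    rw [div_le_div_iff₀ hB (by positivity)]
    have : (q : ℝ) ^ 4 * (q ^ 80 * r) ≤ B := by exact_mod_cast h.rad_le
    push_cast
    calc (q : ℝ) ^ 2 * (2 * ((q : ℝ) ^ 80 * r)) * (q : ℝ) ^ 2
        = 2 * ((q : ℝ) ^ 4 * (q ^ 80 * r)) := by ring
      _ ≤ 2 * (B : ℝ) := by gcongr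
  have h6 : (3 : ℝ) * (q : ℝ) ^ 2 ≤ B := by
    have h7 : (q : ℝ) ^ 4 ≤ B := by
      have h8 : q ^ 4 * 1 ≤ q ^ 4 * (q ^ 80 * r) := Nat.mul_le_mul_left _ h.rad_pos
      exact_mod_cast (by linarith [h.rad_le] : q ^ 4 ≤ B)
    have h9 : (3 : ℝ) ≤ (q : ℝ) ^ 2 := by nlinarith [h.q_ge]
    have h10 : (q : ℝ) ^ 4 = (q : ℝ) ^ 2 * (q : ℝ) ^ 2 := by ring
    nlinarith [sq_nonneg (q : ℝ)]
  have h11 : 1 ≤ 1 / (q : ℝ) ^ 2 * S.mass B y := by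
    rw [one_div_mul_eq_div, le_div_iff₀ (by positivity)]
    linarith
  have h12 := h.div_pow_le.trans (h.one_div_pow_le (k := 2) (by norm_num))
  have h13 := hy.mass_pos h
  have h14 := mul_le_mul_of_nonneg_right h12 h13.le
  have h15 := mul_le_mul_of_nonneg_right h5 h13.le
  have h16 : 2 / (q : ℝ) ^ 2 = 2 * (1 / (q : ℝ) ^ 2) := by ring
  have h17 : 4 / (q : ℝ) ^ 2 = 4 * (1 / (q : ℝ) ^ 2) := by ring
  rw [h16] at h15
  rw [h17]
  rw [sub_mul, one_mul] at h2
  linarith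

theorem one_div_sq_le (h : S.Stable R B q r v) : 1 / (q : ℝ) ^ 2 ≤ 1 / 10 ^ 12 := by
  refine one_div_le_one_div_of_le (by norm_num) ?_
  nlinarith [h.q_ge]

/-- A constant part of the weight is far from `y`: the elements that miss something near `y` have
at most half of the weight, by the choice of `y`, and those near `y` have little. -/
theorem le_sum_far (h : S.Stable R B q r v) (hy : S.IsCenter B q r v y) :
    3 / 10 * S.mass B v ≤ ∑ x ∈ S.far (2 * (q ^ 80 * r)) y, S.wt B x y := by
  classical
  set d := 2 * (q ^ 80 * r) with hd
  set O : Finset α := Finset.univ.filter fun x => ∃ p, S.within d p y ∧ ¬ x ≤ p with hO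
  set Z : Finset α := Finset.univ.filter fun x => S.wt B x y ≤ 9 / 10 * S.wt B x v with hZ
  have h1 : ∑ x ∈ O, S.wt B x v ≤ S.mass B v / 2 :=
    hy.sum_wt_le O fun x hx => (Finset.mem_filter.1 hx).2
  have h2 := h.sum_wt_le (within_refl _ v) hy.near (θ := 9 / 10) (Z := Z)
    fun x hx => (Finset.mem_filter.1 hx).2
  have h3 := hy.sum_wt_ball_le h
  have h4 := h.sub_mul_mass_le hy.within_self
  have h5 := h.mass_pos
  have h6 := hy.mass_le h (within_refl 0 y)
  -- an `x` outside `O` is near `y` or far from `y`, and outside `Z` its weight hardly drops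
  have hpt : ∀ x, 9 / 10 * S.wt B x v ≤
      (if x ∈ S.far d y then S.wt B x y else 0) + (if x ∈ S.ball d y then S.wt B x y else 0) +
      (if x ∈ Z then S.wt B x v else 0) + (if x ∈ O then S.wt B x v else 0) := by
    intro x
    have hv := wt_nonneg (S := S) B x v
    have hxy := wt_nonneg (S := S) B x y
    by_cases hxO : x ∈ O
    · rw [if_pos hxO]
      have : 0 ≤ (if x ∈ S.far d y then S.wt B x y else 0) := by split_ifs <;> simp [hxy]
      have : 0 ≤ (if x ∈ S.ball d y then S.wt B x y else 0) := by split_ifs <;> simp [hxy]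
      have : 0 ≤ (if x ∈ Z then S.wt B x v else 0) := by split_ifs <;> simp [hv]
      linarith
    by_cases hxZ : x ∈ Z
    · rw [if_pos hxZ]
      have : 0 ≤ (if x ∈ S.far d y then S.wt B x y else 0) := by split_ifs <;> simp [hxy]
      have : 0 ≤ (if x ∈ S.ball d y then S.wt B x y else 0) := by split_ifs <;> simp [hxy]
      have : 0 ≤ (if x ∈ O then S.wt B x v else 0) := by simp [hxO]
      linarith
    rw [if_neg hxO, if_neg hxZ]
    have hlt : 9 / 10 * S.wt B x v ≤ S.wt B x y := by
      simp only [hZ, Finset.mem_filter, Finset.mem_univ, true_and, not_le] at hxZ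
      exact hxZ.le
    by_cases hxb : x ∈ S.ball d y
    · rw [if_pos hxb]
      have : 0 ≤ (if x ∈ S.far d y then S.wt B x y else 0) := by split_ifs <;> simp [hxy]
      linarith
    · have hxf : x ∈ S.far d y := by
        simp only [hO, Finset.mem_filter, Finset.mem_univ, true_and, not_exists, not_and,
          not_not] at hxO
        simp only [far, Finset.mem_filter, Finset.mem_univ, true_and]
        exact ⟨hxO, fun h => hxb (mem_ball.2 h)⟩
      rw [if_pos hxf, if_neg hxb]
      linarith
  have hsum := Finset.sum_le_sum fun x (_ : x ∈ Finset.univ) => hpt x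
  simp only [Finset.sum_add_distrib, Finset.sum_ite_mem, Finset.univ_inter,
    ← Finset.mul_sum] at hsum
  have h7 := one_div_sq_le h
  have h8 := h.div_pow_le.trans (h.one_div_pow_le (k := 2) (by norm_num))
  have h9 := h.div_q_cube_le
  have h10 : 1 / (2 * (q : ℝ) ^ 2) = 1 / 2 * (1 / (q : ℝ) ^ 2) := by ring
  have h11 : 10000 / (q : ℝ) ^ 3 = 5 * (2000 / (q : ℝ) ^ 3) := by ring
  have h12 : 4 / (q : ℝ) ^ 2 = 4 * (1 / (q : ℝ) ^ 2) := by ring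
  have h13 : 0 < 1 / (q : ℝ) ^ 2 := by have := h.q_pos; positivity
  have h14 : 4 / (q : ℝ) ^ 2 * S.mass B y ≤ 1 / 100 * S.mass B v := by
    rw [h12]
    nlinarith
  have h15 : 16 / (q : ℝ) ^ 84 * S.mass B v ≤ 1 / 10000 * S.mass B v :=
    mul_le_mul_of_nonneg_right (by linarith) h5.le
  have h16 : 2000 / (q : ℝ) ^ 3 * S.mass B v ≤ 1 / 10000 * S.mass B v :=
    mul_le_mul_of_nonneg_right (by linarith) h5.le
  have h17 : S.mass B v = ∑ x, S.wt B x v := rfl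
  rw [sub_mul, one_mul] at h4
  linarith

/-- Few `x` get much further away from `y` than from `u`, at the given scale. -/
theorem sum_wt_back_le (h : S.Stable R B q r v) (hy : S.IsCenter B q r v y) {a : ℕ} (ha : r ≤ a)
    (ha' : q ^ 8 * a ≤ q ^ 80 * r) {u : α} (hu : S.within (q ^ 4 * a) u y) {Z : Finset α}
    (hZ : ∀ x ∈ Z, x ≤ u ∧ 16 * S.cost x y + q ^ 8 * a ≤ 16 * S.cost x u) :
    ∑ x ∈ Z, S.wt B x y ≤ 1 / 100 * S.mass B v := by
  have hq := h.q_pos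
  have hB := h.B_pos
  have hr := h.r_pos
  have hle : (r : ℝ) ≤ a := by exact_mod_cast ha
  set m : ℝ := (q : ℝ) ^ 8 * a with hm
  have hm0 : 0 < m := by
    have : (0 : ℝ) < a := by linarith
    positivity
  -- between `y` and `u`, the weight of each `x ∈ Z` drops by the factor `exp (-s)`
  set s : ℝ := m / (16 * B) with hs
  have hs0 : 0 < s := by positivity
  have hmB : m ≤ B := by
    have h1 : q ^ 8 * a ≤ B := ha'.trans (by linarith [h.mul_rad_le])
    rw [hm]
    exact_mod_cast h1
  have hs1 : s ≤ 1 := by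
    rw [hs, div_le_one (by positivity)]
    linarith
  have hθ : s / 2 ≤ 1 - Real.exp (-s) := by
    have h1 : Real.exp (-s) ≤ 1 / (1 + s) := by
      rw [Real.exp_neg, one_div]
      exact inv_anti₀ (by linarith) (by linarith [Real.add_one_le_exp s])
    have h2 : 1 / (1 + s) ≤ 1 - s / 2 := by
      rw [div_le_iff₀ (by linarith)]
      nlinarith
    linarith
  have h1 := h.sum_wt_le hy.within_self hu (θ := Real.exp (-s)) (Z := Z) fun x hx => by
    obtain ⟨hxu, hc⟩ := hZ x hx
    rw [wt_of_le hxu, wt_of_le (hxu.trans hu.le), ← Real.exp_add]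
    refine Real.exp_le_exp.2 ?_
    have hc' : 16 * (S.cost x y : ℝ) + m ≤ 16 * S.cost x u := by
      rw [hm]
      exact_mod_cast hc
    rw [hs, ← sub_nonneg]
    have : -(m / (16 * (B : ℝ))) + -(S.cost x y : ℝ) / B - -(S.cost x u : ℝ) / B =
      (16 * S.cost x u - (16 * (S.cost x y : ℝ) + m)) / (16 * B) := by
        field_simp
        ring
    rw [this]
    exact div_nonneg (by linarith) (by positivity)
  have hq1 : 1 ≤ q := by linarith [h.le_q]
  have h48 : q ^ 4 * a ≤ q ^ 8 * a :=
    Nat.mul_le_mul_right _ (Nat.pow_le_pow_right hq1 (by norm_num))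
  have h2 := hy.le_mass _ (by lia) u hu
  have hNy := hy.mass_pos h
  have h3 : (q : ℝ) ^ 2 * (q ^ 4 * a : ℕ) / B = 16 / (q : ℝ) ^ 2 * s := by
    rw [hs, hm]
    push_cast
    field_simp
  have h4 : 16 / (q : ℝ) ^ 84 ≤ 16 / (q : ℝ) ^ 2 * s := by
    have h5 : (B : ℝ) ≤ 2 * (r * (q : ℝ) ^ 84) := by exact_mod_cast h.le_mul
    have h6 : 16 / (q : ℝ) ^ 2 * s = (q : ℝ) ^ 6 * a / B := by
      rw [hs, hm]
      field_simp
    have h7 : (32 : ℝ) ≤ (q : ℝ) ^ 6 :=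
      le_trans (by linarith [h.q_ge]) (le_self_pow₀ (by linarith [h.q_ge]) (by norm_num))
    rw [h6, div_le_div_iff₀ (by positivity) hB]
    calc 16 * (B : ℝ) ≤ 16 * (2 * (r * (q : ℝ) ^ 84)) := by gcongr
      _ = 32 * r * (q : ℝ) ^ 84 := by ring
      _ ≤ (q : ℝ) ^ 6 * a * (q : ℝ) ^ 84 := by gcongr
  have h5 := Finset.sum_nonneg fun x (_ : x ∈ Z) => wt_nonneg (S := S) B x y
  have h6 := mul_le_mul_of_nonneg_right hθ h5
  rw [h3, sub_mul, one_mul] at h2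
  have h7 := mul_le_mul_of_nonneg_right h4 hNy.le
  have h8 : s / 2 * ∑ x ∈ Z, S.wt B x y ≤ s / 2 * (64 / (q : ℝ) ^ 2 * S.mass B y) := by
    have : s / 2 * (64 / (q : ℝ) ^ 2 * S.mass B y) =
      2 * (16 / (q : ℝ) ^ 2 * s * S.mass B y) := by ring
    linarith
  have h9 := le_of_mul_le_mul_left h8 (by positivity)
  have h10 := hy.mass_le h (within_refl 0 y)
  have h11 := one_div_sq_le h
  have h12 : 64 / (q : ℝ) ^ 2 = 64 * (1 / (q : ℝ) ^ 2) := by ring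
  have h13 : 0 < 1 / (q : ℝ) ^ 2 := by positivity
  have h14 := h.mass_pos
  rw [h12] at h9
  nlinarith

end IsCenter

/-! ### Growth of the number of close pairs -/

namespace IsCenter

variable {S : StepSystem α} {R : ℝ} {B q r : ℕ} {v y : α}

open Classical in
/-- If `u` is shortly before `z`, which is shortly before `y`, then the edges into `u` from the
elements up to `m = q ^ 8 * a` steps before it have a large total gain at the single target `z`:
for most `x` about `m` of these elements lie on an optimal path from `x`, and each is cheaper to
reach than `u` by about `m / 2` or more. -/
theorem le_sum_gain_at (h : S.Stable R B q r v) (hy : S.IsCenter B q r v y) {a : ℕ} (ha : r ≤ a)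
    (ha' : q ^ 8 * a ≤ q ^ 80 * r) {u z : α} (hz : S.within a z y) (hu : S.within a u z) :
    1 / 32 * S.mass B v * ((q ^ 8 * a : ℕ) : ℝ) ^ 2 ≤
      ((∑ w ∈ S.ball (q ^ 8 * a) u, ∑ x with x ≤ w,
        (S.cost x z - (S.cost x w + 1 + a)) : ℕ) : ℝ) := by
  have hq1 := h.le_q
  have hr1 := h.one_le_r
  have hm1000 : 1000 * a ≤ q ^ 8 * a :=
    Nat.mul_le_mul_right _ ((by lia : 1000 ≤ q).trans (Nat.le_self_pow (by norm_num) q))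
  have hq4 : 2 * a ≤ q ^ 4 * a :=
    Nat.mul_le_mul_right _ ((by lia : 2 ≤ q).trans (Nat.le_self_pow (by norm_num) q))
  set m := q ^ 8 * a with hm
  have huy : S.within (2 * a) u y := by
    rw [two_mul]
    exact hu.trans hz
  set F := S.far (2 * (q ^ 80 * r)) y with hF
  have hFle : ∀ x ∈ F, ∀ p, S.within (2 * (q ^ 80 * r)) p y → x ≤ p := fun x hx => by
    simp only [hF, far, Finset.mem_filter, Finset.mem_univ, true_and] at hx
    exact hx.1
  have hFu : ∀ x ∈ F, x ≤ u := fun x hx => hFle x hx u (huy.mono (by lia))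
  have hFz : ∀ x ∈ F, x ≤ z := fun x hx => hFle x hx z (hz.mono (by lia))
  set Z := F.filter fun x => 16 * S.cost x y + m ≤ 16 * S.cost x u with hZ
  set E := F.filter fun x => S.cost x z + 4 * r ≤ S.cost x y with hE
  -- the good elements: all but few, in terms of weight
  set X := F.filter fun x => 16 * S.cost x u < 16 * S.cost x y + m ∧
    S.cost x y < S.cost x z + 4 * r with hX
  have hZle := hy.sum_wt_back_le h ha ha' (huy.mono hq4) (Z := Z) fun x hx =>
    ⟨hFu x (Finset.mem_filter.1 hx).1, (Finset.mem_filter.1 hx).2⟩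
  have hEle : ∑ x ∈ E, S.wt B x y ≤ 1 / 100 * S.mass B v := by
    have h1 := sq_mul_card_le h.gain_le h.one_le_r hz
    have h2 : (E.card : ℝ) ≤ R / (r : ℝ) ^ 2 := by
      have := h.r_pos
      rw [le_div_iff₀ (by positivity), mul_comm]
      refine le_trans ?_ h1
      gcongr
      intro x hx
      rw [hE, Finset.mem_filter] at hx
      simpa using ⟨hFz x hx.1, hx.2⟩
    have h3 : ∑ x ∈ E, S.wt B x y ≤ E.card := by
      refine (Finset.sum_le_sum fun x _ => wt_le_one h.B_pos.le x y).trans ?_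
      simp
    have h4 := h.div_sq_le
    have h5 := h.div_pow_le.trans (h.one_div_pow_le (k := 2) (by norm_num))
    have h6 := one_div_sq_le h
    have h7 := h.mass_pos
    have h8 : 16 / (q : ℝ) ^ 84 = 4 * (4 / (q : ℝ) ^ 84) := by ring
    have h9 : 4 / (q : ℝ) ^ 84 * S.mass B v ≤ 1 / 100 * S.mass B v := by
      refine mul_le_mul_of_nonneg_right ?_ h7.le
      have : 0 < 4 / (q : ℝ) ^ 84 := by have := h.q_pos; positivity
      linarith
    linarith
  have hXcard : 1 / 4 * S.mass B v ≤ X.card := by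
    have h1 := hy.le_sum_far h
    have h2 : ∑ x ∈ X, S.wt B x y ≤ X.card := by
      refine (Finset.sum_le_sum fun x _ => wt_le_one h.B_pos.le x y).trans ?_
      simp
    have h3 : F ⊆ X ∪ (Z ∪ E) := by
      intro x hx
      simp only [hX, hZ, hE, Finset.mem_union, Finset.mem_filter, hx, true_and]
      lia
    have h4 : ∑ x ∈ F, S.wt B x y ≤
        ∑ x ∈ X, S.wt B x y + (∑ x ∈ Z, S.wt B x y + ∑ x ∈ E, S.wt B x y) := by
      refine (Finset.sum_le_sum_of_subset_of_nonneg h3 fun _ _ _ => wt_nonneg ..).trans ?_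
      have h5 := Finset.sum_union_inter (s₁ := X) (s₂ := Z ∪ E) (f := fun x => S.wt B x y)
      have h6 := Finset.sum_union_inter (s₁ := Z) (s₂ := E) (f := fun x => S.wt B x y)
      have h7 := Finset.sum_nonneg fun x (_ : x ∈ X ∩ (Z ∪ E)) => wt_nonneg (S := S) B x y
      have h8 := Finset.sum_nonneg fun x (_ : x ∈ Z ∩ E) => wt_nonneg (S := S) B x y
      linarith
    have h5 := h.mass_pos
    linarith
  -- at least `m / 2` elements before `u` lie on an optimal path from `x`, in its earlier half
  have hgood : ∀ x ∈ X, m ^ 2 ≤ 8 * ∑ w ∈ S.ball m u with x ≤ w,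
      (S.cost x z - (S.cost x w + 1 + a)) := by
    intro x hx
    rw [hX, Finset.mem_filter] at hx
    obtain ⟨hxF, hxu, hxz⟩ := hx
    obtain ⟨w₀, hw₀, -, hc₀⟩ := exists_within_of_mem_far (j := m / 2) hxF huy (by lia)
    obtain ⟨U, hU, hU'⟩ := exists_finset_of_mem_far (j := m - m / 2) hxF (hw₀.trans huy) (by lia)
    have hsub : U ⊆ (S.ball m u).filter fun w => x ≤ w := by
      intro w hw
      obtain ⟨h1, h2, -⟩ := hU' w hw
      simp only [Finset.mem_filter, mem_ball]
      exact ⟨(h1.trans hw₀).mono (by lia), h2⟩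
    have h1 : U.card • m ≤ ∑ w ∈ U, 4 * (S.cost x z - (S.cost x w + 1 + a)) := by
      refine Finset.card_nsmul_le_sum _ _ _ fun w hw => ?_
      obtain ⟨-, -, h3⟩ := hU' w hw
      lia
    have h2 := Finset.sum_le_sum_of_subset (f := fun w => S.cost x z - (S.cost x w + 1 + a)) hsub
    rw [hU, smul_eq_mul, ← Finset.mul_sum] at h1
    have h3 : m ≤ 2 * (m - m / 2 + 1) := by lia
    nlinarith
  have hswap : ∑ x ∈ X, ∑ w ∈ S.ball m u with x ≤ w, (S.cost x z - (S.cost x w + 1 + a)) ≤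
      ∑ w ∈ S.ball m u, ∑ x with x ≤ w, (S.cost x z - (S.cost x w + 1 + a)) := by
    rw [Finset.sum_comm' (t' := S.ball m u) (s' := fun w => X.filter fun x => x ≤ w)
      (by intro x w; simp only [Finset.mem_filter]; tauto)]
    gcongr
    simp
  have h1 := (Finset.card_nsmul_le_sum X _ _ hgood).trans
    ((Finset.mul_sum _ _ _).symm.le.trans (Nat.mul_le_mul_left 8 hswap))
  rw [smul_eq_mul] at h1
  have h2 : (X.card : ℝ) * (m : ℝ) ^ 2 ≤ 8 * ((∑ w ∈ S.ball m u, ∑ x with x ≤ w,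
        (S.cost x z - (S.cost x w + 1 + a)) : ℕ) : ℝ) := by exact_mod_cast h1
  have h3 : 1 / 4 * S.mass B v * (m : ℝ) ^ 2 ≤ X.card * (m : ℝ) ^ 2 := by gcongr
  linarith

/-- Summing the gains of all edges near `y` shows that the number of close pairs grows quickly with
the radius. -/
theorem mul_pairCount_le (h : S.Stable R B q r v) (hy : S.IsCenter B q r v y) {a : ℕ}
    (ha : r ≤ a) (ha' : q ^ 8 * a ≤ q ^ 80 * r) :
    1 / 32 * S.mass B v * ((q ^ 8 * a : ℕ) : ℝ) ^ 2 * S.pairCount a y ≤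
      R * S.pairCount (q ^ 8 * a) y := by
  classical
  have hq1 := h.le_q
  have hq8 : 2 * a ≤ q ^ 8 * a :=
    Nat.mul_le_mul_right _ ((by lia : 2 ≤ q).trans (Nat.le_self_pow (by norm_num) q))
  set m := q ^ 8 * a with hm
  set g : α → α → ℕ := fun u z =>
    ∑ w ∈ S.ball m u, ∑ x with x ≤ w, (S.cost x z - (S.cost x w + 1 + a)) with hg
  have hR : 0 ≤ R := (Nat.cast_nonneg _).trans (h.gain_le y y 0 le_rfl)
  have h1 : 1 / 32 * S.mass B v * (m : ℝ) ^ 2 * S.pairCount a y ≤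
      ((∑ z ∈ S.ball a y, ∑ u ∈ S.ball a z, g u z : ℕ) : ℝ) := by
    unfold pairCount
    push_cast
    rw [Finset.mul_sum]
    refine Finset.sum_le_sum fun z hz => ?_
    rw [mul_comm, ← nsmul_eq_mul]
    refine Finset.card_nsmul_le_sum _ _ _ fun u hu => ?_
    have := hy.le_sum_gain_at h ha ha' (mem_ball.1 hz) (mem_ball.1 hu)
    rw [← hm] at this
    exact_mod_cast this
  have h2 : ∑ z ∈ S.ball a y, ∑ u ∈ S.ball a z, g u z ≤
      ∑ u ∈ S.ball m y, ∑ z with S.within a u z, g u z := by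
    rw [Finset.sum_comm' (t' := S.ball m y)
      (s' := fun u => Finset.univ.filter fun z => S.within a u z ∧ S.within a z y)]
    · gcongr
      rename_i u hu z hz
      exact fun h => h.1
    · intro z u
      simp only [mem_ball, Finset.mem_filter, Finset.mem_univ, true_and]
      refine ⟨fun h => ⟨⟨h.2, h.1⟩, (h.2.trans h.1).mono (by lia)⟩, fun h => ⟨h.1.2, h.1.1⟩⟩
  have h3 : ∀ u, ∑ z with S.within a u z, g u z = ∑ w ∈ S.ball m u, S.gain w u a := by
    intro u
    simp only [hg, gain]
    rw [Finset.sum_comm]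
    refine Finset.sum_congr rfl fun w _ => Finset.sum_comm
  have h4 : ((∑ u ∈ S.ball m y, ∑ w ∈ S.ball m u, S.gain w u a : ℕ) : ℝ) ≤
      R * S.pairCount m y := by
    unfold pairCount
    push_cast
    rw [Finset.mul_sum]
    refine Finset.sum_le_sum fun u _ => ?_
    rw [mul_comm, ← nsmul_eq_mul]
    exact Finset.sum_le_card_nsmul _ _ _ fun w hw => h.gain_le w u a (mem_ball.1 hw).le
  simp only [h3] at h2
  have h5 : ((∑ z ∈ S.ball a y, ∑ u ∈ S.ball a z, g u z : ℕ) : ℝ) ≤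
      ((∑ u ∈ S.ball m y, ∑ w ∈ S.ball m u, S.gain w u a : ℕ) : ℝ) := by exact_mod_cast h2
  exact h1.trans (h5.trans h4)

/-- Multiplying the radius by `q ^ 8` multiplies the number of close pairs by at least `q ^ 99`,
because `mass * (q ^ 8 * a) ^ 2 / R` is at least of the order of `q ^ 100`. -/
theorem pow_mul_pairCount_le (h : S.Stable R B q r v) (hy : S.IsCenter B q r v y) {a : ℕ}
    (ha : r ≤ a) (ha' : q ^ 8 * a ≤ q ^ 80 * r) :
    (q : ℝ) ^ 99 * S.pairCount a y ≤ S.pairCount (q ^ 8 * a) y := by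
  have h1 := hy.mul_pairCount_le h ha ha'
  have hq := h.q_pos
  have hq6 := h.q_ge
  have hB := h.B_pos
  have hN := h.mass_pos
  have hle : (r : ℝ) ≤ a := by exact_mod_cast ha
  have h2 : (B : ℝ) ≤ 2 * (a * (q : ℝ) ^ 84) := by
    have : (B : ℝ) ≤ 2 * (r * (q : ℝ) ^ 84) := by exact_mod_cast h.le_mul
    exact this.trans (by gcongr)
  set s : ℝ := (S.pairCount a y : ℝ) with hs
  set s' : ℝ := (S.pairCount (q ^ 8 * a) y : ℝ) with hs'
  have hs0 : 0 ≤ s := Nat.cast_nonneg _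
  have hs0' : 0 ≤ s' := Nat.cast_nonneg _
  have ha0 : (0 : ℝ) < a := by linarith [h.r_pos]
  have h3 : (q : ℝ) ^ 252 * (1 / 32 * S.mass B v * ((q : ℝ) ^ 8 * a) ^ 2 * s) ≤
      S.mass B v * (2 * (a * (q : ℝ) ^ 84)) ^ 2 * s' := by
    push_cast at h1
    calc _ ≤ (q : ℝ) ^ 252 * (R * s') := mul_le_mul_of_nonneg_left h1 (pow_nonneg hq.le _)
      _ = (q : ℝ) ^ 252 * R * s' := by ring
      _ ≤ S.mass B v * (B : ℝ) ^ 2 * s' := mul_le_mul_of_nonneg_right h.pow_mul_le hs0'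
      _ ≤ _ := by gcongr
  have h4 : (q : ℝ) ^ 252 * (1 / 32 * S.mass B v * ((q : ℝ) ^ 8 * a) ^ 2 * s) =
      (S.mass B v * (a : ℝ) ^ 2 * (q : ℝ) ^ 168) * (1 / 32 * (q : ℝ) ^ 100 * s) := by
    have : (q : ℝ) ^ 252 = (q : ℝ) ^ 168 * (q : ℝ) ^ 84 := by rw [← pow_add]
    have h16 : (q : ℝ) ^ 100 = (q : ℝ) ^ 84 * ((q : ℝ) ^ 8) ^ 2 := by rw [← pow_mul, ← pow_add]
    rw [this, h16]
    ring
  have h5 : S.mass B v * (2 * (a * (q : ℝ) ^ 84)) ^ 2 * s' =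
      (S.mass B v * (a : ℝ) ^ 2 * (q : ℝ) ^ 168) * (4 * s') := by
    have : (q : ℝ) ^ 168 = ((q : ℝ) ^ 84) ^ 2 := by rw [← pow_mul]
    rw [this]
    ring
  rw [h4, h5] at h3
  have h6 := le_of_mul_le_mul_left h3 (by positivity)
  have h7 : (q : ℝ) ^ 100 = q * (q : ℝ) ^ 99 := by rw [← pow_succ']
  rw [h7] at h6
  have h8 : 0 ≤ (q : ℝ) ^ 99 * s := mul_nonneg (pow_nonneg hq.le _) hs0
  nlinarith

theorem pow_mul_pairCount_iterate_le (h : S.Stable R B q r v) (hy : S.IsCenter B q r v y)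
    {l : ℕ} (hl : l ≤ 10) :
    (q : ℝ) ^ (99 * l) * S.pairCount r y ≤ S.pairCount (q ^ (8 * l) * r) y := by
  have hq := h.q_pos
  have hq1 : 1 ≤ q := by linarith [h.le_q]
  induction l with
  | zero => simp
  | succ l ih =>
    have h1 : q ^ (8 * (l + 1)) * r = q ^ 8 * (q ^ (8 * l) * r) := by ring
    have h2 := hy.pow_mul_pairCount_le h (a := q ^ (8 * l) * r)
      (Nat.le_mul_of_pos_left _ (by positivity)) (by
        rw [← h1]
        exact Nat.mul_le_mul_right _ (Nat.pow_le_pow_right hq1 (by lia)))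
    rw [h1]
    refine le_trans ?_ h2
    rw [Nat.mul_succ, pow_add, mul_comm ((q : ℝ) ^ (99 * l)), mul_assoc]
    exact mul_le_mul_of_nonneg_left (ih (by lia)) (pow_nonneg hq.le _)

/-- After ten enlargements of the radius there would be more close pairs than the squared mass
allows, since each ball has at most three times as many elements as the mass. -/
theorem false_of_stable (h : S.Stable R B q r v) (hy : S.IsCenter B q r v y) : False := by
  have hq := h.q_pos
  have hq6 := h.q_ge
  have hN := h.mass_pos
  have hr := h.r_pos
  have hρB := h.mul_rad_le
  have hρ0 := h.rad_pos
  have hrρ : r ≤ q ^ 80 * r := Nat.le_mul_of_pos_left _ (by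
    have := h.le_q
    positivity)
  have h1 := hy.pow_mul_pairCount_iterate_le h (l := 10) le_rfl
  norm_num only at h1
  have hheight := hy.le_height h
  have h2 : (r : ℝ) ^ 2 ≤ S.pairCount r y := by
    have h3 : (S.ball r y).card • r ≤ S.pairCount r y := by
      refine Finset.card_nsmul_le_sum _ _ _ fun z hz => ?_
      refine (lt_card_ball ?_).le
      have := (mem_ball.1 hz).height_le
      lia
    have h4 : r ≤ (S.ball r y).card := (lt_card_ball (by lia)).le
    rw [smul_eq_mul] at h3
    have h5 : r ^ 2 ≤ S.pairCount r y := by nlinarith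
    exact_mod_cast h5
  have h3 : (S.pairCount (q ^ 80 * r) y : ℝ) ≤ 36 * S.mass B v ^ 2 := by
    have h4 : (S.pairCount (q ^ 80 * r) y : ℝ) ≤
        ((S.ball (q ^ 80 * r) y).card : ℝ) * (6 * S.mass B v) := by
      unfold pairCount
      push_cast
      rw [← nsmul_eq_mul]
      refine Finset.sum_le_card_nsmul _ _ _ fun z hz => ?_
      have h5 := card_ball_le (S := S) (B := B) (k := q ^ 80 * r) (by lia) z
      have h6 := hy.mass_le h (mem_ball.1 hz)
      linarith
    have h5 := card_ball_le (S := S) (B := B) (k := q ^ 80 * r) (by lia) y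
    have h6 := hy.mass_le h (within_refl 0 y)
    nlinarith
  have h4 := h.mass_le
  have h5 : (q : ℝ) ^ 990 = (q : ℝ) ^ 318 * ((q : ℝ) ^ 336 * (q : ℝ) ^ 336) := by
    rw [← pow_add, ← pow_add]
  have h6 : (36 : ℝ) < (q : ℝ) ^ 318 :=
    lt_of_lt_of_le (by linarith) (le_self_pow₀ (by linarith) (by norm_num))
  have h7 : 0 < (q : ℝ) ^ 336 := pow_pos hq _
  generalize (q : ℝ) ^ 336 = Y at h4 h5 h7
  have h8 : S.mass B v ^ 2 ≤ (Y * r) ^ 2 := by gcongr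
  have h9 : (q : ℝ) ^ 990 * (r : ℝ) ^ 2 ≤ 36 * (Y * r) ^ 2 := by
    refine le_trans ?_ (h3.trans (mul_le_mul_of_nonneg_left h8 (by norm_num)))
    exact (mul_le_mul_of_nonneg_left h2 (pow_nonneg hq.le _)).trans h1
  rw [h5] at h9
  have h10 : (q : ℝ) ^ 318 * (Y * r) ^ 2 ≤ 36 * (Y * r) ^ 2 := by
    calc (q : ℝ) ^ 318 * (Y * r) ^ 2 = (q : ℝ) ^ 318 * (Y * Y) * (r : ℝ) ^ 2 := by ring
      _ ≤ _ := h9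
  exact absurd (le_of_mul_le_mul_right h10 (by positivity)) h6.not_ge

end IsCenter

/-- If some height is a large number `T` and there are at most `2 * T ^ 2` elements, then some gain
is of order at least `T ^ 3`. -/
theorem exists_lt_gain (S : StepSystem α) {T : ℕ} {b : α}
    (hT : 4000 * (10 ^ 6 + 1 : ℝ) ^ 252 ≤ T) (hb : S.height b = T)
    (hcard : Fintype.card α ≤ 2 * T ^ 2) :
    ∃ u v j, u ≤ v ∧ (T : ℝ) ^ 3 / (375 * (10 ^ 6 + 1) ^ 252) < S.gain u v j := by
  by_contra! hR
  obtain ⟨B, q, r, v, h⟩ := S.exists_stable le_rfl hT hb hcard hR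
  obtain ⟨y, h1, h2, h3⟩ := h.exists_center
  exact IsCenter.false_of_stable h ⟨h1, h2, h3⟩

end StepSystem

section

variable {V : Type}

/-! ### Walks with few edges -/

/-- `v` is reached from `u` by a walk of at most `k` edges. -/
def Hops (D : Digraph V) : ℕ → V → V → Prop
  | 0, u, v => u = v
  | k + 1, u, v => ∃ w, (u = w ∨ D.Adj u w) ∧ Hops D k w v

section

variable {D : Digraph V} {k l : ℕ} {u v w : V}

theorem Hops.refl (k : ℕ) (u : V) : Hops D k u u := by
  induction k with
  | zero => rfl
  | succ k ih => exact ⟨u, Or.inl rfl, ih⟩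

theorem Hops.trans (h : Hops D k u v) (h' : Hops D l v w) : Hops D (k + l) u w := by
  induction k generalizing u with
  | zero => cases h; simpa using h'
  | succ k ih =>
    obtain ⟨x, hx, h⟩ := h
    rw [Nat.add_right_comm]
    exact ⟨x, hx, ih h⟩

theorem Hops.mono (h : Hops D k u v) (hkl : k ≤ l) : Hops D l u v := by
  obtain ⟨j, rfl⟩ := Nat.exists_eq_add_of_le hkl
  exact h.trans (Hops.refl j v)

theorem Hops.of_adj (h : D.Adj u v) : Hops D 1 u v := ⟨v, Or.inr h, rfl⟩

theorem Hops.mono_graph {D' : Digraph V} (hD : ∀ x y, D.Adj x y → D'.Adj x y)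
    (h : Hops D k u v) : Hops D' k u v := by
  induction k generalizing u with
  | zero => exact h
  | succ k ih =>
    obtain ⟨x, hx, h⟩ := h
    exact ⟨x, hx.imp_right (hD _ _), ih h⟩

theorem Hops.exists_path (h : Hops D k u v) :
    ∃ p, IsPathFromTo D u v p ∧ p.length ≤ k + 1 := by
  induction k generalizing u with
  | zero =>
    cases h
    exact ⟨[v], ⟨⟨by simp, by simp, by simp⟩, by simp, by simp⟩, by simp⟩
  | succ k ih =>
    obtain ⟨w, hw, h⟩ := h
    obtain ⟨p, ⟨⟨hp0, hpn, hpc⟩, hph, hpl⟩, hlen⟩ := ih h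
    rcases hw with rfl | hw
    · exact ⟨p, ⟨⟨hp0, hpn, hpc⟩, hph, hpl⟩, by lia⟩
    by_cases hu : u ∈ p
    · obtain ⟨s, t, rfl⟩ := List.append_of_mem hu
      refine ⟨u :: t, ⟨⟨by simp, ?_, ?_⟩, by simp, ?_⟩, ?_⟩
      · exact (List.nodup_append.1 hpn).2.1
      · exact (List.isChain_append.1 hpc).2.1
      · rw [← hpl, List.getLast?_append_of_ne_nil _ (by simp)]
      · simp only [List.length_append] at hlen
        lia
    · obtain ⟨x, t, rfl⟩ := List.exists_cons_of_ne_nil hp0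
      simp only [List.head?_cons, Option.some.injEq] at hph
      subst hph
      refine ⟨u :: x :: t, ⟨⟨by simp, List.nodup_cons.2 ⟨hu, hpn⟩, ?_⟩, by simp, ?_⟩,
        by simpa using hlen⟩
      · rw [List.isChain_cons_cons]
        exact ⟨hw, hpc⟩
      · rw [List.getLast?_cons_cons, hpl]

theorem Hops.distLE (h : Hops D k u v) : DistLE D u v k := by
  obtain ⟨p, hp, hlen⟩ := h.exists_path
  refine ⟨p, hp, ?_⟩
  rw [sub_le_iff_le_add]
  exact_mod_cast hlen

theorem hops_of_isPathFromTo {p : List V} (hp : IsPathFromTo D u v p) :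
    Hops D (p.length - 1) u v := by
  obtain ⟨⟨hp0, -, hpc⟩, hph, hpl⟩ := hp
  induction p generalizing u with
  | nil => exact absurd rfl hp0
  | cons x t ih =>
    simp only [List.head?_cons, Option.some.injEq] at hph
    subst hph
    cases t with
    | nil =>
      simp only [List.getLast?_singleton, Option.some.injEq] at hpl
      subst hpl
      exact Hops.refl _ _
    | cons y t =>
      rw [List.isChain_cons_cons] at hpc
      rw [List.getLast?_cons_cons] at hpl
      exact ⟨y, Or.inr hpc.1, ih (by simp) hpc.2 (by simp) hpl⟩

theorem DistLE.hops {b : ℕ} (h : DistLE D u v b) : Hops D b u v := by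
  obtain ⟨p, hp, hlen⟩ := h
  refine (hops_of_isPathFromTo hp).mono ?_
  rw [sub_le_iff_le_add] at hlen
  have : p.length ≤ b + 1 := by exact_mod_cast hlen
  lia

end

/-! ### Short hops along an interval -/

/-- An interval of length `m` has a two-hop shortcut with about `m * log m` edges: the middle is
joined to all other elements, and the construction is repeated on both halves. -/
theorem exists_two_hops (t : ℕ) : ∀ a m : ℕ, m ≤ 2 ^ t → ∃ E : Finset (ℕ × ℕ), E.card ≤ m * t ∧
    (∀ e ∈ E, a ≤ e.1 ∧ e.1 < e.2 ∧ e.2 < a + m) ∧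
    ∀ i j, a ≤ i → i ≤ j → j < a + m → Hops (edgeGraph (E : Set (ℕ × ℕ))) 2 i j := by
  induction t with
  | zero =>
    intro a m hm
    refine ⟨∅, by simp, by simp, fun i j hi hij hj => ?_⟩
    obtain rfl : i = j := by simp at hm; lia
    exact Hops.refl _ _
  | succ t ih =>
    intro a m hm
    rcases Nat.eq_zero_or_pos m with rfl | hm0
    · exact ⟨∅, by simp, by simp, fun i j hi hij hj => by lia⟩
    rw [pow_succ] at hm
    obtain ⟨E₁, hE₁, hE₁', h₁⟩ := ih a (m / 2) (by lia)
    obtain ⟨E₂, hE₂, hE₂', h₂⟩ := ih (a + m / 2) (m - m / 2) (by lia)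
    set h := a + m / 2 with hh
    -- the edges between the middle vertex `h` and all others
    set M : Finset (ℕ × ℕ) := (Finset.Ico a h).image (fun i => (i, h)) ∪
      (Finset.Ioo h (a + m)).image (fun j => (h, j)) with hM
    refine ⟨E₁ ∪ E₂ ∪ M, ?_, ?_, ?_⟩
    · have h3 : M.card ≤ m := by
        refine (Finset.card_union_le _ _).trans ?_
        refine (Nat.add_le_add Finset.card_image_le Finset.card_image_le).trans ?_
        simp only [Nat.card_Ico, Nat.card_Ioo]
        lia
      have h4 := Finset.card_union_le (E₁ ∪ E₂) M
      have h5 := Finset.card_union_le E₁ E₂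
      have h6 : m / 2 * t + (m - m / 2) * t = m * t := by
        rw [← Nat.add_mul]
        congr 1
        lia
      rw [Nat.mul_succ]
      lia
    · intro e he
      rw [Finset.mem_union, Finset.mem_union] at he
      rcases he with (he | he) | he
      · have := hE₁' e he
        lia
      · have := hE₂' e he
        lia
      · simp only [hM, Finset.mem_union, Finset.mem_image, Finset.mem_Ico, Finset.mem_Ioo] at he
        rcases he with ⟨i, hi, rfl⟩ | ⟨j, hj, rfl⟩
        · simp only
          lia
        · simp only
          lia
    · intro i j hi hij hj
      by_cases hjh : j < h
      · exact (h₁ i j hi hij (by lia)).mono_graph fun x y hxy => by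
          simp only [edgeGraph, Finset.coe_union, Set.mem_union] at hxy ⊢
          exact Or.inl (Or.inl hxy)
      by_cases hih : h ≤ i
      · exact (h₂ i j hih hij (by lia)).mono_graph fun x y hxy => by
          simp only [edgeGraph, Finset.coe_union, Set.mem_union] at hxy ⊢
          exact Or.inl (Or.inr hxy)
      · refine ⟨h, Or.inr ?_, j, ?_, rfl⟩
        · simp only [edgeGraph, hM, Finset.mem_coe, Finset.mem_union, Finset.mem_image,
            Finset.mem_Ico]
          exact Or.inr (Or.inl ⟨i, by lia, rfl⟩)
        · rcases eq_or_ne h j with hhj | hhj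
          · exact Or.inl hhj
          · right
            simp only [edgeGraph, hM, Finset.mem_coe, Finset.mem_union, Finset.mem_image,
              Finset.mem_Ioo]
            exact Or.inr (Or.inr ⟨j, by lia, rfl⟩)

theorem Hops.map {D : Digraph ℕ} {D' : Digraph V} {g : ℕ → V} {k i j : ℕ}
    (hD : ∀ x y, D.Adj x y → D'.Adj (g x) (g y)) (h : Hops D k i j) : Hops D' k (g i) (g j) := by
  induction k generalizing i with
  | zero => exact congrArg g h
  | succ k ih =>
    obtain ⟨x, hx, h⟩ := h
    exact ⟨g x, hx.imp (congrArg g) (hD _ _), ih h⟩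

theorem sum_min_sub (L m q : ℕ) :
    ∑ b ∈ Finset.range q, min L (m - b * L) = min (q * L) m := by
  induction q with
  | zero => simp
  | succ q ih =>
    rw [Finset.sum_range_succ, ih, Nat.succ_mul]
    lia

/-- By recursion on the iterated logarithm, an interval of length `m` has a four-hop shortcut with
`O(m * k)` edges. The interval is cut into blocks of about logarithmic length. A path between
different blocks goes to the start of the next block, by two hops to the start of the last block,
and from there to its end; inside the blocks the construction is repeated. -/
theorem exists_four_hops (k : ℕ) : ∀ (x : ℝ) (a m : ℕ), (Real.logb 2)^[k] x ≤ 1 → (m : ℝ) ≤ x →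
    ∃ E : Finset (ℕ × ℕ), E.card ≤ 8 * m * k ∧
    (∀ e ∈ E, a ≤ e.1 ∧ e.1 < e.2 ∧ e.2 < a + m) ∧
    ∀ i j, a ≤ i → i ≤ j → j < a + m → Hops (edgeGraph (E : Set (ℕ × ℕ))) 4 i j := by
  induction k with
  | zero =>
    intro x a m hx hm
    have hm1 : m ≤ 1 := by
      have : (m : ℝ) ≤ 1 := hm.trans hx
      exact_mod_cast this
    refine ⟨∅, by simp, by simp, fun i j hi hij hj => ?_⟩
    obtain rfl : i = j := by lia
    exact Hops.refl _ _
  | succ k ih =>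
    intro x a m hx hm
    rw [Function.iterate_succ_apply] at hx
    rcases Nat.lt_or_ge 1 m with hm1 | hm1
    swap
    · refine ⟨∅, by simp, by simp, fun i j hi hij hj => ?_⟩
      obtain rfl : i = j := by lia
      exact Hops.refl _ _
    have hm2 : (2 : ℝ) ≤ m := by exact_mod_cast hm1
    have hx0 : 0 < x := by linarith
    have hy1 : 1 ≤ Real.logb 2 x := by
      rw [Real.le_logb_iff_rpow_le (by norm_num) hx0]
      norm_num
      linarith
    set y := Real.logb 2 x with hy
    set L := ⌊y⌋₊ with hL
    have hL1 : 1 ≤ L := Nat.le_floor (by simpa using hy1)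
    have hLy : (L : ℝ) ≤ y := Nat.floor_le (by linarith)
    rcases Nat.lt_or_ge L m with hLm | hLm
    swap
    · obtain ⟨E, hE, h1, h2⟩ := ih y a m hx (le_trans (by exact_mod_cast hLm) hLy)
      exact ⟨E, hE.trans (by gcongr; lia), h1, h2⟩
    have hmL : m ≤ 2 ^ (L + 1) := by
      have h1 : (m : ℝ) ≤ 2 ^ ((L : ℝ) + 1) := by
        refine hm.trans ?_
        have h2 : x = 2 ^ y := (Real.rpow_logb (by norm_num) (by norm_num) hx0).symm
        rw [h2]
        exact Real.rpow_le_rpow_of_exponent_le (by norm_num) (Nat.lt_floor_add_one y).le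
      have h3 : (2 : ℝ) ^ ((L : ℝ) + 1) = ((2 ^ (L + 1) : ℕ) : ℝ) := by
        push_cast
        rw [← Real.rpow_natCast]
        push_cast
        rfl
      rw [h3] at h1
      exact_mod_cast h1
    -- the number of blocks
    set n := m / L + 1 with hn
    have hnm : n ≤ m + 1 := Nat.succ_le_succ (Nat.div_le_self m L)
    have hdm : L * (m / L) ≤ m := Nat.mul_div_le m L
    have hmdiv : m / L ≤ m := Nat.div_le_self m L
    have hdiv1 : 1 ≤ m / L := Nat.div_pos hLm.le hL1
    have hltn : m < n * L := by
      have := Nat.lt_mul_div_succ m hL1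
      rw [hn, mul_comm]
      exact this
    obtain ⟨E₁, hE₁, hE₁', h₁⟩ := exists_two_hops (L + 2) 0 n (by
      rw [pow_succ]
      lia)
    have hblock : ∀ b : ℕ, ∃ E : Finset (ℕ × ℕ), E.card ≤ 8 * min L (m - b * L) * k ∧
      (∀ e ∈ E, a + b * L ≤ e.1 ∧ e.1 < e.2 ∧ e.2 < a + b * L + min L (m - b * L)) ∧
      ∀ i j, a + b * L ≤ i → i ≤ j → j < a + b * L + min L (m - b * L) →
        Hops (edgeGraph (E : Set (ℕ × ℕ))) 4 i j := fun b =>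
      ih y _ _ hx (le_trans (by exact_mod_cast min_le_left _ _) hLy)
    choose E₂ hE₂ hE₂' h₂ using hblock
    set st : ℕ → ℕ := fun b => a + b * L with hst
    -- the two-hop edges between block starts, the edges inside the blocks, and the edges between
    -- each vertex and the starts of its own and the next block
    set F₁ := (E₁.image fun e => (st e.1, st e.2)).filter fun e => e.2 < a + m with hF₁
    set F₂ := (Finset.range n).biUnion E₂ with hF₂
    set F₃ := ((Finset.range m).image fun i => (st (i / L), a + i)).filter fun e => e.1 < e.2
      with hF₃
    set F₄ := ((Finset.range m).image fun i => (a + i, st (i / L + 1))).filter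
      fun e => e.2 < a + m with hF₄
    have hst_le : ∀ i, st (i / L) ≤ a + i := fun i => by
      have := Nat.div_mul_le_self i L
      simp only [hst]
      lia
    have hst_lt : ∀ i, a + i < st (i / L + 1) := fun i => by
      have := Nat.lt_mul_div_succ i hL1
      simp only [hst]
      rw [mul_comm]
      lia
    refine ⟨F₁ ∪ F₂ ∪ (F₃ ∪ F₄), ?_, ?_, ?_⟩
    · have c1 : F₁.card ≤ 6 * m := by
        refine (Finset.card_filter_le _ _).trans (Finset.card_image_le.trans (hE₁.trans ?_))
        have : n * (L + 2) ≤ (2 * (m / L)) * (3 * L) := Nat.mul_le_mul (by lia) (by lia)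
        refine this.trans ?_
        nlinarith
      have c2 : F₂.card ≤ 8 * m * k := by
        refine Finset.card_biUnion_le.trans ((Finset.sum_le_sum fun b _ => hE₂ b).trans ?_)
        rw [← Finset.sum_mul, ← Finset.mul_sum, sum_min_sub]
        gcongr
        exact min_le_right _ _
      have c3 : F₃.card ≤ m := (Finset.card_filter_le _ _).trans
        (Finset.card_image_le.trans (Finset.card_range m).le)
      have c4 : F₄.card ≤ m := (Finset.card_filter_le _ _).trans
        (Finset.card_image_le.trans (Finset.card_range m).le)
      have c5 := Finset.card_union_le (F₁ ∪ F₂) (F₃ ∪ F₄)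
      have c6 := Finset.card_union_le F₁ F₂
      have c7 := Finset.card_union_le F₃ F₄
      rw [Nat.mul_succ]
      lia
    · intro e he
      simp only [Finset.mem_union] at he
      rcases he with (he | he) | he | he
      · simp only [hF₁, Finset.mem_filter, Finset.mem_image] at he
        obtain ⟨⟨e', he', rfl⟩, hlt⟩ := he
        have h3 := hE₁' e' he'
        have h4 : e'.1 * L < e'.2 * L := Nat.mul_lt_mul_of_pos_right h3.2.1 hL1
        simp only [hst] at hlt ⊢
        lia
      · simp only [hF₂, Finset.mem_biUnion] at he
        obtain ⟨b, -, he⟩ := he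
        have := hE₂' b e he
        lia
      · simp only [hF₃, Finset.mem_filter, Finset.mem_image, Finset.mem_range] at he
        obtain ⟨⟨i, hi, rfl⟩, hlt⟩ := he
        simp only [hst] at hlt ⊢
        lia
      · simp only [hF₄, Finset.mem_filter, Finset.mem_image, Finset.mem_range] at he
        obtain ⟨⟨i, hi, rfl⟩, hlt⟩ := he
        have := hst_lt i
        simp only at hlt ⊢
        lia
    · intro i j hi hij hj
      obtain ⟨i, rfl⟩ := Nat.exists_eq_add_of_le hi
      obtain ⟨j, rfl⟩ := Nat.exists_eq_add_of_le (hi.trans hij)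
      have hb : i / L ≤ j / L := Nat.div_le_div_right (by lia)
      have hjn : j / L < n := by
        have : j / L ≤ m / L := Nat.div_le_div_right (by lia)
        lia
      rcases hb.eq_or_lt with hb | hb
      · have h3 := hst_le i
        have h4 := hst_lt j
        have h5 : (j / L + 1) * L = j / L * L + L := Nat.succ_mul _ _
        simp only [hst] at h3 h4
        rw [hb] at h3
        refine (h₂ (j / L) (a + i) (a + j) h3 hij ?_).mono_graph fun u w huw => ?_
        · lia
        · simp only [edgeGraph, Finset.mem_coe, Finset.mem_union] at huw ⊢
          refine Or.inl (Or.inr ?_)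
          rw [hF₂, Finset.mem_biUnion]
          exact ⟨_, Finset.mem_range.2 hjn, huw⟩
      · have h3 : st (i / L + 1) ≤ st (j / L) := by
          simp only [hst]
          gcongr
          lia
        have h4 := hst_le j
        refine ⟨st (i / L + 1), Or.inr ?_, ?_⟩
        · simp only [edgeGraph, Finset.mem_coe, Finset.mem_union]
          refine Or.inr (Or.inr ?_)
          simp only [hF₄, Finset.mem_filter, Finset.mem_image, Finset.mem_range]
          exact ⟨⟨i, by lia, rfl⟩, by lia⟩
        · have h5 := h₁ (i / L + 1) (j / L) (Nat.zero_le _) hb (by lia)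
          refine Hops.trans (k := 2) (l := 1) (v := st (j / L)) ?_ ?_
          · obtain ⟨c, hc, _, hd, rfl⟩ := h5
            have hle : ∀ {u w}, (u = w ∨ (edgeGraph (E₁ : Set (ℕ × ℕ))).Adj u w) → u ≤ w := by
              rintro u w (rfl | h)
              · exact le_rfl
              · exact (hE₁' (u, w) h).2.1.le
            have hadj : ∀ {u w}, w ≤ j / L → (u = w ∨ (edgeGraph (E₁ : Set (ℕ × ℕ))).Adj u w) →
                st u = st w ∨
                (edgeGraph ((F₁ ∪ F₂ ∪ (F₃ ∪ F₄) : Finset (ℕ × ℕ)) : Set (ℕ × ℕ))).Adj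
                  (st u) (st w) := by
              rintro u w hw (rfl | h)
              · exact Or.inl rfl
              · right
                simp only [edgeGraph, Finset.mem_coe, Finset.mem_union]
                refine Or.inl (Or.inl ?_)
                simp only [hF₁, Finset.mem_filter, Finset.mem_image]
                refine ⟨⟨(u, w), h, rfl⟩, ?_⟩
                have : st w ≤ st (j / L) := by
                  simp only [hst]
                  gcongr
                lia
            exact ⟨st c, hadj (hle hd) hc, st (j / L), hadj le_rfl hd, rfl⟩
          · rcases h4.eq_or_lt with h4 | h4
            · rw [h4]
              exact Hops.refl _ _
            · refine Hops.of_adj ?_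
              simp only [edgeGraph, Finset.mem_coe, Finset.mem_union]
              refine Or.inr (Or.inl ?_)
              simp only [hF₃, Finset.mem_filter, Finset.mem_image, Finset.mem_range]
              exact ⟨⟨j, by lia, rfl⟩, h4⟩

end

section

variable {V : Type}

/-! ### The iterated logarithm -/

theorem exists_iterate_logb_le_one (x : ℝ) : ∃ k, (Real.logb 2)^[k] x ≤ 1 := by
  obtain ⟨N, hN⟩ := exists_nat_ge x
  induction N generalizing x with
  | zero => exact ⟨0, by simp at hN ⊢; linarith⟩
  | succ N ih =>
    rcases le_or_gt x 1 with h1 | h1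
    · exact ⟨0, h1⟩
    have hx0 : 0 < x := by linarith
    rcases le_or_gt x 2 with h2 | h2
    · refine ⟨1, ?_⟩
      rw [Function.iterate_one, Real.logb_le_iff_le_rpow (by norm_num) hx0]
      simpa using h2
    · have hlog : Real.logb 2 x ≤ x - 1 := by
        rw [Real.logb_le_iff_le_rpow (by norm_num) hx0]
        have := one_add_mul_self_le_rpow_one_add (s := 1) (by norm_num) (p := x - 1) (by linarith)
        norm_num at this
        exact this
      push_cast at hN
      obtain ⟨k, hk⟩ := ih (Real.logb 2 x) (by linarith)
      exact ⟨k + 1, by rwa [Function.iterate_succ_apply]⟩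

theorem iterate_logb_logStar_le (n : ℕ) : (Real.logb 2)^[logStar n] (n : ℝ) ≤ 1 :=
  Nat.sInf_mem (s := {k : ℕ | (Real.logb 2)^[k] (n : ℝ) ≤ 1}) (exists_iterate_logb_le_one n)

theorem one_le_logStar {n : ℕ} (hn : 2 ≤ n) : 1 ≤ logStar n := by
  by_contra h
  have h0 : logStar n = 0 := by lia
  have := iterate_logb_logStar_le n
  rw [h0, Function.iterate_zero_apply] at this
  have : n ≤ 1 := by exact_mod_cast this
  lia

/-! ### Super-shortcuts -/

theorem pair_sublist_iff {l : List V} {u v : V} :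
    [u, v].Sublist l ↔ ∃ i j, ∃ (hi : i < l.length) (hj : j < l.length),
      i < j ∧ l[i] = u ∧ l[j] = v := by
  constructor
  · intro h
    have h1 : l.Pairwise fun u v => ∃ i j, ∃ (hi : i < l.length) (hj : j < l.length),
        i < j ∧ l[i] = u ∧ l[j] = v :=
      List.pairwise_iff_getElem.2 fun i j hi hj hij => ⟨i, j, hi, hj, hij, rfl, rfl⟩
    exact List.pairwise_iff_forall_sublist.1 h1 h
  · rintro ⟨i, j, hi, hj, hij, rfl, rfl⟩
    have h1 : l.Pairwise fun u v => [u, v].Sublist l :=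
      List.pairwise_iff_forall_sublist.2 fun h => h
    exact List.pairwise_iff_getElem.1 h1 i j hi hj hij

/-- The four-hop shortcut of an interval, transported to a chain. -/
theorem exists_superShortcut_of_chain [Finite V] (C : List V) {x : ℝ} {k : ℕ}
    (hx : (Real.logb 2)^[k] x ≤ 1) (hC : (C.length : ℝ) ≤ x) :
    ∃ H : Set (V × V), H.ncard ≤ 8 * C.length * k + C.length ∧
      (∀ e ∈ H, [e.1, e.2].Sublist C) ∧ (∀ u v, [u, v] <:+: C → (u, v) ∈ H) ∧
      ∀ u v, [u, v].Sublist C → Hops (edgeGraph H) 4 u v := by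
  classical
  obtain ⟨E, hE, hE', h⟩ := exists_four_hops k x 0 C.length hx hC
  rcases C.eq_nil_or_concat with rfl | ⟨C', c, hC'⟩
  · exact ⟨∅, by simp, by simp, by simp, by simp⟩
  set g : ℕ → V := fun i => C.getD i c with hg
  have hgi : ∀ i (hi : i < C.length), g i = C[i] := fun i hi => by
    simp [hg, hi]
  set H₁ : Finset (V × V) := E.image fun e => (g e.1, g e.2) with hH₁
  set H₂ : Finset (V × V) := ((Finset.range C.length).filter fun i => i + 1 < C.length).image
    fun i => (g i, g (i + 1)) with hH₂
  refine ⟨(H₁ ∪ H₂ : Finset (V × V)), ?_, ?_, ?_, ?_⟩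
  · rw [Set.ncard_coe_finset]
    refine (Finset.card_union_le _ _).trans (Nat.add_le_add ?_ ?_)
    · exact Finset.card_image_le.trans hE
    · refine Finset.card_image_le.trans ((Finset.card_filter_le _ _).trans ?_)
      simp
  · intro e he
    rw [Finset.mem_coe, Finset.mem_union] at he
    rcases he with he | he
    · rw [hH₁, Finset.mem_image] at he
      obtain ⟨e', he', rfl⟩ := he
      obtain ⟨-, h1, h2⟩ := hE' e' he'
      rw [pair_sublist_iff]
      exact ⟨e'.1, e'.2, by lia, by lia, h1, (hgi _ (by lia)).symm, (hgi _ (by lia)).symm⟩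
    · simp only [hH₂, Finset.mem_image, Finset.mem_filter, Finset.mem_range] at he
      obtain ⟨i, ⟨hi, hi'⟩, rfl⟩ := he
      rw [pair_sublist_iff]
      exact ⟨i, i + 1, hi, hi', by lia, (hgi _ hi).symm, (hgi _ hi').symm⟩
  · rintro u v ⟨s, t, hst⟩
    rw [Finset.mem_coe, Finset.mem_union]
    right
    simp only [hH₂, Finset.mem_image, Finset.mem_filter, Finset.mem_range]
    have hlen : C.length = s.length + (t.length + 2) := by
      rw [← hst]
      simp
    refine ⟨s.length, ⟨by lia, by lia⟩, ?_⟩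
    rw [hgi _ (by lia), hgi _ (by lia)]
    subst hst
    simp
  · intro u v huv
    obtain ⟨i, j, hi, hj, hij, rfl, rfl⟩ := pair_sublist_iff.1 huv
    rw [← hgi i hi, ← hgi j hj]
    refine (h i j (Nat.zero_le _) hij.le (by lia)).map fun x y hxy => ?_
    simp only [edgeGraph, Finset.mem_coe, Finset.mem_union] at hxy ⊢
    left
    rw [hH₁, Finset.mem_image]
    exact ⟨(x, y), hxy, rfl⟩

theorem sum_length_le_card [Fintype V] {𝒞 : Finset (List V)} (hnodup : ∀ C ∈ 𝒞, C.Nodup)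
    (hdisj : (𝒞 : Set (List V)).Pairwise List.Disjoint) :
    ∑ C ∈ 𝒞, C.length ≤ Fintype.card V := by
  classical
  have h1 : (𝒞.biUnion List.toFinset).card = ∑ C ∈ 𝒞, C.toFinset.card :=
    Finset.card_biUnion fun C hC D hD hCD => List.disjoint_toFinset_iff_disjoint.2
      (hdisj hC hD hCD)
  rw [Finset.sum_congr rfl fun C hC => (List.toFinset_card_of_nodup (hnodup C hC)).symm, ← h1]
  exact Finset.card_le_univ _

theorem exists_superShortcut [Fintype V] {G : Digraph V} {ℓ : ℝ} {𝒞 : Finset (List V)}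
    (h𝒞 : IsChainCover G ℓ 𝒞) (hV : 2 ≤ Fintype.card V) :
    ∃ H : Set (V × V), IsSuperShortcut 𝒞 H ∧
      (H.ncard : ℝ) ≤ 9 * (Fintype.card V * logStar (Fintype.card V)) := by
  classical
  set n := Fintype.card V with hn
  have hnodup : ∀ C ∈ 𝒞, C.Nodup := fun C hC => (h𝒞.isChain C hC).2.1
  have hex : ∀ C : List V, ∃ H : Set (V × V), C ∈ 𝒞 →
      (H.ncard ≤ 8 * C.length * logStar n + C.length ∧
      (∀ e ∈ H, [e.1, e.2].Sublist C) ∧ (∀ u v, [u, v] <:+: C → (u, v) ∈ H) ∧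
      ∀ u v, [u, v].Sublist C → Hops (edgeGraph H) 4 u v) := fun C => by
    by_cases hC : C ∈ 𝒞
    · obtain ⟨H, hH⟩ := exists_superShortcut_of_chain C (iterate_logb_logStar_le n)
        (by exact_mod_cast (hnodup C hC).length_le_card)
      exact ⟨H, fun _ => hH⟩
    · exact ⟨∅, fun h => absurd h hC⟩
  choose H hH using hex
  refine ⟨⋃ C ∈ 𝒞, H C, ⟨?_, ?_, ?_⟩, ?_⟩
  · intro e he
    simp only [Set.mem_iUnion] at he
    obtain ⟨C, hC, he⟩ := he
    exact ⟨C, hC, (hH C hC).2.1 e he⟩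
  · intro C hC u v huv
    simp only [Set.mem_iUnion]
    exact ⟨C, hC, (hH C hC).2.2.1 u v huv⟩
  · intro C hC u v huv
    have := (hH C hC).2.2.2 u v huv
    have h4 := this.mono_graph (D' := edgeGraph (⋃ C ∈ 𝒞, H C)) fun x y hxy => by
      simp only [edgeGraph, Set.mem_iUnion] at hxy ⊢
      exact ⟨C, hC, hxy⟩
    simpa using h4.distLE
  · have h1 : (⋃ C ∈ 𝒞, H C).ncard ≤ ∑ C ∈ 𝒞, (H C).ncard := by
      exact Finset.set_ncard_biUnion_le 𝒞 H
    have h2 : ∑ C ∈ 𝒞, (H C).ncard ≤ 9 * (n * logStar n) := by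
      calc ∑ C ∈ 𝒞, (H C).ncard ≤ ∑ C ∈ 𝒞, C.length * (9 * logStar n) := by
            refine Finset.sum_le_sum fun C hC => (hH C hC).1.trans ?_
            have := one_le_logStar hV
            nlinarith
        _ = (∑ C ∈ 𝒞, C.length) * (9 * logStar n) := by rw [Finset.sum_mul]
        _ ≤ n * (9 * logStar n) :=
            Nat.mul_le_mul_right _ (sum_length_le_card hnodup h𝒞.disjoint)
        _ = _ := by ring
    exact_mod_cast h1.trans h2

end

section

variable {V : Type}

/-! ### Chain covers -/

theorem pairwise_reaches_of_isChain {G : Digraph V} {p : List V} (hp : p.IsChain G.Adj) :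
    p.Pairwise (Reaches G) := by
  have : IsTrans V (Reaches G) := ⟨fun _ _ _ => Relation.ReflTransGen.trans⟩
  exact List.isChain_iff_pairwise.1 (hp.imp fun _ _ h => Relation.ReflTransGen.single h)

theorem two_mul_div_rpow {n : ℝ} (hn : 0 < n) :
    2 * n / (2 * n ^ (2 / 3 : ℝ)) = n ^ (1 / 3 : ℝ) := by
  rw [mul_div_mul_left _ _ (by norm_num : (2 : ℝ) ≠ 0), div_eq_iff (by positivity),
    ← Real.rpow_add hn]
  norm_num

theorem rpow_third_mul_sq {n : ℝ} (hn : 0 < n) :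
    (n ^ (1 / 3 : ℝ)) * n ^ (2 / 3 : ℝ) = n := by
  rw [← Real.rpow_add hn]
  norm_num

/-- A maximal family of disjoint chains with more than `n ^ (1 / 3)` vertices is a chain cover. -/
theorem exists_chainCover [Fintype V] (G : Digraph V) (hV : 0 < Fintype.card V) :
    ∃ 𝒞 : Finset (List V), IsChainCover G (2 * (Fintype.card V : ℝ) ^ (2 / 3 : ℝ)) 𝒞 := by
  classical
  set n := Fintype.card V with hn
  have hn0 : (0 : ℝ) < n := by exact_mod_cast hV
  set k := ⌊(n : ℝ) ^ (1 / 3 : ℝ)⌋₊ with hk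
  set P : ℕ → Prop := fun m => ∃ 𝒞 : Finset (List V), 𝒞.card = m ∧
    (∀ C ∈ 𝒞, IsPath (tc G) C ∧ k + 1 ≤ C.length) ∧
    (𝒞 : Set (List V)).Pairwise List.Disjoint with hP
  have hbound : ∀ 𝒞 : Finset (List V), (∀ C ∈ 𝒞, IsPath (tc G) C ∧ k + 1 ≤ C.length) →
      (𝒞 : Set (List V)).Pairwise List.Disjoint → 𝒞.card * (k + 1) ≤ n := by
    intro 𝒞 h1 h2
    refine le_trans ?_ (sum_length_le_card (fun C hC => (h1 C hC).1.2.1) h2)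
    rw [← smul_eq_mul]
    exact Finset.card_nsmul_le_sum _ _ _ fun C hC => (h1 C hC).2
  have hP0 : P 0 := ⟨∅, rfl, by simp, by simp⟩
  have hspec : P (Nat.findGreatest P n) := Nat.findGreatest_spec (Nat.zero_le n) hP0
  obtain ⟨𝒞, hcard, hchain, hdisj⟩ := hspec
  refine ⟨𝒞, fun C hC => (hchain C hC).1, hdisj, ?_, ?_⟩
  · have h1 : (𝒞.card : ℝ) * (k + 1) ≤ n := by exact_mod_cast hbound 𝒞 hchain hdisj
    have h2 : (n : ℝ) ^ (1 / 3 : ℝ) ≤ k + 1 := (Nat.lt_floor_add_one _).le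
    have h3 : 0 < (n : ℝ) ^ (1 / 3 : ℝ) := by positivity
    have h4 := rpow_third_mul_sq hn0
    have h5 : 0 < (n : ℝ) ^ (2 / 3 : ℝ) := by positivity
    have h6 : (𝒞.card : ℝ) * (n : ℝ) ^ (1 / 3 : ℝ) ≤
        (n : ℝ) ^ (2 / 3 : ℝ) * (n : ℝ) ^ (1 / 3 : ℝ) := by
      rw [mul_comm _ ((n : ℝ) ^ (1 / 3 : ℝ)), mul_comm _ ((n : ℝ) ^ (1 / 3 : ℝ)), h4]
      refine le_trans ?_ h1
      rw [mul_comm]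
      gcongr
    linarith [le_of_mul_le_mul_right h6 h3]
  · intro p hp
    rw [two_mul_div_rpow hn0]
    set f := p.filter fun v => decide (¬ Covered 𝒞 v) with hf
    have hmem : ∀ v, v ∈ f ↔ v ∈ p ∧ ¬ Covered 𝒞 v := fun v => by
      rw [hf, List.mem_filter, decide_eq_true_iff]
    have hle : f.length ≤ k := by
      by_contra! hlt
      have hfC : f ∉ 𝒞 := fun h => by
        obtain ⟨v, hv⟩ := List.exists_mem_of_length_pos (l := f) (by lia)
        exact ((hmem v).1 hv).2 ⟨f, h, hv⟩
      have hpath : IsPath (tc G) f := by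
        refine ⟨List.ne_nil_of_length_pos (by lia), hp.2.1.filter _, ?_⟩
        exact List.Pairwise.isChain ((pairwise_reaches_of_isChain hp.2.2).filter _)
      have hnew : P (𝒞.card + 1) := by
        refine ⟨insert f 𝒞, Finset.card_insert_of_notMem hfC, ?_, ?_⟩
        · intro C hC
          rcases Finset.mem_insert.1 hC with rfl | hC
          · exact ⟨hpath, hlt⟩
          · exact hchain C hC
        · rw [Finset.coe_insert, Set.pairwise_insert]
          refine ⟨hdisj, fun C hC _ => ⟨?_, ?_⟩⟩
          · exact fun v hv hvC => ((hmem v).1 hv).2 ⟨C, hC, hvC⟩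
          · exact fun v hvC hv => ((hmem v).1 hv).2 ⟨C, hC, hvC⟩
      have hn' : 𝒞.card + 1 ≤ n := by
        obtain ⟨𝒞', h1, h2, h3⟩ := hnew
        have := hbound 𝒞' h2 h3
        rw [h1] at this
        nlinarith
      have := Nat.le_findGreatest hn' hnew
      lia
    have hset : {v | v ∈ p ∧ ¬ Covered 𝒞 v} = (f.toFinset : Set V) := by
      ext v
      simp [hmem]
    rw [hset, Set.ncard_coe_finset]
    have h1 : (f.toFinset.card : ℝ) ≤ k := by exact_mod_cast (List.toFinset_card_le f).trans hle
    exact h1.trans (Nat.floor_le (by positivity))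

end

section

variable {V : Type}

/-! ### Entry points -/

theorem Reaches.antisymm {G : Digraph V} (hG : IsDAG G) {u v : V} (h : Reaches G u v)
    (h' : Reaches G v u) : u = v := by
  rcases Relation.reflTransGen_iff_eq_or_transGen.1 h with h | h
  · exact h.symm
  · exact absurd (h.trans_left h') (hG u)

/-- The standing assumptions on the chains and the current edge set of the greedy loop. -/
structure IsSetup (G : Digraph V) (𝒞 : Finset (List V)) (H : Set (V × V)) : Prop where
  dag : IsDAG G
  isChain : ∀ C ∈ 𝒞, IsPath (tc G) C
  disjoint : (𝒞 : Set (List V)).Pairwise List.Disjoint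
  reaches : ∀ e ∈ H, Reaches G e.1 e.2
  consecutive : ∀ C ∈ 𝒞, ∀ u v, [u, v] <:+: C → (u, v) ∈ H

section

variable {G : Digraph V} {𝒞 : Finset (List V)} {H : Set (V × V)} {C D : List V} {x y u v w z : V}
  {k : ℕ}

theorem exists_isEntry (hz : z ∈ C) (hxz : Reaches G x z) :
    ∃ w, IsEntry G x C w := by
  classical
  obtain ⟨w, hw⟩ : ∃ w, C.find? (fun w => decide (Reaches G x w)) = some w := by
    rw [← Option.isSome_iff_exists, List.find?_isSome]
    exact ⟨z, hz, by simpa using hxz⟩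
  rw [List.find?_eq_some_iff_append] at hw
  obtain ⟨hxw, pre, post, hC', hpre⟩ := hw
  refine ⟨w, pre, post, hC', by simpa using hxw, fun y hy => by simpa using hpre y hy⟩

namespace IsSetup

theorem insert (h : IsSetup G 𝒞 H) {e : V × V} (he : Reaches G e.1 e.2) :
    IsSetup G 𝒞 (insert e H) where
  dag := h.dag
  isChain := h.isChain
  disjoint := h.disjoint
  reaches := by
    intro e' he'
    rcases he' with rfl | he'
    · exact he
    · exact h.reaches e' he'
  consecutive := fun C hC u v huv => Or.inr (h.consecutive C hC u v huv)

theorem eq_of_mem (h : IsSetup G 𝒞 H) (hC : C ∈ 𝒞) (hD : D ∈ 𝒞) (hv : v ∈ C) (hv' : v ∈ D) :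
    C = D := by
  by_contra hne
  exact h.disjoint hC hD hne hv hv'

theorem reaches_of_adj (h : IsSetup G 𝒞 H) (huv : (addEdges G H).Adj u v) : Reaches G u v := by
  rcases huv with huv | huv
  · exact Relation.ReflTransGen.single huv
  · exact h.reaches _ huv

theorem pairwise (h : IsSetup G 𝒞 H) (hC : C ∈ 𝒞) : C.Pairwise (Reaches G) := by
  have : IsTrans V (Reaches G) := ⟨fun _ _ _ => Relation.ReflTransGen.trans⟩
  exact List.isChain_iff_pairwise.1 (h.isChain C hC).2.2

theorem isEntry_iff (h : IsSetup G 𝒞 H) (hC : C ∈ 𝒞) :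
    IsEntry G x C w ↔ w ∈ C ∧ Reaches G x w ∧ ∀ z ∈ C, Reaches G x z → Reaches G w z := by
  have hp := h.pairwise hC
  constructor
  · rintro ⟨pre, post, rfl, hxw, hpre⟩
    refine ⟨by simp, hxw, fun z hz hxz => ?_⟩
    rw [List.mem_append, List.mem_cons] at hz
    rcases hz with hz | rfl | hz
    · exact absurd hxz (hpre z hz)
    · exact Relation.ReflTransGen.refl
    · rw [List.pairwise_append, List.pairwise_cons] at hp
      exact hp.2.1.1 z hz
  · rintro ⟨hw, hxw, hmin⟩
    obtain ⟨pre, post, rfl⟩ := List.append_of_mem hw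
    refine ⟨pre, post, rfl, hxw, fun z hz hxz => ?_⟩
    have h1 := hmin z (by simp [hz]) hxz
    rw [List.pairwise_append] at hp
    have h2 := hp.2.2 z hz w (by simp)
    have h3 := h2.antisymm h.dag h1
    have hnd := (h.isChain _ hC).2.1
    rw [List.nodup_append] at hnd
    exact hnd.2.2 z hz w (by simp) h3

theorem entry_unique (h : IsSetup G 𝒞 H) (hC : C ∈ 𝒞) (hw : IsEntry G x C w)
    (hz : IsEntry G x C z) : w = z := by
  rw [h.isEntry_iff hC] at hw hz
  exact (hw.2.2 z hz.1 hz.2.1).antisymm h.dag (hz.2.2 w hw.1 hw.2.1)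

/-- An entry point of `x` is also the entry point of everything between `x` and it. -/
theorem isEntry_of_reaches (h : IsSetup G 𝒞 H) (hC : C ∈ 𝒞) (hw : IsEntry G x C w)
    (hxy : Reaches G x y) (hyw : Reaches G y w) : IsEntry G y C w := by
  rw [h.isEntry_iff hC] at hw ⊢
  exact ⟨hw.1, hyw, fun z hz hyz => hw.2.2 z hz (hxy.trans hyz)⟩

end IsSetup

/-! ### Valid walks -/

/-- A step of a valid walk that does not enter a chain. -/
def StayStep (G : Digraph V) (𝒞 : Finset (List V)) (H : Set (V × V)) (u v : V) : Prop :=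
  (addEdges G H).Adj u v ∧ u ≠ v ∧ ∀ C ∈ 𝒞, v ∈ C → u ∈ C

/-- `VWalk G 𝒞 H x v k` says that some walk from `x` to `v` enters `k` chains, each of them at the
entry point of `x`. The chain of `x` itself is counted. -/
inductive VWalk (G : Digraph V) (𝒞 : Finset (List V)) (H : Set (V × V)) (x : V) : V → ℕ → Prop
  | start_covered : Covered 𝒞 x → VWalk G 𝒞 H x x 1
  | start_uncovered : ¬ Covered 𝒞 x → VWalk G 𝒞 H x x 0
  | stay {v v' k} : VWalk G 𝒞 H x v k → StayStep G 𝒞 H v v' → VWalk G 𝒞 H x v' k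
  | enter {v v' C k} : VWalk G 𝒞 H x v k → (addEdges G H).Adj v v' → C ∈ 𝒞 → v' ∈ C → v ∉ C →
      IsEntry G x C v' → VWalk G 𝒞 H x v' (k + 1)

theorem StayStep.mono {H' : Set (V × V)} (hH : H ⊆ H') (h : StayStep G 𝒞 H u v) :
    StayStep G 𝒞 H' u v :=
  ⟨h.1.imp_right fun h => hH h, h.2⟩

theorem VWalk.mono {H' : Set (V × V)} (hH : H ⊆ H') (h : VWalk G 𝒞 H x v k) :
    VWalk G 𝒞 H' x v k := by
  induction h with
  | start_covered h => exact .start_covered h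
  | start_uncovered h => exact .start_uncovered h
  | stay _ h ih => exact .stay ih (h.mono hH)
  | enter _ h1 h2 h3 h4 h5 ih => exact .enter ih (h1.imp_right fun h => hH h) h2 h3 h4 h5

theorem VWalk.reaches (h : IsSetup G 𝒞 H) (hv : VWalk G 𝒞 H x v k) : Reaches G x v := by
  induction hv with
  | start_covered _ => exact .refl
  | start_uncovered _ => exact .refl
  | stay _ hs ih => exact ih.trans (h.reaches_of_adj hs.1)
  | enter _ h1 _ _ _ _ ih => exact ih.trans (h.reaches_of_adj h1)

theorem VWalk.stays (hv : VWalk G 𝒞 H x v k)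
    (hs : Relation.ReflTransGen (StayStep G 𝒞 H) v w) : VWalk G 𝒞 H x w k := by
  induction hs with
  | refl => exact hv
  | tail _ h ih => exact .stay ih h

theorem exists_vWalk_self (G : Digraph V) (𝒞 : Finset (List V)) (H : Set (V × V)) (x : V) :
    ∃ k ≤ 1, VWalk G 𝒞 H x x k := by
  by_cases hx : Covered 𝒞 x
  · exact ⟨1, le_rfl, .start_covered hx⟩
  · exact ⟨0, by simp, .start_uncovered hx⟩

/-- A walk can move on to an adjacent entry point at the cost of at most one more chain. -/
theorem VWalk.exists_adj (h : IsSetup G 𝒞 H) (hv : VWalk G 𝒞 H x v k)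
    (hvw : (addEdges G H).Adj v w) (hne : v ≠ w) (hC : C ∈ 𝒞) (hw : IsEntry G x C w) :
    ∃ j ≤ k + 1, VWalk G 𝒞 H x w j := by
  have hwC := ((h.isEntry_iff hC).1 hw).1
  by_cases hvC : v ∈ C
  · refine ⟨k, by lia, .stay hv ⟨hvw, hne, fun D hD hwD => ?_⟩⟩
    rwa [← h.eq_of_mem hC hD hwC hwD]
  · exact ⟨k + 1, le_rfl, .enter hv hvw hC hwC hvC hw⟩

/-- The last chain that a walk enters. -/
theorem VWalk.exists_last_entry (h : IsSetup G 𝒞 H) (hv : VWalk G 𝒞 H x v k) :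
    k = 0 ∨ ∃ C ∈ 𝒞, ∃ q, IsEntry G x C q ∧ VWalk G 𝒞 H x q k ∧
      Relation.ReflTransGen (StayStep G 𝒞 H) q v := by
  induction hv with
  | start_covered hx =>
    obtain ⟨C, hC, hxC⟩ := hx
    refine Or.inr ⟨C, hC, x, ?_, .start_covered ⟨C, hC, hxC⟩, .refl⟩
    rw [h.isEntry_iff hC]
    exact ⟨hxC, .refl, fun z _ hxz => hxz⟩
  | start_uncovered _ => exact Or.inl rfl
  | stay _ hs ih =>
    rcases ih with ih | ⟨C, hC, q, hq, hq', hqv⟩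
    · exact Or.inl ih
    · exact Or.inr ⟨C, hC, q, hq, hq', hqv.tail hs⟩
  | enter hw h1 h2 h3 h4 h5 _ =>
    exact Or.inr ⟨_, h2, _, h5, .enter hw h1 h2 h3 h4 h5, .refl⟩

theorem VWalk.pos (hx : Covered 𝒞 x) (hv : VWalk G 𝒞 H x v k) : 0 < k := by
  induction hv with
  | start_covered _ => exact one_pos
  | start_uncovered h => exact absurd hx h
  | stay _ _ ih => exact ih
  | enter => exact Nat.succ_pos _

/-- The last step of a walk to an entry point. -/
theorem VWalk.exists_pred (h : IsSetup G 𝒞 H) (hv : VWalk G 𝒞 H x v k) (hC : C ∈ 𝒞)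
    (hvC : IsEntry G x C v) (hne : x ≠ v) :
    ∃ u j, k = j + 1 ∧ VWalk G 𝒞 H x u j ∧ (addEdges G H).Adj u v ∧ u ≠ v := by
  cases hv with
  | start_covered _ => exact absurd rfl hne
  | start_uncovered _ => exact absurd rfl hne
  | stay hw hs =>
    have hmem := (h.isEntry_iff hC).1 hvC
    have h1 := hmem.2.2 _ (hs.2.2 C hC hmem.1) (hw.reaches h)
    exact absurd ((h.reaches_of_adj hs.1).antisymm h.dag h1) hs.2.1
  | enter hw h1 h2 h3 h4 h5 =>
    exact ⟨_, _, rfl, hw, h1, fun he => h4 (he ▸ h3)⟩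

theorem IsSetup.wf_adj [Finite V] (h : IsSetup G 𝒞 H) :
    WellFounded fun u v => Reaches G u v ∧ u ≠ v := by
  have h1 : IsTrans V fun u v => Reaches G u v ∧ u ≠ v :=
    ⟨fun a b c hab hbc => ⟨hab.1.trans hbc.1, fun hac =>
      hab.2 (hab.1.antisymm h.dag (hac ▸ hbc.1))⟩⟩
  have h2 : Std.Irrefl fun u v => Reaches G u v ∧ u ≠ v := ⟨fun a ha => ha.2 rfl⟩
  exact Finite.wellFounded_of_trans_of_irrefl _

/-- Along a chain one can move from each vertex to each later one by consecutive edges. -/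
theorem IsSetup.stays_of_reaches (h : IsSetup G 𝒞 H) (hC : C ∈ 𝒞) (hu : u ∈ C) (hv : v ∈ C)
    (huv : Reaches G u v) : Relation.ReflTransGen (StayStep G 𝒞 H) u v := by
  obtain ⟨pre, post, rfl⟩ := List.append_of_mem hv
  have hp := h.pairwise hC
  have hnd := (h.isChain _ hC).2.1
  have key : ∀ (l₁ l₂ : List V), pre ++ v :: post = l₁ ++ l₂ → ∀ y, l₁.getLast? = some y →
      ∀ u ∈ l₁, Relation.ReflTransGen (StayStep G 𝒞 H) u y := by
    intro l₁
    induction l₁ using List.reverseRecOn with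
    | nil => simp
    | append_singleton l b ih =>
      intro l₂ hl y hy u hu
      rw [List.getLast?_concat, Option.some.injEq] at hy
      subst hy
      rw [List.mem_append, List.mem_singleton] at hu
      rcases hu with hu | rfl
      swap
      · exact .refl
      obtain ⟨l', c, rfl⟩ : ∃ l' c, l = l' ++ [c] :=
        ⟨l.dropLast, l.getLast (List.ne_nil_of_mem hu), (List.dropLast_append_getLast _).symm⟩
      refine (ih (b :: l₂) (by rw [hl]; simp) c (by simp) u hu).tail ⟨?_, ?_, ?_⟩
      · exact Or.inr (h.consecutive _ hC c b ⟨l', l₂, by rw [hl]; simp⟩)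
      · rintro rfl
        rw [hl] at hnd
        simp [List.nodup_append] at hnd
      · intro D hD hbD
        rw [← h.eq_of_mem hC hD (by rw [hl]; simp) hbD, hl]
        simp
  have hu' : u ∈ pre ++ [v] := by
    rw [List.mem_append, List.mem_cons] at hu
    rcases hu with hu | rfl | hu
    · simp [hu]
    · simp
    · rw [List.pairwise_append, List.pairwise_cons] at hp
      have := huv.antisymm h.dag (hp.2.1.1 u hu)
      simp [this]
  exact key (pre ++ [v]) post (by simp) v (by simp) u hu'

/-- A walk always exists: it goes to the entry point of the chain of `v` and along that chain, or,
if `v` is itself an entry point or uncovered, to the predecessor of `v` on any path. -/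
theorem exists_vWalk [Finite V] (h : IsSetup G 𝒞 H) (hxv : Reaches G x v) :
    ∃ k, VWalk G 𝒞 H x v k := by
  induction v using h.wf_adj.induction with
  | _ v ih =>
    rcases eq_or_ne x v with rfl | hne
    · obtain ⟨k, -, hk⟩ := exists_vWalk_self G 𝒞 H x
      exact ⟨k, hk⟩
    by_cases hC : ∃ C ∈ 𝒞, v ∈ C ∧ ¬ IsEntry G x C v
    · obtain ⟨C, hC, hvC, hv⟩ := hC
      obtain ⟨w, hw⟩ := exists_isEntry hvC hxv
      have hw' := (h.isEntry_iff hC).1 hw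
      have hwv := hw'.2.2 v hvC hxv
      obtain ⟨k, hk⟩ := ih w ⟨hwv, fun he => hv (he ▸ hw)⟩ hw'.2.1
      exact ⟨k, hk.stays (h.stays_of_reaches hC hw'.1 hvC hwv)⟩
    · push Not at hC
      rcases Relation.ReflTransGen.cases_tail hxv with he | ⟨u, hxu, huv⟩
      · exact absurd he.symm hne
      have huv' : u ≠ v := by
        rintro rfl
        exact h.dag u (Relation.TransGen.single huv)
      obtain ⟨k, hk⟩ := ih u ⟨Relation.ReflTransGen.single huv, huv'⟩ hxu
      by_cases hvc : Covered 𝒞 v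
      · obtain ⟨C, hC', hvC⟩ := hvc
        obtain ⟨j, -, hj⟩ := hk.exists_adj h (Or.inl huv) huv' hC' (hC C hC' hvC)
        exact ⟨j, hj⟩
      · exact ⟨k, .stay hk ⟨Or.inl huv, huv', fun C hC hvC => absurd ⟨C, hC, hvC⟩ hvc⟩⟩

end

end

section

variable {V : Type} {G : Digraph V} {𝒞 : Finset (List V)} {H : Set (V × V)} {C D : List V}
  {a x y u v w z : V} {k : ℕ} {p : List V}

/-! ### Normalized distances -/

/-- `p` is a valid path from `x` to `v` that meets `k` chains; its vertices are listed in the order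
of reachability. -/
structure IsValidList (G : Digraph V) (𝒞 : Finset (List V)) (H : Set (V × V)) (x v : V)
    (p : List V) (k : ℕ) : Prop where
  head : p.head? = some x
  last : p.getLast? = some v
  isChain : p.IsChain (addEdges G H).Adj
  pairwise : p.Pairwise fun u w => Reaches G u w ∧ u ≠ w
  valid : IsValid G 𝒞 x p
  chainsOn_eq : chainsOn 𝒞 p = k

theorem IsValidList.reaches_last (hp : IsValidList G 𝒞 H x v p k) (hu : u ∈ p) :
    Reaches G u v := by
  obtain ⟨q, rfl⟩ : ∃ q, p = q ++ [v] := List.getLast?_eq_some_iff.1 hp.last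
  rw [List.mem_append, List.mem_singleton] at hu
  rcases hu with hu | rfl
  · exact ((List.pairwise_append.1 hp.pairwise).2.2 u hu v (by simp)).1
  · exact .refl

theorem IsValidList.mem_last (hp : IsValidList G 𝒞 H x v p k) : v ∈ p :=
  List.mem_of_getLast? hp.last

theorem IsValidList.isChain_append (hp : IsValidList G 𝒞 H x v p k)
    (hvw : (addEdges G H).Adj v w) : (p ++ [w]).IsChain (addEdges G H).Adj := by
  rw [List.isChain_append]
  refine ⟨hp.isChain, by simp, fun y hy z hz => ?_⟩
  rw [hp.last, Option.mem_some_iff] at hy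
  rw [List.head?_singleton, Option.mem_some_iff] at hz
  rwa [← hy, ← hz]

theorem IsValidList.pairwise_append (h : IsSetup G 𝒞 H) (hp : IsValidList G 𝒞 H x v p k)
    (hvw : (addEdges G H).Adj v w) (hne : v ≠ w) :
    (p ++ [w]).Pairwise fun u w => Reaches G u w ∧ u ≠ w := by
  rw [List.pairwise_append]
  refine ⟨hp.pairwise, by simp, fun y hy z hz => ?_⟩
  rw [List.mem_singleton] at hz
  subst hz
  have h1 := hp.reaches_last hy
  have h2 := h.reaches_of_adj hvw
  refine ⟨h1.trans h2, ?_⟩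
  rintro rfl
  exact hne (h2.antisymm h.dag h1)

theorem isValid_append_of_not_mem {C : List V}
    (h1 : ∃ pre seg post, p = pre ++ seg ++ post ∧
      (∀ x ∈ pre, x ∉ C) ∧ (∀ x ∈ seg, x ∈ C) ∧ (∀ x ∈ post, x ∉ C) ∧
      ∃ w, IsEntry G x C w ∧ seg.head? = some w) (hw : w ∉ C) :
    ∃ pre seg post, p ++ [w] = pre ++ seg ++ post ∧
      (∀ x ∈ pre, x ∉ C) ∧ (∀ x ∈ seg, x ∈ C) ∧ (∀ x ∈ post, x ∉ C) ∧
      ∃ w, IsEntry G x C w ∧ seg.head? = some w := by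
  obtain ⟨pre, seg, post, rfl, h2, h3, h4, h5⟩ := h1
  refine ⟨pre, seg, post ++ [w], by simp, h2, h3, ?_, h5⟩
  intro y hy
  rw [List.mem_append, List.mem_singleton] at hy
  rcases hy with hy | rfl
  · exact h4 y hy
  · exact hw

theorem IsValidList.stay (h : IsSetup G 𝒞 H) (hp : IsValidList G 𝒞 H x v p k)
    (hs : StayStep G 𝒞 H v w) : IsValidList G 𝒞 H x w (p ++ [w]) k where
  head := by rw [List.head?_append, hp.head]; rfl
  last := by simp
  isChain := hp.isChain_append hs.1
  pairwise := hp.pairwise_append h hs.1 hs.2.1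
  valid := by
    intro C hC hmeet
    by_cases hwC : w ∈ C
    · have hvC := hs.2.2 C hC hwC
      obtain ⟨pre, seg, post, hpe, h2, h3, h4, e, he, hseg⟩ := hp.valid C hC ⟨v, hp.mem_last, hvC⟩
      have hpost : post = [] := by
        by_contra hne
        have h5 := hp.last
        rw [hpe, List.getLast?_append_of_ne_nil _ hne] at h5
        exact h4 v (List.mem_of_getLast? h5) hvC
      subst hpost
      refine ⟨pre, seg ++ [w], [], by simp [hpe], h2, ?_, by simp, e, he, ?_⟩
      · intro y hy
        rw [List.mem_append, List.mem_singleton] at hy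
        rcases hy with hy | rfl
        · exact h3 y hy
        · exact hwC
      · rw [List.head?_append, hseg]
        rfl
    · obtain ⟨y, hy, hyC⟩ := hmeet
      rw [List.mem_append, List.mem_singleton] at hy
      rcases hy with hy | rfl
      · exact isValid_append_of_not_mem (hp.valid C hC ⟨y, hy, hyC⟩) hwC
      · exact absurd hyC hwC
  chainsOn_eq := by
    rw [← hp.chainsOn_eq]
    unfold chainsOn
    congr 1
    ext C
    refine and_congr_right fun hC => ⟨?_, ?_⟩
    · rintro ⟨y, hy, hyC⟩
      rw [List.mem_append, List.mem_singleton] at hy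
      rcases hy with hy | rfl
      · exact ⟨y, hy, hyC⟩
      · exact ⟨v, hp.mem_last, hs.2.2 C hC hyC⟩
    · rintro ⟨y, hy, hyC⟩
      exact ⟨y, by simp [hy], hyC⟩

theorem IsValidList.enter (h : IsSetup G 𝒞 H) (hp : IsValidList G 𝒞 H x v p k)
    (hvw : (addEdges G H).Adj v w) (hC : C ∈ 𝒞) (hwC : w ∈ C) (hvC : v ∉ C)
    (hw : IsEntry G x C w) : IsValidList G 𝒞 H x w (p ++ [w]) (k + 1) := by
  have hne : v ≠ w := fun he => hvC (he ▸ hwC)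
  -- the entry point of `x` comes after all vertices of `p`, so that `p` does not meet `C`
  have hpC : ∀ z ∈ p, z ∉ C := by
    intro z hz hzC
    obtain ⟨pre, seg, post, hpe, -, -, -, e, he, hseg⟩ := hp.valid C hC ⟨z, hz, hzC⟩
    have hew := h.entry_unique hC he hw
    have hep : e ∈ p := by
      rw [hpe]
      simp [List.mem_of_mem_head? hseg]
    rw [hew] at hep
    exact hne ((h.reaches_of_adj hvw).antisymm h.dag (hp.reaches_last hep))
  refine ⟨by rw [List.head?_append, hp.head]; rfl, by simp, hp.isChain_append hvw,
    hp.pairwise_append h hvw hne, ?_, ?_⟩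
  · intro D hD hmeet
    by_cases hDC : D = C
    · subst hDC
      exact ⟨p, [w], [], by simp, hpC, by simpa using hwC, by simp, w, hw, by simp⟩
    · have hwD : w ∉ D := fun hwD => hDC (h.eq_of_mem hD hC hwD hwC)
      obtain ⟨y, hy, hyD⟩ := hmeet
      rw [List.mem_append, List.mem_singleton] at hy
      rcases hy with hy | rfl
      · exact isValid_append_of_not_mem (hp.valid D hD ⟨y, hy, hyD⟩) hwD
      · exact absurd hyD hwD
  · rw [← hp.chainsOn_eq]
    unfold chainsOn
    rw [← Set.ncard_insert_of_notMem (a := C) (s := {C | C ∈ 𝒞 ∧ ∃ x ∈ p, x ∈ C})]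
    · congr 1
      ext D
      simp only [Set.mem_insert_iff, Set.mem_ofPred_eq]
      constructor
      · rintro ⟨hD, y, hy, hyD⟩
        rw [List.mem_append, List.mem_singleton] at hy
        rcases hy with hy | rfl
        · exact Or.inr ⟨hD, y, hy, hyD⟩
        · exact Or.inl (h.eq_of_mem hD hC hyD hwC)
      · rintro (rfl | ⟨hD, y, hy, hyD⟩)
        · exact ⟨hC, w, by simp, hwC⟩
        · exact ⟨hD, y, by simp [hy], hyD⟩
    · rintro ⟨-, z, hz, hzC⟩
      exact hpC z hz hzC

theorem isValidList_singleton (h : IsSetup G 𝒞 H) (x : V) :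
    ∃ k, IsValidList G 𝒞 H x x [x] k ∧ VWalk G 𝒞 H x x k := by
  have hvalid : IsValid G 𝒞 x [x] := by
    rintro C hC ⟨y, hy, hyC⟩
    rw [List.mem_singleton] at hy
    subst hy
    refine ⟨[], [y], [], by simp, by simp, by simpa using hyC, by simp, y, ?_, by simp⟩
    rw [h.isEntry_iff hC]
    exact ⟨hyC, .refl, fun z _ hz => hz⟩
  refine ⟨chainsOn 𝒞 [x], ⟨by simp, by simp, by simp, by simp, hvalid, rfl⟩, ?_⟩
  by_cases hx : Covered 𝒞 x
  · have : chainsOn 𝒞 [x] = 1 := by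
      obtain ⟨C, hC, hxC⟩ := hx
      unfold chainsOn
      rw [Set.ncard_eq_one]
      refine ⟨C, ?_⟩
      ext D
      simp only [List.mem_singleton, exists_eq_left, Set.mem_ofPred_eq, Set.mem_singleton_iff]
      exact ⟨fun hD => h.eq_of_mem hD.1 hC hD.2 hxC, fun hD => hD ▸ ⟨hC, hxC⟩⟩
    rw [this]
    exact .start_covered hx
  · have : chainsOn 𝒞 [x] = 0 := by
      unfold chainsOn
      rw [Set.ncard_eq_zero ((Finset.finite_toSet 𝒞).subset fun D hD => hD.1)]
      ext D
      simp only [List.mem_singleton, exists_eq_left, Set.mem_ofPred_eq, Set.mem_empty_iff_false,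
        iff_false]
      exact fun hD => hx ⟨D, hD⟩
    rw [this]
    exact .start_uncovered hx

theorem VWalk.exists_isValidList (h : IsSetup G 𝒞 H) (hv : VWalk G 𝒞 H x v k) :
    ∃ p, IsValidList G 𝒞 H x v p k := by
  induction hv with
  | start_covered hx =>
    obtain ⟨k, hk, hk'⟩ := isValidList_singleton h x
    have := hk'.pos hx
    cases hk' with
    | start_covered _ => exact ⟨_, hk⟩
    | start_uncovered hx' => exact absurd hx hx'
    | stay hw hs => exact absurd ((h.reaches_of_adj hs.1).antisymm h.dag (hw.reaches h)) hs.2.1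
    | enter hw h1 h2 h3 h4 h5 =>
      exact absurd ((h.reaches_of_adj h1).antisymm h.dag (hw.reaches h)) fun he => h4 (he ▸ h3)
  | start_uncovered hx =>
    obtain ⟨k, hk, hk'⟩ := isValidList_singleton h x
    cases hk' with
    | start_covered hx' => exact absurd hx' hx
    | start_uncovered _ => exact ⟨_, hk⟩
    | stay hw hs => exact absurd ((h.reaches_of_adj hs.1).antisymm h.dag (hw.reaches h)) hs.2.1
    | enter hw h1 h2 h3 h4 h5 => exact absurd ⟨_, h2, h3⟩ hx
  | stay _ hs ih =>
    obtain ⟨p, hp⟩ := ih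
    exact ⟨_, hp.stay h hs⟩
  | enter _ h1 h2 h3 h4 h5 ih =>
    obtain ⟨p, hp⟩ := ih
    exact ⟨_, hp.enter h h1 h2 h3 h4 h5⟩

theorem isChain_of_forall_mem {R : V → V → Prop} {l : List V} (h : ∀ u ∈ l, ∀ v ∈ l, R u v) :
    l.IsChain R := by
  refine List.Pairwise.isChain (List.pairwise_iff_forall_sublist.2 fun huv => ?_)
  exact h _ (huv.subset (by simp)) _ (huv.subset (by simp))

/-- In a valid path, a chain is only entered at the entry point. -/
theorem IsValid.isEntry {l r : List V} (hp : IsValid G 𝒞 x (l ++ v :: w :: r)) (hC : C ∈ 𝒞)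
    (hw : w ∈ C) (hv : v ∉ C) : IsEntry G x C w := by
  obtain ⟨pre, seg, post, hpe, h2, h3, h4, e, he, hseg⟩ := hp C hC ⟨w, by simp, hw⟩
  have hchain : (l ++ v :: w :: r).IsChain fun v w => w ∈ C → v ∈ C ∨ w = e := by
    rw [hpe, List.isChain_append, List.isChain_append]
    refine ⟨⟨?_, ?_, ?_⟩, ?_, ?_⟩
    · exact isChain_of_forall_mem fun u _ v hv hvC => absurd hvC (h2 v hv)
    · exact isChain_of_forall_mem fun u hu v _ _ => Or.inl (h3 u hu)
    · intro u _ v hv _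
      rw [hseg] at hv
      exact Or.inr (Option.mem_some_iff.1 hv).symm
    · exact isChain_of_forall_mem fun u _ v hv hvC => absurd hvC (h4 v hv)
    · intro u _ v hv hvC
      exact absurd hvC (h4 v (List.mem_of_mem_head? hv))
  rw [List.isChain_append, List.isChain_cons_cons] at hchain
  rcases hchain.2.1.1 hw with h | h
  · exact absurd h hv
  · rwa [h]

/-- Every valid path is a walk as in `VWalk`. -/
theorem exists_vWalk_of_isValid (h : IsSetup G 𝒞 H) (hp : IsPathFromTo (addEdges G H) x v p)
    (hvalid : IsValid G 𝒞 x p) : VWalk G 𝒞 H x v (chainsOn 𝒞 p) := by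
  obtain ⟨⟨hp0, hnd, hch⟩, hhead, hlast⟩ := hp
  have key : ∀ l₁ l₂ : List V, p = l₁ ++ l₂ → ∀ u, l₁.getLast? = some u →
      ∃ k, IsValidList G 𝒞 H x u l₁ k ∧ VWalk G 𝒞 H x u k := by
    intro l₁
    induction l₁ using List.reverseRecOn with
    | nil => simp
    | append_singleton l b ih =>
      intro l₂ hl u hu
      rw [List.getLast?_concat, Option.some.injEq] at hu
      subst hu
      rcases List.eq_nil_or_concat l with rfl | ⟨l, c, rfl⟩
      · rw [hl] at hhead
        simp only [List.nil_append, List.cons_append, List.head?_cons, Option.some.injEq] at hhead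
        subst hhead
        exact isValidList_singleton h b
      · rw [List.concat_eq_append] at *
        obtain ⟨k, hk, hk'⟩ := ih (b :: l₂) (by rw [hl]; simp) c (by simp)
        have hl' : p = l ++ c :: b :: l₂ := by rw [hl]; simp
        have hcb : (addEdges G H).Adj c b := by
          rw [hl', List.isChain_append, List.isChain_cons_cons] at hch
          exact hch.2.1.1
        have hne : c ≠ b := by
          rintro rfl
          rw [hl'] at hnd
          simp [List.nodup_append] at hnd
        by_cases hC : ∃ C ∈ 𝒞, b ∈ C ∧ c ∉ C
        · obtain ⟨C, hC, hbC, hcC⟩ := hC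
          have he : IsEntry G x C b := by
            rw [hl'] at hvalid
            exact hvalid.isEntry hC hbC hcC
          exact ⟨k + 1, hk.enter h hcb hC hbC hcC he, .enter hk' hcb hC hbC hcC he⟩
        · push Not at hC
          exact ⟨k, hk.stay h ⟨hcb, hne, hC⟩, .stay hk' ⟨hcb, hne, hC⟩⟩
  obtain ⟨k, hk, hk'⟩ := key p [] (by simp) v hlast
  rwa [hk.chainsOn_eq]

/-- The normalized distance as a natural number: the least number of chains on a walk as in
`VWalk`, and `0` if there is none. -/
noncomputable def vDist (G : Digraph V) (𝒞 : Finset (List V)) (H : Set (V × V)) (x v : V) : ℕ :=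
  sInf {k | VWalk G 𝒞 H x v k}

theorem vDist_le (hv : VWalk G 𝒞 H x v k) : vDist G 𝒞 H x v ≤ k := Nat.sInf_le hv

theorem vWalk_vDist [Finite V] (h : IsSetup G 𝒞 H) (hxv : Reaches G x v) :
    VWalk G 𝒞 H x v (vDist G 𝒞 H x v) :=
  Nat.sInf_mem (s := {k | VWalk G 𝒞 H x v k}) (exists_vWalk h hxv)

/-- Valid paths and walks as in `VWalk` define the same distance. -/
theorem normDist_eq [Finite V] (h : IsSetup G 𝒞 H) (hxv : Reaches G x v) :
    normDist G 𝒞 H x v = vDist G 𝒞 H x v := by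
  refine le_antisymm ?_ ?_
  · obtain ⟨p, hp⟩ := (vWalk_vDist h hxv).exists_isValidList h
    have hpath : IsPath (addEdges G H) p :=
      ⟨List.ne_nil_of_mem hp.mem_last, hp.pairwise.imp fun h => h.2, hp.isChain⟩
    refine (iInf₂_le p ⟨⟨hpath, hp.head, hp.last⟩, hp.valid⟩).trans ?_
    rw [hp.chainsOn_eq]
  · refine le_iInf₂ fun p hp => ?_
    exact_mod_cast vDist_le (exists_vWalk_of_isValid h hp.1 hp.2)

theorem vDist_anti [Finite V] (h : IsSetup G 𝒞 H) {H' : Set (V × V)} (hH : H ⊆ H')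
    (hxv : Reaches G x v) : vDist G 𝒞 H' x v ≤ vDist G 𝒞 H x v :=
  vDist_le ((vWalk_vDist h hxv).mono hH)

theorem vDist_self_le (G : Digraph V) (𝒞 : Finset (List V)) (H : Set (V × V)) (x : V) :
    vDist G 𝒞 H x x ≤ 1 := by
  obtain ⟨k, hk, hw⟩ := exists_vWalk_self G 𝒞 H x
  exact (vDist_le hw).trans hk

theorem reaches_of_mem_importantPairs {e : V × V} (he : e ∈ importantPairs G 𝒞) :
    Reaches G e.1 e.2 := by
  obtain ⟨C, -, pre, post, -, h, -⟩ := he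
  exact h

open Classical in
/-- The potential as a natural number. -/
noncomputable def vPotential [Fintype V] (G : Digraph V) (𝒞 : Finset (List V))
    (H : Set (V × V)) : ℕ :=
  ∑ e with e ∈ importantPairs G 𝒞, vDist G 𝒞 H e.1 e.2

theorem potential_eq [Fintype V] (h : IsSetup G 𝒞 H) :
    potential G 𝒞 H = vPotential G 𝒞 H := by
  classical
  unfold potential vPotential
  have h1 : importantPairs G 𝒞 =
      ((Finset.univ.filter fun e => e ∈ importantPairs G 𝒞 : Finset (V × V)) : Set (V × V)) := by
    ext e
    simp
  rw [finsum_mem_congr h1 fun e _ => rfl, finsum_mem_coe_finset]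
  push_cast
  refine Finset.sum_congr rfl fun e he => ?_
  exact normDist_eq h (reaches_of_mem_importantPairs (Finset.mem_filter.1 he).2)

theorem reduction_eq [Fintype V] (h : IsSetup G 𝒞 H) {e : V × V} (he : Reaches G e.1 e.2) :
    reduction G 𝒞 H e = ((vPotential G 𝒞 H - vPotential G 𝒞 (insert e H) : ℕ) : ℕ∞) := by
  unfold reduction
  rw [potential_eq h, potential_eq (h.insert he)]
  push_cast
  rfl

end

section

variable {V : Type} {G : Digraph V} {𝒞 : Finset (List V)} {H : Set (V × V)} {C D : List V}
  {a x y u v w z : V} {k : ℕ}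

/-! ### The step system of a source -/

/-- The entry points of the vertex `a` on the chains. -/
abbrev EntryPoint (G : Digraph V) (𝒞 : Finset (List V)) (a : V) : Type :=
  {w : V // ∃ C ∈ 𝒞, IsEntry G a C w}

/-- Entry points are ordered by reachability. -/
abbrev entryOrder (hG : IsDAG G) (𝒞 : Finset (List V)) (a : V) :
    PartialOrder (EntryPoint G 𝒞 a) where
  le u v := Reaches G u.1 v.1
  le_refl _ := Relation.ReflTransGen.refl
  le_trans _ _ _ := Relation.ReflTransGen.trans
  le_antisymm _ _ h h' := Subtype.ext (Reaches.antisymm hG h h')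

noncomputable instance [Fintype V] : Fintype (EntryPoint G 𝒞 a) := Fintype.ofFinite _

/-- `v` can be entered directly after the chain of `u`. -/
def ChainStep (G : Digraph V) (𝒞 : Finset (List V)) (H : Set (V × V)) (u v : V) : Prop :=
  ∃ w, Relation.ReflTransGen (StayStep G 𝒞 H) u w ∧ (addEdges G H).Adj w v ∧ w ≠ v

theorem ChainStep.mono {H' : Set (V × V)} (hH : H ⊆ H') (h : ChainStep G 𝒞 H u v) :
    ChainStep G 𝒞 H' u v := by
  obtain ⟨w, h1, h2, h3⟩ := h
  exact ⟨w, Relation.ReflTransGen.mono (fun _ _ h => StayStep.mono hH h) _ _ h1,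
    h2.imp_right fun h => hH h, h3⟩

theorem IsSetup.reaches_of_stays (h : IsSetup G 𝒞 H)
    (hs : Relation.ReflTransGen (StayStep G 𝒞 H) u v) : Reaches G u v := by
  induction hs with
  | refl => exact .refl
  | tail _ hs ih => exact ih.trans (h.reaches_of_adj hs.1)

theorem vDist_le_of_chainStep [Finite V] (h : IsSetup G 𝒞 H) (hs : ChainStep G 𝒞 H u v)
    (hxu : Reaches G x u) (hC : C ∈ 𝒞) (hv : IsEntry G x C v) :
    vDist G 𝒞 H x v ≤ vDist G 𝒞 H x u + 1 := by
  obtain ⟨w, h1, h2, h3⟩ := hs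
  obtain ⟨j, hj, hw⟩ := ((vWalk_vDist h hxu).stays h1).exists_adj h h2 h3 hC hv
  exact (vDist_le hw).trans hj

/-- An optimal walk to an entry point `v`, cut at the last chain before `v`. -/
theorem exists_chainStep [Finite V] (h : IsSetup G 𝒞 H) (hC : C ∈ 𝒞) (hv : IsEntry G x C v)
    (hne : x ≠ v) (hd : 2 ≤ vDist G 𝒞 H x v ∨ Covered 𝒞 x) :
    ∃ D ∈ 𝒞, ∃ q, IsEntry G x D q ∧ ChainStep G 𝒞 H q v ∧
      vDist G 𝒞 H x q + 1 ≤ vDist G 𝒞 H x v := by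
  have hxv := ((h.isEntry_iff hC).1 hv).2.1
  obtain ⟨w, j, hj, hw, hwv, hwne⟩ := (vWalk_vDist h hxv).exists_pred h hC hv hne
  have hj0 : j ≠ 0 := by
    rcases hd with hd | hd
    · lia
    · exact (hw.pos hd).ne'
  rcases hw.exists_last_entry h with h0 | ⟨D, hD, q, hq, hxq, hqw⟩
  · exact absurd h0 hj0
  · refine ⟨D, hD, q, hq, ⟨w, hqw, hwv, hwne⟩, ?_⟩
    have := vDist_le hxq
    lia

theorem lt_of_chainStep (h : IsSetup G 𝒞 H) (hs : ChainStep G 𝒞 H u v) :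
    Reaches G u v ∧ u ≠ v := by
  obtain ⟨w, h1, h2, h3⟩ := hs
  have h4 := h.reaches_of_stays h1
  have h5 := h.reaches_of_adj h2
  refine ⟨h4.trans h5, ?_⟩
  rintro rfl
  exact h3 (h5.antisymm h.dag h4)

/-- The step system formed by the entry points of `a`. -/
noncomputable def entrySystem [Finite V] (h : IsSetup G 𝒞 H) (a : V) :
    letI := entryOrder h.dag 𝒞 a
    StepSystem (EntryPoint G 𝒞 a) :=
  letI := entryOrder h.dag 𝒞 a
  { height := fun y => vDist G 𝒞 H a y.1
    cost := fun x y => vDist G 𝒞 H x.1 y.1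
    step := fun u v => ChainStep G 𝒞 H u.1 v.1
    step_lt := fun {u v} hs => by
      obtain ⟨h1, h2⟩ := lt_of_chainStep h hs
      exact lt_of_le_of_ne h1 fun he => h2 (congrArg Subtype.val he)
    height_le := fun {u v} hs => by
      obtain ⟨C, hC, hv⟩ := v.2
      obtain ⟨D, hD, hu⟩ := u.2
      exact vDist_le_of_chainStep h hs ((h.isEntry_iff hD).1 hu).2.1 hC hv
    cost_le := fun {x u v} hs hxu => by
      obtain ⟨C, hC, hv⟩ := v.2
      obtain ⟨D, hD, hx⟩ := x.2
      have hxv : Reaches G x.1 v.1 := Relation.ReflTransGen.trans hxu (lt_of_chainStep h hs).1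
      exact vDist_le_of_chainStep h hs hxu hC
        (h.isEntry_of_reaches hC hv ((h.isEntry_iff hD).1 hx).2.1 hxv)
    cost_self := fun x => vDist_self_le G 𝒞 H x.1
    exists_step := fun {v} hv => by
      obtain ⟨C, hC, hv'⟩ := v.2
      have hne : a ≠ v.1 := by
        intro he
        have := vDist_self_le G 𝒞 H a
        rw [← he] at hv
        lia
      obtain ⟨D, hD, q, hq, hs, hle⟩ := exists_chainStep h hC hv' hne (Or.inl hv)
      refine ⟨⟨q, D, hD, hq⟩, hs, le_antisymm ?_ hle⟩
      exact vDist_le_of_chainStep h hs ((h.isEntry_iff hD).1 hq).2.1 hC hv'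
    back := fun {x v} hxv => by
      obtain ⟨C, hC, hv⟩ := v.2
      obtain ⟨E, hE, hx⟩ := x.2
      have hx' := (h.isEntry_iff hE).1 hx
      have hxv' : Reaches G x.1 v.1 := hxv.le
      have hne : x.1 ≠ v.1 := fun he => hxv.ne (Subtype.ext he)
      obtain ⟨D, hD, q, hq, hs, hle⟩ := exists_chainStep h hC
        (h.isEntry_of_reaches hC hv hx'.2.1 hxv') hne (Or.inr ⟨E, hE, hx'.1⟩)
      have hq' := (h.isEntry_iff hD).1 hq
      obtain ⟨p, hp⟩ := exists_isEntry hq'.1 (hx'.2.1.trans hq'.2.1)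
      have hp' := (h.isEntry_iff hD).1 hp
      have hpq := hp'.2.2 q hq'.1 (hx'.2.1.trans hq'.2.1)
      by_cases hxp : Reaches G x.1 p
      · have hpq' : p = q := hpq.antisymm h.dag (hq'.2.2 p hp'.1 hxp)
        subst hpq'
        exact Or.inl ⟨⟨p, D, hD, hp⟩, hs, hxp, hle⟩
      · obtain ⟨w, h1, h2⟩ := hs
        exact Or.inr ⟨⟨p, D, hD, hp⟩,
          ⟨w, (h.stays_of_reaches hD hp'.1 hq'.1 hpq).trans h1, h2⟩, hxp⟩ }

theorem vPotential_sub [Fintype V] (h : IsSetup G 𝒞 H) {H' : Set (V × V)} (hH : H ⊆ H') :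
    open Classical in
    vPotential G 𝒞 H - vPotential G 𝒞 H' =
      ∑ e with e ∈ importantPairs G 𝒞, (vDist G 𝒞 H e.1 e.2 - vDist G 𝒞 H' e.1 e.2) := by
  classical
  refine (Finset.sum_tsub_distrib _ fun e he => ?_).symm
  exact vDist_anti h hH (reaches_of_mem_importantPairs (Finset.mem_filter.1 he).2)

/-- Adding an edge between two entry points decreases the potential by at least the gain. -/
theorem gain_le [Fintype V] (h : IsSetup G 𝒞 H) (a : V) {u v : EntryPoint G 𝒞 a} (j : ℕ)
    (huv : Reaches G u.1 v.1) :
    letI := entryOrder h.dag 𝒞 a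
    (entrySystem h a).gain u v j ≤
      vPotential G 𝒞 H - vPotential G 𝒞 (insert (u.1, v.1) H) := by
  classical
  let := entryOrder h.dag 𝒞 a
  have h' : IsSetup G 𝒞 (insert (u.1, v.1) H) := h.insert huv
  have hsub : H ⊆ insert (u.1, v.1) H := Set.subset_insert _ _
  rw [vPotential_sub h hsub]
  have hreach : ∀ {i : ℕ} {y z : EntryPoint G 𝒞 a}, (entrySystem h a).reach i y z →
      (entrySystem h' a).reach i y z := by
    intro i
    induction i with
    | zero => exact fun h => h
    | succ i ih =>
      rintro y z ⟨w, hw, hwz⟩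
      exact ⟨w, hw.mono hsub, ih hwz⟩
  have hedge : ∀ x : EntryPoint G 𝒞 a, Reaches G x.1 u.1 →
      vDist G 𝒞 (insert (u.1, v.1) H) x.1 v.1 ≤ vDist G 𝒞 H x.1 u.1 + 1 := by
    intro x hxu
    rcases eq_or_ne u.1 v.1 with he | hne
    · rw [← he]
      exact (vDist_anti h (Set.subset_insert _ _) hxu).trans (Nat.le_succ _)
    · obtain ⟨C, hC, hv⟩ := v.2
      obtain ⟨E, hE, hx⟩ := x.2
      have hxC := h.isEntry_of_reaches hC hv ((h.isEntry_iff hE).1 hx).2.1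
        (hxu.trans huv)
      obtain ⟨i, hi, hw⟩ := ((vWalk_vDist h hxu).mono hsub).exists_adj h'
        (Or.inr (Set.mem_insert _ _)) hne hC hxC
      exact (vDist_le hw).trans hi
  have hterm : ∀ x z : EntryPoint G 𝒞 a, x ≤ u → (entrySystem h a).within j v z →
      vDist G 𝒞 (insert (u.1, v.1) H) x.1 z.1 ≤ vDist G 𝒞 H x.1 u.1 + 1 + j := by
    intro x z hxu hz
    obtain ⟨i, hi, hz⟩ := hz
    have h1 : vDist G 𝒞 (insert (u.1, v.1) H) x.1 z.1 ≤
        vDist G 𝒞 (insert (u.1, v.1) H) x.1 v.1 + i :=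
      StepSystem.cost_le_of_reach (hreach hz) (Relation.ReflTransGen.trans hxu huv : _)
    have h2 := hedge x hxu
    lia
  set T : Finset (EntryPoint G 𝒞 a × EntryPoint G 𝒞 a) :=
    (Finset.univ.filter fun x => x ≤ u) ×ˢ
      (Finset.univ.filter fun z => (entrySystem h a).within j v z) with hT
  calc (entrySystem h a).gain u v j
      = ∑ e ∈ T, (vDist G 𝒞 H e.1.1 e.2.1 - (vDist G 𝒞 H e.1.1 u.1 + 1 + j)) := by
        rw [hT, Finset.sum_product]
        rfl
    _ ≤ ∑ e ∈ T, (vDist G 𝒞 H e.1.1 e.2.1 - vDist G 𝒞 (insert (u.1, v.1) H) e.1.1 e.2.1) := by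
        refine Finset.sum_le_sum fun e he => Nat.sub_le_sub_left ?_ _
        simp only [hT, Finset.mem_product, Finset.mem_filter, Finset.mem_univ, true_and] at he
        exact hterm e.1 e.2 he.1 he.2
    _ = ∑ e ∈ T.image (fun e => (e.1.1, e.2.1)),
          (vDist G 𝒞 H e.1 e.2 - vDist G 𝒞 (insert (u.1, v.1) H) e.1 e.2) := by
        rw [Finset.sum_image]
        intro e _ e' _ hee
        simp only [Prod.mk.injEq] at hee
        exact Prod.ext (Subtype.ext hee.1) (Subtype.ext hee.2)
    _ ≤ _ := by
        refine Finset.sum_le_sum_of_subset fun e he => ?_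
        rw [Finset.mem_image] at he
        obtain ⟨⟨x, z⟩, he, rfl⟩ := he
        simp only [hT, Finset.mem_product, Finset.mem_filter, Finset.mem_univ, true_and] at he ⊢
        obtain ⟨C, hC, hz⟩ := z.2
        obtain ⟨E, hE, hx⟩ := x.2
        have hvz : Reaches G v.1 z.1 := he.2.le
        exact ⟨C, hC, h.isEntry_of_reaches hC hz ((h.isEntry_iff hE).1 hx).2.1
          (Relation.ReflTransGen.trans he.1 (huv.trans hvz))⟩

theorem card_entryPoint_le [Fintype V] (h : IsSetup G 𝒞 H) (a : V) :
    Fintype.card (EntryPoint G 𝒞 a) ≤ 𝒞.card := by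
  rw [← Fintype.card_coe]
  refine Fintype.card_le_of_injective
    (fun w => (⟨w.2.choose, w.2.choose_spec.1⟩ : {C // C ∈ 𝒞})) fun w z hwz => ?_
  have hwz' : w.2.choose = z.2.choose := congrArg Subtype.val hwz
  have h1 := w.2.choose_spec
  have h2 := z.2.choose_spec
  rw [← hwz'] at h2
  exact Subtype.ext (h.entry_unique h1.1 h1.2 h2.2)

/-- If some important pair has large normalized distance, then some edge decreases the potential a
lot. -/
theorem exists_lt_vPotential_sub [Fintype V] (h : IsSetup G 𝒞 H) {e : V × V}
    (he : e ∈ importantPairs G 𝒞)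
    (hT : 4000 * (10 ^ 6 + 1 : ℝ) ^ 252 ≤ vDist G 𝒞 H e.1 e.2)
    (hcard : 𝒞.card ≤ 2 * vDist G 𝒞 H e.1 e.2 ^ 2) :
    ∃ e' : V × V, Reaches G e'.1 e'.2 ∧
      (vDist G 𝒞 H e.1 e.2 : ℝ) ^ 3 / (375 * (10 ^ 6 + 1) ^ 252) <
        (vPotential G 𝒞 H - vPotential G 𝒞 (insert e' H) : ℕ) := by
  let := entryOrder h.dag 𝒞 e.1
  obtain ⟨u, v, j, huv, hlt⟩ := (entrySystem h e.1).exists_lt_gain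
    (T := vDist G 𝒞 H e.1 e.2) (b := ⟨e.2, he⟩) hT rfl ((card_entryPoint_le h e.1).trans hcard)
  refine ⟨(u.1, v.1), huv, hlt.trans_le ?_⟩
  exact_mod_cast gain_le h e.1 j huv

/-- If some important pair has normalized distance at least `3`, then the potential can be
decreased. -/
theorem exists_vPotential_lt [Fintype V] (h : IsSetup G 𝒞 H) {e : V × V}
    (he : e ∈ importantPairs G 𝒞) (hd : 3 ≤ vDist G 𝒞 H e.1 e.2) :
    ∃ e' : V × V, Reaches G e'.1 e'.2 ∧
      0 < vPotential G 𝒞 H - vPotential G 𝒞 (insert e' H) := by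
  classical
  have hr := reaches_of_mem_importantPairs he
  refine ⟨e, hr, ?_⟩
  rw [vPotential_sub h (Set.subset_insert _ _)]
  refine Finset.sum_pos' (fun _ _ => Nat.zero_le _) ⟨e, by simpa using he, ?_⟩
  obtain ⟨C, hC, hv⟩ := he
  have hne : e.1 ≠ e.2 := by
    intro heq
    have := vDist_self_le G 𝒞 H e.1
    rw [← heq] at hd
    lia
  obtain ⟨k, hk, hw⟩ := exists_vWalk_self G 𝒞 (insert e H) e.1
  obtain ⟨j, hj, hw'⟩ := hw.exists_adj (h.insert hr) (Or.inr (Set.mem_insert _ _)) hne hC hv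
  have := vDist_le hw'
  lia

end

section

variable {V : Type} {G : Digraph V} {𝒞 : Finset (List V)} {H H' : Set (V × V)}

/-! ### The number of greedy steps -/

theorem done_iff [Fintype V] (h : IsSetup G 𝒞 H) :
    Done G 𝒞 H ↔ ∀ e ∈ importantPairs G 𝒞,
      vDist G 𝒞 H e.1 e.2 ≤ ⌊(Fintype.card V : ℝ) ^ (1 / 3 : ℝ)⌋₊ := by
  refine forall₂_congr fun e he => ?_
  rw [normDist_eq h (reaches_of_mem_importantPairs he), Nat.cast_le]

theorem card_importantPairs_le [Fintype V] (h : IsSetup G 𝒞 H) :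
    open Classical in
    (Finset.univ.filter fun e => e ∈ importantPairs G 𝒞).card ≤ Fintype.card V * 𝒞.card := by
  classical
  choose! c hc using fun (e : V × V) (he : e ∈ importantPairs G 𝒞) => he
  rw [← Finset.card_univ, ← Finset.card_product]
  refine Finset.card_le_card_of_injOn (fun e => (e.1, c e)) (fun e he => ?_)
    fun e he e' he' hee => ?_
  · have he := (Finset.mem_filter.1 he).2
    simpa using (hc e he).1
  · have he := (Finset.mem_filter.1 he).2
    have he' := (Finset.mem_filter.1 he').2
    simp only [Prod.mk.injEq] at hee
    have h1 := (hc e he).2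
    have h2 := (hc e' he').2
    rw [← hee.1, ← hee.2] at h2
    exact Prod.ext hee.1 (h.entry_unique (hc e he).1 h1 h2)

theorem floor_third_facts {n : ℕ} (hn : 8 ≤ n) {d : ℕ}
    (hd : ⌊(n : ℝ) ^ (1 / 3 : ℝ)⌋₊ < d) :
    3 ≤ d ∧ (n : ℝ) ≤ (d : ℝ) ^ 3 ∧ (n : ℝ) ^ (2 / 3 : ℝ) ≤ (d : ℝ) ^ 2 := by
  have hn0 : (0 : ℝ) ≤ n := Nat.cast_nonneg n
  set s := (n : ℝ) ^ (1 / 3 : ℝ) with hs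
  have hs0 : 0 ≤ s := by positivity
  have hs3 : s ^ 3 = n := by
    rw [hs, ← Real.rpow_natCast, ← Real.rpow_mul hn0]
    norm_num
  have hs2 : s ^ 2 = (n : ℝ) ^ (2 / 3 : ℝ) := by
    rw [hs, ← Real.rpow_natCast, ← Real.rpow_mul hn0]
    norm_num
  have hsd : s ≤ d := (Nat.lt_of_floor_lt hd).le
  have h2 : (2 : ℝ) ≤ s := by
    by_contra! hlt
    have : s ^ 3 < 2 ^ 3 := by gcongr
    rw [hs3] at this
    have h8 : (8 : ℝ) ≤ n := by exact_mod_cast hn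
    linarith
  refine ⟨?_, ?_, ?_⟩
  · have : 2 ≤ ⌊s⌋₊ := Nat.le_floor (by exact_mod_cast h2)
    lia
  · rw [← hs3]
    gcongr
  · rw [← hs2]
    gcongr

/-- The constant in the lower bound for the decrease of the potential in a greedy step. -/
noncomputable def stepConst : ℝ := 1 / (4000 * (10 ^ 6 + 1) ^ 252) ^ 3

theorem stepConst_pos : 0 < stepConst := by
  unfold stepConst
  have : (0 : ℝ) < (10 ^ 6 + 1) ^ 252 := pow_pos (by norm_num) _
  generalize ((10 : ℝ) ^ 6 + 1) ^ 252 = p at this ⊢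
  positivity

theorem stepConst_le : stepConst ≤ 1 / (375 * (10 ^ 6 + 1) ^ 252) ∧ stepConst ≤ 1 := by
  unfold stepConst
  have : (1 : ℝ) ≤ (10 ^ 6 + 1) ^ 252 := one_le_pow₀ (by norm_num)
  generalize ((10 : ℝ) ^ 6 + 1) ^ 252 = p at this ⊢
  have h1 : 4000 * p ≤ (4000 * p) ^ 3 := le_self_pow₀ (by linarith) (by norm_num)
  constructor
  · exact one_div_le_one_div_of_le (by linarith) (by linarith)
  · rw [div_le_one (by linarith)]
    linarith

/-- Before the loop stops, some edge decreases the potential by the order of `d ^ 3`, where `d` is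
the largest normalized distance. -/
theorem exists_large_decrease [Fintype V] (h : IsSetup G 𝒞 H) (hV : 8 ≤ Fintype.card V)
    (hcard : (𝒞.card : ℝ) ≤ 2 * (Fintype.card V : ℝ) ^ (2 / 3 : ℝ)) (hdone : ¬ Done G 𝒞 H) :
    ∃ (e : V × V) (D : ℕ), Reaches G e.1 e.2 ∧ D = vPotential G 𝒞 H - vPotential G 𝒞 (insert e H) ∧
      0 < D ∧ stepConst * Fintype.card V ≤ D ∧
      stepConst / (8 * (Fintype.card V : ℝ) ^ 5) * (vPotential G 𝒞 H : ℝ) ^ 3 ≤ D := by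
  classical
  rw [done_iff h] at hdone
  push Not at hdone
  obtain ⟨e₀, he₀, hlt₀⟩ := hdone
  obtain ⟨e, he, hmax⟩ := Finset.exists_max_image
    (Finset.univ.filter fun e => e ∈ importantPairs G 𝒞) (fun e => vDist G 𝒞 H e.1 e.2)
    ⟨e₀, by simpa using he₀⟩
  simp only [Finset.mem_filter, Finset.mem_univ, true_and] at he hmax
  have hlt := hlt₀.trans_le (hmax e₀ he₀)
  set d := vDist G 𝒞 H e.1 e.2 with hd
  set n := Fintype.card V with hn
  obtain ⟨hd3, hnd, hnd2⟩ := floor_third_facts hV hlt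
  have hn0 : (0 : ℝ) < n := by exact_mod_cast (by lia : 0 < n)
  have hcard' : 𝒞.card ≤ 2 * d ^ 2 := by
    have : (𝒞.card : ℝ) ≤ 2 * (d : ℝ) ^ 2 := hcard.trans (by gcongr)
    exact_mod_cast this
  have hex : ∃ e' : V × V, Reaches G e'.1 e'.2 ∧
      0 < vPotential G 𝒞 H - vPotential G 𝒞 (insert e' H) ∧
      stepConst * (d : ℝ) ^ 3 ≤ (vPotential G 𝒞 H - vPotential G 𝒞 (insert e' H) : ℕ) := by
    rcases le_or_gt (4000 * (10 ^ 6 + 1 : ℝ) ^ 252) (d : ℝ) with hT | hT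
    · obtain ⟨e', he', hlt'⟩ := exists_lt_vPotential_sub h he hT hcard'
      have h1 : stepConst * (d : ℝ) ^ 3 ≤
          (vPotential G 𝒞 H - vPotential G 𝒞 (insert e' H) : ℕ) := by
        refine le_trans ?_ hlt'.le
        rw [div_eq_mul_one_div, mul_comm]
        exact mul_le_mul_of_nonneg_left stepConst_le.1 (pow_nonneg (Nat.cast_nonneg _) _)
      refine ⟨e', he', ?_, h1⟩
      have h2 : 0 < stepConst * (d : ℝ) ^ 3 := mul_pos stepConst_pos
        (pow_pos (by exact_mod_cast (by lia : 0 < d)) _)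
      exact_mod_cast h2.trans_le h1
    · obtain ⟨e', he', hlt'⟩ := exists_vPotential_lt h he hd3
      refine ⟨e', he', hlt', ?_⟩
      have h1 : stepConst * (d : ℝ) ^ 3 ≤ 1 := by
        unfold stepConst
        have h0 : (0 : ℝ) ≤ d := Nat.cast_nonneg d
        generalize 4000 * ((10 : ℝ) ^ 6 + 1) ^ 252 = p at hT ⊢
        have hp : 0 < p := by linarith
        rw [div_mul_eq_mul_div, one_mul, div_le_one (by positivity)]
        gcongr
      refine h1.trans ?_
      exact_mod_cast hlt'
  obtain ⟨e', he', hpos, hle⟩ := hex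
  refine ⟨e', _, he', rfl, hpos, ?_, ?_⟩
  · exact (mul_le_mul_of_nonneg_left hnd stepConst_pos.le).trans hle
  · refine le_trans ?_ hle
    have h1 : (vPotential G 𝒞 H : ℝ) ≤ 2 * (n : ℝ) ^ (5 / 3 : ℝ) * d := by
      have h2 : vPotential G 𝒞 H ≤ n * 𝒞.card * d := by
        refine (Finset.sum_le_card_nsmul _ _ d fun e he => hmax e
          (Finset.mem_filter.1 he).2).trans ?_
        rw [smul_eq_mul]
        exact Nat.mul_le_mul_right _ (card_importantPairs_le h)
      have h3 : (vPotential G 𝒞 H : ℝ) ≤ n * 𝒞.card * d := by exact_mod_cast h2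
      refine h3.trans ?_
      have h4 : (n : ℝ) ^ (5 / 3 : ℝ) = n * (n : ℝ) ^ (2 / 3 : ℝ) := by
        rw [← Real.rpow_one_add' hn0.le (by norm_num)]
        norm_num
      rw [h4]
      calc (n : ℝ) * 𝒞.card * d ≤ n * (2 * (n : ℝ) ^ (2 / 3 : ℝ)) * d := by gcongr
        _ = _ := by ring
    have h5 : ((n : ℝ) ^ (5 / 3 : ℝ)) ^ 3 = (n : ℝ) ^ 5 := by
      rw [← Real.rpow_natCast, ← Real.rpow_mul hn0.le]
      norm_num
    have h6 : (vPotential G 𝒞 H : ℝ) ^ 3 ≤ 8 * (n : ℝ) ^ 5 * (d : ℝ) ^ 3 := by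
      calc (vPotential G 𝒞 H : ℝ) ^ 3 ≤ (2 * (n : ℝ) ^ (5 / 3 : ℝ) * d) ^ 3 := by gcongr
        _ = 8 * ((n : ℝ) ^ (5 / 3 : ℝ)) ^ 3 * (d : ℝ) ^ 3 := by ring
        _ = _ := by rw [h5]
    have hκ := stepConst_pos
    rw [div_mul_eq_mul_div, div_le_iff₀ (by positivity)]
    calc stepConst * (vPotential G 𝒞 H : ℝ) ^ 3
        ≤ stepConst * (8 * (n : ℝ) ^ 5 * (d : ℝ) ^ 3) := by gcongr
      _ = _ := by ring

theorem greedyStep_facts [Fintype V] (h : IsSetup G 𝒞 H) (hV : 8 ≤ Fintype.card V)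
    (hcard : (𝒞.card : ℝ) ≤ 2 * (Fintype.card V : ℝ) ^ (2 / 3 : ℝ)) (hs : GreedyStep G 𝒞 H H') :
    IsSetup G 𝒞 H' ∧ H ⊆ H' ∧ H'.ncard ≤ H.ncard + 1 ∧ vPotential G 𝒞 H' < vPotential G 𝒞 H ∧
      (vPotential G 𝒞 H' : ℝ) + stepConst * Fintype.card V ≤ vPotential G 𝒞 H ∧
      (vPotential G 𝒞 H' : ℝ) + stepConst / (8 * (Fintype.card V : ℝ) ^ 5) *
        (vPotential G 𝒞 H : ℝ) ^ 3 ≤ vPotential G 𝒞 H := by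
  obtain ⟨hdone, e, he, hmax, rfl⟩ := hs
  obtain ⟨e', D, he', hD, hpos, h1, h2⟩ := exists_large_decrease h hV hcard hdone
  have h3 := hmax e' he'
  rw [reduction_eq h he', reduction_eq h he, Nat.cast_le, ← hD] at h3
  have h4 : vPotential G 𝒞 (insert e H) + D ≤ vPotential G 𝒞 H := by lia
  have h5 : (vPotential G 𝒞 (insert e H) : ℝ) + D ≤ vPotential G 𝒞 H := by exact_mod_cast h4
  exact ⟨h.insert he, Set.subset_insert _ _, Set.ncard_insert_le _ _, by lia, by linarith,
    by linarith⟩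

theorem exists_greedyStep [Fintype V] (hV : 8 ≤ Fintype.card V)
    (hdone : ¬ Done G 𝒞 H) : ∃ H', GreedyStep G 𝒞 H H' := by
  have : Nonempty V := Fintype.card_pos_iff.1 (by lia)
  obtain ⟨v⟩ := this
  obtain ⟨e, he, hmax⟩ := Set.exists_max_image {e : V × V | (tc G).Adj e.1 e.2}
    (reduction G 𝒞 H) (Set.toFinite _) ⟨(v, v), Relation.ReflTransGen.refl⟩
  exact ⟨_, hdone, e, he, hmax, rfl⟩

theorem exists_greedyOutput [Fintype V] (h : IsSetup G 𝒞 H) (hV : 8 ≤ Fintype.card V)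
    (hcard : (𝒞.card : ℝ) ≤ 2 * (Fintype.card V : ℝ) ^ (2 / 3 : ℝ)) :
    ∃ H', IsGreedyOutput G 𝒞 H H' := by
  induction hφ : vPotential G 𝒞 H using Nat.strong_induction_on generalizing H with
  | _ φ ih =>
    by_cases hdone : Done G 𝒞 H
    · exact ⟨H, .refl, hdone⟩
    · obtain ⟨H₁, hs⟩ := exists_greedyStep hV hdone
      obtain ⟨h1, -, -, h2, -⟩ := greedyStep_facts h hV hcard hs
      obtain ⟨H', h3, h4⟩ := ih _ (hφ ▸ h2) h1 rfl
      exact ⟨H', h3.head hs, h4⟩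

theorem not_exists_greedySeq [Fintype V] (h : IsSetup G 𝒞 H) (hV : 8 ≤ Fintype.card V)
    (hcard : (𝒞.card : ℝ) ≤ 2 * (Fintype.card V : ℝ) ^ (2 / 3 : ℝ)) :
    ¬ ∃ f : ℕ → Set (V × V), f 0 = H ∧ ∀ i, GreedyStep G 𝒞 (f i) (f (i + 1)) := by
  rintro ⟨f, h0, hf⟩
  have key : ∀ i, IsSetup G 𝒞 (f i) ∧ vPotential G 𝒞 (f i) + i ≤ vPotential G 𝒞 H := by
    intro i
    induction i with
    | zero => exact ⟨h0 ▸ h, by rw [h0]; simp⟩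
    | succ i ih =>
      obtain ⟨h1, -, -, h2, -⟩ := greedyStep_facts ih.1 hV hcard (hf i)
      exact ⟨h1, by lia⟩
  have := (key (vPotential G 𝒞 H + 1)).2
  lia

/-- The invariant of the step count `t` and the potential `φ`: the potential falls to the order of
`n ^ 2` within `n` steps, and from then on linearly. -/
def StepBound (κ n φ t : ℝ) : Prop :=
  φ ^ 2 * (2 * (κ / (8 * n ^ 5)) * t) ≤ 1 ∧ (n ≤ t → φ + κ * n * (t - n) ≤ 2 * n ^ 2 / κ)

/-- The invariant is preserved by a step. The hypothesis `hnt` says that `t` does not jump over `n`,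
which holds for integers. -/
theorem StepBound.succ {κ n φ φ' t : ℝ} (hκ : 0 < κ) (hκ1 : κ ≤ 1) (hn : 1 ≤ n) (hφ' : 0 ≤ φ')
    (ht : 0 ≤ t) (h : StepBound κ n φ t) (hnt : n ≤ t + 1 → n = t + 1 ∨ n ≤ t)
    (h1 : φ' + κ * n ≤ φ) (h2 : φ' + κ / (8 * n ^ 5) * φ ^ 3 ≤ φ) :
    StepBound κ n φ' (t + 1) := by
  obtain ⟨ha, hb⟩ := h
  set μ := κ / (8 * n ^ 5) with hμ
  have hμ0 : 0 < μ := by positivity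
  have hφ0 : 0 < φ := by nlinarith [mul_pos hκ (by linarith : 0 < n)]
  have hA : φ' ^ 2 * (2 * μ * (t + 1)) ≤ 1 := by
    -- with `x = μ * φ ^ 2`, the claim follows from `(1 - x) ^ 2 * (1 + 2 * x) ≤ 1`
    set x := μ * φ ^ 2 with hx
    have hx0 : 0 ≤ x := by positivity
    have h3 : φ' ≤ φ * (1 - x) := by
      rw [hx]
      nlinarith
    have hx1 : x ≤ 1 := by
      by_contra! hlt
      nlinarith
    have h4 : φ' ^ 2 ≤ (φ * (1 - x)) ^ 2 := by gcongr
    have h5 : 0 ≤ (1 - x) ^ 2 := sq_nonneg _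
    calc φ' ^ 2 * (2 * μ * (t + 1)) ≤ (φ * (1 - x)) ^ 2 * (2 * μ * (t + 1)) := by gcongr
      _ = (1 - x) ^ 2 * (φ ^ 2 * (2 * μ * t)) + (1 - x) ^ 2 * (2 * x) := by
        rw [hx]
        ring
      _ ≤ (1 - x) ^ 2 * 1 + (1 - x) ^ 2 * (2 * x) := by gcongr
      _ ≤ 1 := by nlinarith [mul_nonneg (sq_nonneg x) (sub_nonneg.2 hx1)]
  refine ⟨hA, fun hle => ?_⟩
  rcases hnt hle with heq | hle'
  · rw [← heq] at hA ⊢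
    have h3 : φ' ^ 2 ≤ 4 * n ^ 4 / κ := by
      rw [le_div_iff₀ hκ]
      have : φ' ^ 2 * (2 * μ * n) = φ' ^ 2 * κ / (4 * n ^ 4) := by
        rw [hμ]
        field_simp
        ring
      rw [this, div_le_one (by positivity)] at hA
      exact hA
    have h4 : 4 * n ^ 4 / κ ≤ (2 * n ^ 2 / κ) ^ 2 := by
      rw [div_pow, div_le_div_iff₀ hκ (by positivity)]
      have : 0 < n ^ 4 := by positivity
      nlinarith [mul_pos this hκ]
    have h5 : φ' ≤ 2 * n ^ 2 / κ := by
      refine (sq_le_sq₀ hφ' (by positivity)).1 (h3.trans h4)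
    rw [sub_self, mul_zero, add_zero]
    exact h5
  · have := hb hle'
    linarith

theorem StepBound.le {κ n φ t : ℝ} (hκ : 0 < κ) (hn : 1 ≤ n) (hφ : 0 ≤ φ)
    (h : StepBound κ n φ t) : t ≤ (1 + 2 / κ ^ 2) * n := by
  rcases le_or_gt n t with hnt | hnt
  · have h1 := h.2 hnt
    have h2 : κ * n * (t - n) ≤ κ * n * (2 / κ ^ 2 * n) := by
      have : κ * n * (2 / κ ^ 2 * n) = 2 * n ^ 2 / κ := by
        field_simp
      linarith
    have := le_of_mul_le_mul_left h2 (by positivity)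
    linarith
  · have : 0 ≤ 2 / κ ^ 2 * n := by positivity
    linarith

/-- The greedy loop adds only `O(n)` edges. -/
theorem greedy_facts [Fintype V] (h : IsSetup G 𝒞 H) (hV : 8 ≤ Fintype.card V)
    (hcard : (𝒞.card : ℝ) ≤ 2 * (Fintype.card V : ℝ) ^ (2 / 3 : ℝ))
    (hs : Relation.ReflTransGen (GreedyStep G 𝒞) H H') :
    IsSetup G 𝒞 H' ∧ H ⊆ H' ∧
      (H'.ncard : ℝ) ≤ H.ncard + (1 + 2 / stepConst ^ 2) * Fintype.card V := by
  set n := Fintype.card V with hn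
  have hn1 : (1 : ℝ) ≤ n := by exact_mod_cast (by lia : 1 ≤ n)
  have key : IsSetup G 𝒞 H' ∧ H ⊆ H' ∧ ∃ t : ℕ, H'.ncard ≤ H.ncard + t ∧
      StepBound stepConst n (vPotential G 𝒞 H') t := by
    induction hs with
    | refl =>
      refine ⟨h, subset_rfl, 0, le_rfl, by simp, fun hle => ?_⟩
      simp only [Nat.cast_zero] at hle
      linarith
    | tail _ hs ih =>
      obtain ⟨h1, hsub, t, ht, hb⟩ := ih
      obtain ⟨h2, hsub', h3, -, h4, h5⟩ := greedyStep_facts h1 hV hcard hs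
      refine ⟨h2, hsub.trans hsub', t + 1, by lia, ?_⟩
      push_cast
      refine hb.succ stepConst_pos stepConst_le.2 hn1 (Nat.cast_nonneg _) (Nat.cast_nonneg _)
        (fun hle => ?_) h4 h5
      have hle' : n ≤ t + 1 := by exact_mod_cast hle
      rcases Nat.le_succ_iff.1 hle' with hle' | heq
      · exact Or.inr (by exact_mod_cast hle')
      · exact Or.inl (by exact_mod_cast heq)
  obtain ⟨h1, hsub, t, ht, hb⟩ := key
  refine ⟨h1, hsub, ?_⟩
  have h2 := hb.le stepConst_pos hn1 (Nat.cast_nonneg _)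
  have h3 : (H'.ncard : ℝ) ≤ H.ncard + t := by exact_mod_cast ht
  linarith

end

section

variable {V : Type} {G : Digraph V} {𝒞 : Finset (List V)} {H H₀ : Set (V × V)} {C : List V}
  {u v w x y : V} {k : ℕ}

/-! ### The hopbound -/

/-- The vertices of a path in the transitive closure lie on a path of the graph. -/
theorem exists_isPath_of_pairwise (hG : IsDAG G) {l : List V} (hl : l.Pairwise (Reaches G))
    (hl0 : l ≠ []) : ∃ p, IsPath G p ∧ l ⊆ p := by
  obtain ⟨x, l, rfl⟩ := List.exists_cons_of_ne_nil hl0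
  have key : ∃ p, (x :: p).IsChain G.Adj ∧ x :: l ⊆ x :: p := by
    clear hl0
    induction l generalizing x with
    | nil => exact ⟨[], by simp, by simp⟩
    | cons y l ih =>
      rw [List.pairwise_cons] at hl
      obtain ⟨q, hq, hlq⟩ := ih y hl.2
      have hxy : Reaches G x y := hl.1 y (by simp)
      have hex : ∃ p, (x :: p).IsChain G.Adj ∧ y :: q ⊆ x :: p := by
        clear hl
        induction hxy using Relation.ReflTransGen.head_induction_on with
        | refl => exact ⟨q, hq, List.Subset.refl _⟩
        | head h _ ih =>
          obtain ⟨p, hp, hqp⟩ := ih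
          exact ⟨_ :: p, List.isChain_cons_cons.2 ⟨h, hp⟩, List.subset_cons_of_subset _ hqp⟩
      obtain ⟨p, hp, hqp⟩ := hex
      exact ⟨p, hp, List.cons_subset.2 ⟨by simp, List.Subset.trans hlq hqp⟩⟩
  obtain ⟨p, hp, hlp⟩ := key
  refine ⟨x :: p, ⟨by simp, ?_, hp⟩, hlp⟩
  have : IsTrans V (Relation.TransGen G.Adj) := ⟨fun _ _ _ => Relation.TransGen.trans⟩
  have hpw := List.isChain_iff_pairwise.1 (hp.imp fun _ _ h => Relation.TransGen.single h)
  refine hpw.imp fun {a b} hab (he : a = b) => ?_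
  subst he
  exact hG _ hab

/-- A sequence of uncovered vertices, each reaching all later ones, is short. -/
theorem length_le_of_uncovered [Fintype V] (hG : IsDAG G)
    (h𝒞 : IsChainCover G (2 * (Fintype.card V : ℝ) ^ (2 / 3 : ℝ)) 𝒞) {l : List V}
    (hl : l.Pairwise fun u v => Reaches G u v ∧ u ≠ v) (hunc : ∀ v ∈ l, ¬ Covered 𝒞 v) :
    l.length ≤ ⌊(Fintype.card V : ℝ) ^ (1 / 3 : ℝ)⌋₊ := by
  classical
  rcases eq_or_ne l [] with rfl | hl0
  · simp
  obtain ⟨p, hp, hlp⟩ := exists_isPath_of_pairwise hG (hl.imp fun h => h.1) hl0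
  have hV : (0 : ℝ) < Fintype.card V := by
    have : Nonempty V := ⟨l.head hl0⟩
    exact_mod_cast Fintype.card_pos
  have h1 := h𝒞.uncovered_le p hp
  rw [two_mul_div_rpow hV] at h1
  refine Nat.le_floor (le_trans ?_ h1)
  rw [← List.toFinset_card_of_nodup (hl.imp fun h => h.2), ← Set.ncard_coe_finset]
  refine Nat.cast_le.2 (Set.ncard_le_ncard fun v hv => ?_)
  have hv' : v ∈ l := by simpa using hv
  exact ⟨hlp hv', hunc v hv'⟩

theorem pairwise_append_singleton (hG : IsDAG G) {l : List V}
    (hl : l.Pairwise fun u v => Reaches G u v ∧ u ≠ v) (hlv : ∀ u ∈ l, Reaches G u v)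
    (hvw : Reaches G v w) (hne : v ≠ w) :
    (l ++ [w]).Pairwise fun u v => Reaches G u v ∧ u ≠ v := by
  rw [List.pairwise_append]
  refine ⟨hl, by simp, fun u hu z hz => ?_⟩
  rw [List.mem_singleton] at hz
  subst hz
  refine ⟨(hlv u hu).trans hvw, ?_⟩
  rintro rfl
  exact hne (hvw.antisymm hG (hlv u hu))

theorem hops_of_reaches_on_chain (h : IsSetup G 𝒞 H) (h₀ : IsSuperShortcut 𝒞 H₀) (hH : H₀ ⊆ H)
    (hC : C ∈ 𝒞) (hu : u ∈ C) (hv : v ∈ C) (huv : Reaches G u v) :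
    Hops (addEdges G H) 4 u v := by
  rcases eq_or_ne u v with rfl | hne
  · exact Hops.refl _ _
  obtain ⟨i, hi, rfl⟩ := List.getElem_of_mem hu
  obtain ⟨j, hj, rfl⟩ := List.getElem_of_mem hv
  have hij : i < j := by
    by_contra! hle
    rcases hle.eq_or_lt with rfl | hlt
    · exact hne rfl
    · exact hne (huv.antisymm h.dag (List.pairwise_iff_getElem.1 (h.pairwise hC) j i hj hi hlt))
  have h4 := h₀.four_hops C hC _ _ (pair_sublist_iff.2 ⟨i, j, hi, hj, hij, rfl, rfl⟩)
  exact (DistLE.hops (b := 4) (by exact_mod_cast h4)).mono_graph fun _ _ h => Or.inr (hH h)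

/-- A valid walk needs at most `5` hops for each chain and one for each uncovered vertex. -/
theorem VWalk.exists_hops (h : IsSetup G 𝒞 H) (h₀ : IsSuperShortcut 𝒞 H₀) (hH : H₀ ⊆ H)
    (hv : VWalk G 𝒞 H x v k) :
    ∃ l : List V, (l.Pairwise fun u v => Reaches G u v ∧ u ≠ v) ∧ (∀ u ∈ l, Reaches G u v) ∧
      (∀ u ∈ l, ¬ Covered 𝒞 u) ∧ Hops (addEdges G H) (5 * k + l.length) x v := by
  -- on a chain, the hops are counted only up to the entry point
  suffices hs : ∃ l : List V, (l.Pairwise fun u v => Reaches G u v ∧ u ≠ v) ∧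
      (∀ u ∈ l, Reaches G u v) ∧ (∀ u ∈ l, ¬ Covered 𝒞 u) ∧
      ((¬ Covered 𝒞 v ∧ Hops (addEdges G H) (5 * k + l.length) x v) ∨
        ∃ C ∈ 𝒞, v ∈ C ∧ ∃ q ∈ C, Reaches G q v ∧ ∃ j, j + 4 = 5 * k ∧
          Hops (addEdges G H) (j + l.length) x q) by
    obtain ⟨l, h1, h2, h3, h4 | ⟨C, hC, hvC, q, hq, hqv, j, hj, h4⟩⟩ := hs
    · exact ⟨l, h1, h2, h3, h4.2⟩
    · refine ⟨l, h1, h2, h3, ?_⟩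
      exact (h4.trans (hops_of_reaches_on_chain h h₀ hH hC hq hvC hqv)).mono (by lia)
  induction hv with
  | start_covered hx =>
    obtain ⟨C, hC, hxC⟩ := hx
    exact ⟨[], by simp, by simp, by simp,
      Or.inr ⟨C, hC, hxC, x, hxC, .refl, 1, rfl, Hops.refl _ _⟩⟩
  | start_uncovered hx =>
    refine ⟨[x], by simp, ?_, by simpa using hx, Or.inl ⟨hx, Hops.refl _ _⟩⟩
    intro u hu
    rw [List.mem_singleton] at hu
    subst hu
    exact .refl
  | stay _hw hs ih =>
    rename_i v v' k
    obtain ⟨l, h1, h2, h3, h4⟩ := ih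
    have hvv' := h.reaches_of_adj hs.1
    by_cases hc : Covered 𝒞 v'
    · obtain ⟨C, hC, hvC'⟩ := hc
      have hvC := hs.2.2 C hC hvC'
      rcases h4 with h4 | ⟨D, hD, hvD, q, hq, hqv, hj⟩
      · exact absurd ⟨C, hC, hvC⟩ h4.1
      · obtain rfl := h.eq_of_mem hC hD hvC hvD
        exact ⟨l, h1, fun u hu => (h2 u hu).trans hvv', h3,
          Or.inr ⟨C, hC, hvC', q, hq, hqv.trans hvv', hj⟩⟩
    · have hhops : Hops (addEdges G H) (5 * k + l.length) x v := by
        rcases h4 with h4 | ⟨D, hD, hvD, q, hq, hqv, j, hj, h4⟩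
        · exact h4.2
        · exact (h4.trans (hops_of_reaches_on_chain h h₀ hH hD hq hvD hqv)).mono (by lia)
      refine ⟨l ++ [v'], pairwise_append_singleton h.dag h1 h2 hvv' hs.2.1, ?_, ?_,
        Or.inl ⟨hc, ?_⟩⟩
      · intro u hu
        rw [List.mem_append, List.mem_singleton] at hu
        rcases hu with hu | rfl
        · exact (h2 u hu).trans hvv'
        · exact .refl
      · intro u hu
        rw [List.mem_append, List.mem_singleton] at hu
        rcases hu with hu | rfl
        · exact h3 u hu
        · exact hc
      · rw [List.length_append, List.length_singleton, ← Nat.add_assoc]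
        exact hhops.trans (Hops.of_adj hs.1)
  | enter _hw hadj hC hvC' hvC he ih =>
    rename_i v v' C k
    obtain ⟨l, h1, h2, h3, h4⟩ := ih
    have hvv' := h.reaches_of_adj hadj
    have hhops : Hops (addEdges G H) (5 * k + l.length) x v := by
      rcases h4 with h4 | ⟨D, hD, hvD, q, hq, hqv, j, hj, h4⟩
      · exact h4.2
      · exact (h4.trans (hops_of_reaches_on_chain h h₀ hH hD hq hvD hqv)).mono (by lia)
    refine ⟨l, h1, fun u hu => (h2 u hu).trans hvv', h3,
      Or.inr ⟨C, hC, hvC', v', hvC', .refl, 5 * k + 1, by lia, ?_⟩⟩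
    exact (hhops.trans (Hops.of_adj hadj)).mono (by lia)

/-- A path in the graph leaves its last covered vertex (or its start) through uncovered
vertices. -/
theorem exists_last_covered (hG : IsDAG G) (𝒞 : Finset (List V)) {s t : V}
    (hst : Reaches G s t) : ∃ c, (c = s ∨ Covered 𝒞 c) ∧ Reaches G s c ∧ ∃ l : List V,
      (l.Pairwise fun u v => Reaches G u v ∧ u ≠ v) ∧ (∀ u ∈ l, Reaches G u t) ∧
      (∀ u ∈ l, ¬ Covered 𝒞 u) ∧ Hops G l.length c t := by
  induction hst with
  | refl => exact ⟨s, Or.inl rfl, .refl, [], by simp, by simp, by simp, Hops.refl _ _⟩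
  | tail hsv hvw ih =>
    rename_i v w
    by_cases hw : Covered 𝒞 w
    · exact ⟨w, Or.inr hw, Relation.ReflTransGen.tail hsv hvw, [], by simp, by simp, by simp,
        Hops.refl _ _⟩
    obtain ⟨c, hc, hsc, l, h1, h2, h3, h4⟩ := ih
    have hne : v ≠ w := by
      rintro rfl
      exact hG v (Relation.TransGen.single hvw)
    have hvw' : Reaches G v w := Relation.ReflTransGen.single hvw
    refine ⟨c, hc, hsc, l ++ [w], pairwise_append_singleton hG h1 h2 hvw' hne, ?_, ?_, ?_⟩
    · intro u hu
      rw [List.mem_append, List.mem_singleton] at hu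
      rcases hu with hu | rfl
      · exact (h2 u hu).trans hvw'
      · exact .refl
    · intro u hu
      rw [List.mem_append, List.mem_singleton] at hu
      rcases hu with hu | rfl
      · exact h3 u hu
      · exact hw
    · rw [List.length_append, List.length_singleton]
      exact h4.trans (Hops.of_adj hvw)

/-- When the loop stops, `t` is reached from `s` by a valid path to the entry point on the chain of
the last covered vertex of some path, along this chain, and through uncovered vertices. -/
theorem hops_of_done [Fintype V] (h : IsSetup G 𝒞 H) (hV : 0 < Fintype.card V)
    (h𝒞 : IsChainCover G (2 * (Fintype.card V : ℝ) ^ (2 / 3 : ℝ)) 𝒞) (h₀ : IsSuperShortcut 𝒞 H₀)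
    (hH : H₀ ⊆ H) (hdone : Done G 𝒞 H) {s t : V} (hst : Reaches G s t) :
    Hops (addEdges G H) (11 * ⌊(Fintype.card V : ℝ) ^ (1 / 3 : ℝ)⌋₊) s t := by
  have hm1 : 1 ≤ ⌊(Fintype.card V : ℝ) ^ (1 / 3 : ℝ)⌋₊ := by
    refine Nat.le_floor ?_
    have : (1 : ℝ) ≤ Fintype.card V := by exact_mod_cast hV
    simpa using Real.one_le_rpow this (by norm_num)
  obtain ⟨c, hc, hsc, l, h1, -, h3, h4⟩ := exists_last_covered h.dag 𝒞 hst
  have hl := length_le_of_uncovered h.dag h𝒞 h1 h3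
  have h4' : Hops (addEdges G H) l.length c t := h4.mono_graph fun _ _ h => Or.inl h
  rw [done_iff h] at hdone
  set m := ⌊(Fintype.card V : ℝ) ^ (1 / 3 : ℝ)⌋₊ with hm
  rcases hc with rfl | ⟨C, hC, hcC⟩
  · exact h4'.mono (by lia)
  obtain ⟨w, hw⟩ := exists_isEntry hcC hsc
  have hw' := (h.isEntry_iff hC).1 hw
  have hd := hdone (s, w) ⟨C, hC, hw⟩
  obtain ⟨l', h1', -, h3', h5⟩ := (vWalk_vDist h hw'.2.1).exists_hops h h₀ hH
  have hl' := length_le_of_uncovered h.dag h𝒞 h1' h3'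
  have h6 := hops_of_reaches_on_chain h h₀ hH hC hw'.1 hcC (hw'.2.2 c hcC hsc)
  simp only at hd
  exact ((h5.trans h6).trans h4').mono (by lia)

end

end ChainGreedy

/-! ### The output of the greedy loop -/

theorem mainTheorem4 :
    ∃ c₀ : ℝ, ∀ c : ℝ, c₀ ≤ c → ∃ K : ℝ,
      ∀ (V : Type) [Fintype V] (G : Digraph V), ChainGreedy.IsDAG G → 8 ≤ Fintype.card V →
        (∃ 𝒞 : Finset (List V),
          ChainGreedy.IsChainCover G (2 * (Fintype.card V : ℝ) ^ (2 / 3 : ℝ)) 𝒞) ∧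
        ∀ 𝒞 : Finset (List V),
          ChainGreedy.IsChainCover G (2 * (Fintype.card V : ℝ) ^ (2 / 3 : ℝ)) 𝒞 →
          (∃ H₀ : Set (V × V), ChainGreedy.IsSuperShortcut 𝒞 H₀ ∧
            (H₀.ncard : ℝ) ≤ c * (Fintype.card V * ChainGreedy.logStar (Fintype.card V))) ∧
          ∀ H₀ : Set (V × V), ChainGreedy.IsSuperShortcut 𝒞 H₀ →
            (H₀.ncard : ℝ) ≤ c * (Fintype.card V * ChainGreedy.logStar (Fintype.card V)) →
            (¬ ∃ f : ℕ → Set (V × V), f 0 = H₀ ∧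
              ∀ i, ChainGreedy.GreedyStep G 𝒞 (f i) (f (i + 1))) ∧
            (∃ H : Set (V × V), ChainGreedy.IsGreedyOutput G 𝒞 H₀ H) ∧
            ∀ H : Set (V × V), ChainGreedy.IsGreedyOutput G 𝒞 H₀ H →
              ChainGreedy.IsShortcutSet G H (K * (Fintype.card V : ℝ) ^ (1 / 3 : ℝ)) ∧
              (H.ncard : ℝ) ≤ K * (Fintype.card V * ChainGreedy.logStar (Fintype.card V)) := by
  refine ⟨9, fun c hc => ⟨max 11 (c + (1 + 2 / ChainGreedy.stepConst ^ 2)), ?_⟩⟩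
  intro V _ G hG hV
  refine ⟨ChainGreedy.exists_chainCover G (by lia), fun 𝒞 h𝒞 => ⟨?_, fun H₀ h₀ hcard₀ => ?_⟩⟩
  · obtain ⟨H₀, h₀, hcard₀⟩ := ChainGreedy.exists_superShortcut h𝒞 (by lia)
    exact ⟨H₀, h₀, hcard₀.trans (by gcongr)⟩
  have h : ChainGreedy.IsSetup G 𝒞 H₀ :=
    { dag := hG
      isChain := h𝒞.isChain
      disjoint := h𝒞.disjoint
      reaches := fun e he => by
        obtain ⟨C, hC, hsub⟩ := h₀.along e he
        have : IsTrans V (ChainGreedy.Reaches G) :=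
          ⟨fun _ _ _ => Relation.ReflTransGen.trans⟩
        have hch : C.IsChain (ChainGreedy.Reaches G) := (h𝒞.isChain C hC).2.2
        exact List.pairwise_iff_forall_sublist.1 (List.isChain_iff_pairwise.1 hch) hsub
      consecutive := h₀.consecutive }
  refine ⟨ChainGreedy.not_exists_greedySeq h hV h𝒞.card_le,
    ChainGreedy.exists_greedyOutput h hV h𝒞.card_le, fun H hH => ?_⟩
  obtain ⟨hsteps, hdone⟩ := hH
  obtain ⟨hset, hsub, hcard⟩ := ChainGreedy.greedy_facts h hV h𝒞.card_le hsteps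
  refine ⟨⟨hset.reaches, fun s t hst => ?_⟩, ?_⟩
  · obtain ⟨p, hp, hlen⟩ :=
      (ChainGreedy.hops_of_done hset (by lia) h𝒞 h₀ hsub hdone hst).distLE
    refine ⟨p, hp, hlen.trans ?_⟩
    push_cast
    gcongr
    · exact le_max_left _ _
    · exact Nat.floor_le (by positivity)
  · have hlog : (1 : ℝ) ≤ ChainGreedy.logStar (Fintype.card V) := by
      exact_mod_cast ChainGreedy.one_le_logStar (by lia)
    have hpos := ChainGreedy.stepConst_pos
    set A : ℝ := 1 + 2 / ChainGreedy.stepConst ^ 2 with hA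
    have hA0 : 0 ≤ A := by positivity
    set n : ℝ := (Fintype.card V : ℝ) with hn
    set L : ℝ := (ChainGreedy.logStar (Fintype.card V) : ℝ) with hL
    have hn0 : 0 ≤ n := Nat.cast_nonneg _
    have h1 : A * n ≤ A * (n * L) := by
      gcongr
      exact le_mul_of_one_le_right hn0 hlog
    calc (H.ncard : ℝ) ≤ c * (n * L) + A * (n * L) := by linarith
      _ = (c + A) * (n * L) := by ring
      _ ≤ _ := by
        gcongr
        exact le_max_right _ _
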